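/- Let $p\ge 1$ be an odd integer, $q$ a primitive $p$-th root of unity, $q^{1/2}$ the square root of $q$ with $(q^{1/2})^p=-1$, and $r$ a real number; $r^{1/p}$ denotes the real $p$-th root and $[n]=\frac{q^n-q^{-n}}{q-q^{-1}}$, $[n]!=[n]\cdots[1]$. **The quantum group.** Let $\mathcal A_q$ be the complex algebra generated by $\eta_+,\eta_-,\delta$ with $\eta_-\eta_+=q^2\eta_+\eta_-$, $\eta_\pm\delta=q^2\delta\eta_\pm$, $\eta_\pm^p=0$, $\delta^p=1$, with the antilinear anti-involution $\eta_\pm^*=\eta_\pm$, $\delta^*=\delta$, and let $\zeta(k,\delta)=\frac1p\sum_{n=0}^{p-1}q^{-nk}\delta^n$ $(k\in\mathbb Z/p)$. Let $\mathcal A_F$ be the algebra of $\mathcal A_q$-valued smooth functions of $g_0=(z_+,z_-,\lambda)\in\mathbb R^3$, with $\Delta(\delta)=\delta\otimes\delta$, $\Delta(\lambda)=\lambda\otimes1+1\otimes\lambda$, $\Delta(\eta_\pm)=\eta_\pm\otimes1+\delta^{\pm1}e^{\mp\lambda/p}\otimes\eta_\pm$, $$\Delta(z_\pm)=z_\pm\otimes1+e^{\mp\lambda}\otimes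 z_\pm+(-1)^{\frac{p+1}2}\sum_{n=1}^{p-1}\frac{q^{\pm n^2}}{[p-n]![n]!}\eta_\pm^{p-n}\delta^{\pm n}e^{\mp\lambda n/p}\otimes\eta_\pm^n,$$ (smooth functions of $\Delta(z_\pm),\Delta(\lambda)$ being defined by the finite Taylor expansion in the nilpotent parts) and $\varepsilon(\eta_\pm)=\varepsilon(z_\pm)=\varepsilon(\lambda)=0$, $\varepsilon(\delta)=1$. **The representation.** On $C_0^\infty(\mathbb R)\otimes\mathbb C[t]/(t^p-1)$ let $\pi_r(p_\pm)=(-r)^{1/p}e^{\pm x/p}t^{\pm1}$, $\pi_r(P_\pm)=-re^{\pm x}$, $\pi_r(H)=-i\frac{d}{dx}$, and $\pi_r(\kappa)\colon a(t)\mapsto a(qt)$. For $\phi=p_+^np_-^m\kappa^kP_+^{b}P_-^{s}H^{u}$ let $a_\phi=\eta_+^n\eta_-^m\zeta(k+n+m,\delta)z_+^{b}z_-^{s}\lambda^{u}$ and $\langle\phi,a_\phi\rangle=i^{n+m+b+s+u}q^{\frac{n-m}2-nm}\,u!\,b!\,s!\,[n]!\,[m]!$, and let $$T_r(v)=\sum_{n,m,k=0}^{p-1}\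 \sum_{b,s,u\ge0}\frac{a_\phi\,\pi_r(\phi)v}{\langle\phi,a_\phi\rangle}.$$ Let $Q_r$ be its Fourier transform, obtained by applying $F(\nu)=\int_{\mathbb R}f(x)e^{\nu x}dx$ to each term; it acts on the functions $F(\nu)a(t)$, with $F$ the transform of some $f\in C_0^\infty(\mathbb R)$. **Claims.** 1. The series defining $Q_r$ converges absolutely (for all $\nu\in\mathbb C$ and $g_0$), and $Q_r$ is a corepresentation of $\mathcal A_F$ in the space of functions $F(\nu)a(t)$: its coefficients are smooth in $g_0$ and take values in this space, $Q_r$ is linear, $(\varepsilon\otimes\mathrm{id})Q_r=\mathrm{id}$, and $\Delta$ applied to the coefficients of $Q_r$ equals $Q_r$ applied twice (the outer application giving the first tensor factor). It is pseudo-unitary for the form corresponding to $(f_1t^j,f_2t^{k})=\delta_{j+k\equiv0\,(p)}\int f_1\overline{f_2}\,dx$, extended by $(aF,a'G)=a'^*a\,(F,G)$. 2. For $r\ne0$, $z_+\neq 0\neq z_-$ and $-1<\mathrm{Re}(\nu-\mu+s/p)<1$ the (improper) integral $$K_s^r(\nu,\mu,g_0)=\frac{1}{2\pi i}e^{\mu\lambda}\int_{-\infty}^{\infty}e^{ir(e^xz_++e^{-x}z_-)+x(\nu-\mu+s/p)}dx$$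 converges, and for every real $c$ with $|\mathrm{Re}\,\nu-c|<1/p$ and $0\le k<p$ $$Q_r(F(\nu)t^k)=\int_{c-i\infty}^{c+i\infty}d\mu\sum_{l=0}^{p-1}Q^r_{kl}(\nu,\mu,g)F(\mu)t^l ,$$ the integral being absolutely convergent, where with $\xi=q\eta_+\eta_-$, $\delta^{1/2}=\delta^{(p+1)/2}$ and $$\omega^r_s(\xi)=\sum_{m=0}^{p-s-1}\frac{(ir^{1/p})^{2m+s}}{[m]!\,[m+s]!}(q^s\xi)^m$$ (so $\omega^r_p=0$; the term containing it is $0$) the kernel is $$Q^r_{kl}=\delta^{k/2}(q^{-1/2}\eta_+)^{l-k}\omega^r_{l-k}(\xi)\delta^{k/2}K^r_{l-k}+\delta^{k/2}\omega^r_{p+k-l}(\xi)(q^{1/2}\eta_-)^{p+k-l}\delta^{k/2}K^r_{l-k-p}\qquad(l\ge k),$$ $$Q^r_{kl}=\delta^{k/2}(q^{-1/2}\eta_+)^{p+l-k}\omega^r_{p+l-k}(\xi)\delta^{k/2}K^r_{p+l-k}+\delta^{k/2}\omega^r_{k-l}(\xi)(q^{1/2}\eta_-)^{k-l}\delta^{k/2}K^r_{l-k}\qquad(l<k).$$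 3. Let $r>0$, $\rho>0$, $\beta\in\mathbb R$, $s\in\mathbb Z$, $-1<\mathrm{Re}(\nu-\mu+s/p)<1$ and $\alpha=\mu-\nu-s/p$. Then - $z_\pm=\frac12\rho e^{\pm\beta}$: $\ K_s^r=\frac12e^{\alpha(\beta+\frac{\pi i}2)+\mu\lambda}H^{(1)}_\alpha(r\rho)$; - $z_\pm=\pm\frac12\rho e^{\pm\beta}$: $\ K_s^r=\frac1{\pi i}e^{\alpha(\beta-\frac{\pi i}2)+\mu\lambda}K_\alpha(r\rho)$; - $z_\pm=-\frac12\rho e^{\pm\beta}$: $\ K_s^r=-\frac12e^{\alpha(\beta-\frac{\pi i}2)+\mu\lambda}H^{(2)}_\alpha(r\rho)$; - $z_\pm=\mp\frac12\rho e^{\pm\beta}$: $\ K_s^r=\frac1{\pi i}e^{\alpha(\beta+\frac{\pi i}2)+\mu\lambda}K_\alpha(r\rho)$, where $H^{(1)},H^{(2)}$ are the Hankel functions and $K_\alpha$ is the Macdonald function. -/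

import Mathlib

open Filter Topology MeasureTheory
open scoped TensorProduct ContDiff

noncomputable section

namespace FracPoincare

/-! ### `q`-numbers and roots -/

/-- The symmetric `q`-number `[n] = (q^n - q^{-n}) / (q - q^{-1})`. -/
def qNum (q : ℂ) (n : ℕ) : ℂ := (q ^ n - q⁻¹ ^ n) / (q - q⁻¹)

/-- The `q`-factorial `[n]! = [n][n-1]⋯[1]`. -/
def qFact (q : ℂ) (n : ℕ) : ℂ := ∏ i ∈ Finset.range n, qNum q (i + 1)

/-- For odd `p`, the real `p`-th root of the real number `r`. -/
def realRoot (p : ℕ) (r : ℝ) : ℝ := Real.sign r * |r| ^ (1 / (p : ℝ))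

/-! ### The finite-dimensional algebra generated by `η₊, η₋, δ` -/

/-- The generators `η₊, η₋, δ`. -/
inductive Gen
  | etaP
  | etaM
  | delta

/-- The defining relations
`η₋η₊ = q²η₊η₋`, `η_±δ = q²δη_±`, `η_±^p = 0`, `δ^p = 1`. -/
inductive Rel (p : ℕ) (q : ℂ) : FreeAlgebra ℂ Gen → FreeAlgebra ℂ Gen → Prop
  | eta_eta : Rel p q (FreeAlgebra.ι ℂ Gen.etaM * FreeAlgebra.ι ℂ Gen.etaP)
      (q ^ 2 • (FreeAlgebra.ι ℂ Gen.etaP * FreeAlgebra.ι ℂ Gen.etaM))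
  | etaP_delta : Rel p q (FreeAlgebra.ι ℂ Gen.etaP * FreeAlgebra.ι ℂ Gen.delta)
      (q ^ 2 • (FreeAlgebra.ι ℂ Gen.delta * FreeAlgebra.ι ℂ Gen.etaP))
  | etaM_delta : Rel p q (FreeAlgebra.ι ℂ Gen.etaM * FreeAlgebra.ι ℂ Gen.delta)
      (q ^ 2 • (FreeAlgebra.ι ℂ Gen.delta * FreeAlgebra.ι ℂ Gen.etaM))
  | etaP_pow : Rel p q (FreeAlgebra.ι ℂ Gen.etaP ^ p) 0
  | etaM_pow : Rel p q (FreeAlgebra.ι ℂ Gen.etaM ^ p) 0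
  | delta_pow : Rel p q (FreeAlgebra.ι ℂ Gen.delta ^ p) 1

/-- The quantum Poincaré group at a root of unity: the complex algebra presented by
`η₊, η₋, δ` and the relations `Rel`. -/
abbrev QAlg (p : ℕ) (q : ℂ) : Type := RingQuot (Rel p q)

/-- A generator, as an element of the algebra. -/
def gen (p : ℕ) (q : ℂ) (x : Gen) : QAlg p q :=
  RingQuot.mkAlgHom ℂ (Rel p q) (FreeAlgebra.ι ℂ x)

def etaP (p : ℕ) (q : ℂ) : QAlg p q := gen p q Gen.etaP

def etaM (p : ℕ) (q : ℂ) : QAlg p q := gen p q Gen.etaM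

/-- `δ^k`, the exponent being taken modulo `p` (recall `δ^p = 1`). -/
def deltaPow (p : ℕ) (q : ℂ) (k : ZMod p) : QAlg p q := gen p q Gen.delta ^ k.val

/-- `ζ(k, δ) = (1/p) ∑_{n<p} q^{-nk} δ^n`. -/
def zeta (p : ℕ) (q : ℂ) (k : ZMod p) : QAlg p q :=
  (1 / (p : ℂ)) • ∑ n ∈ Finset.range p, (q⁻¹ ^ (n * k.val)) • gen p q Gen.delta ^ n

/-- Labels `(n, m, k)` of the basis elements `η₊ⁿ η₋ᵐ ζ(k, δ)` of `QAlg p q`. -/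
abbrev Idx (p : ℕ) : Type := Fin p × Fin p × ZMod p

/-- The basis element `η₊ⁿ η₋ᵐ ζ(k, δ)`. -/
def basisElt (p : ℕ) (q : ℂ) (b : Idx p) : QAlg p q :=
  etaP p q ^ (b.1 : ℕ) * etaM p q ^ (b.2.1 : ℕ) * zeta p q b.2.2

/-- The adjoint `(η₊ⁿ η₋ᵐ ζ(k, δ))^*` for the antilinear antimultiplicative involution
with `η_±^* = η_±` and `δ^* = δ`. -/
def basisEltStar (p : ℕ) (q : ℂ) (b : Idx p) : QAlg p q :=
  ((1 / (p : ℂ)) • ∑ n ∈ Finset.range p,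
      (starRingEnd ℂ (q⁻¹ ^ (n * b.2.2.val))) • gen p q Gen.delta ^ n) *
    etaM p q ^ (b.2.1 : ℕ) * etaP p q ^ (b.1 : ℕ)

/-! ### The Hopf structure

An element of `𝒜_F`, i.e. a smooth function of `g₀ = (z₊, z₋, λ)` with values in `QAlg p q`,
is given by its coefficients `f_b` in the basis `η₊ⁿ η₋ᵐ ζ(k, δ)`. The coproduct takes
values in the smooth functions of two points `g₀, g₀'` with values in `QAlg ⊗ QAlg`. -/

/-- The coordinates `(z₊, z₋, λ)`. -/
abbrev Pt : Type := ℝ × ℝ × ℝ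

/-- `Δ(η₊) = η₊ ⊗ 1 + δ e^{-λ/p} ⊗ η₊`, where `λ` is a coordinate of the first factor. -/
def coprodEtaP (p : ℕ) (q : ℂ) (lam : ℝ) : QAlg p q ⊗[ℂ] QAlg p q :=
  etaP p q ⊗ₜ[ℂ] 1 + Complex.exp (-lam / p) • (deltaPow p q 1 ⊗ₜ[ℂ] etaP p q)

/-- `Δ(η₋) = η₋ ⊗ 1 + δ⁻¹ e^{λ/p} ⊗ η₋`. -/
def coprodEtaM (p : ℕ) (q : ℂ) (lam : ℝ) : QAlg p q ⊗[ℂ] QAlg p q :=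
  etaM p q ⊗ₜ[ℂ] 1 + Complex.exp (lam / p) • (deltaPow p q (-1) ⊗ₜ[ℂ] etaM p q)

/-- `Δ(ζ(k, δ))`, from `Δ(δ) = δ ⊗ δ`. -/
def coprodZeta (p : ℕ) (q : ℂ) (k : ZMod p) : QAlg p q ⊗[ℂ] QAlg p q :=
  (1 / (p : ℂ)) • ∑ n ∈ Finset.range p,
    (q⁻¹ ^ (n * k.val)) • ((gen p q Gen.delta ^ n) ⊗ₜ[ℂ] (gen p q Gen.delta ^ n))

/-- The nilpotent part of
`Δ(z₊) = z₊ ⊗ 1 + e^{-λ} ⊗ z₊ + (-1)^{(p+1)/2} ∑_{0<n<p} q^{n²} / ([p-n]![n]!)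
  η₊^{p-n} δⁿ e^{-λn/p} ⊗ η₊ⁿ`. -/
def nilP (p : ℕ) (q : ℂ) (lam : ℝ) : QAlg p q ⊗[ℂ] QAlg p q :=
  ((-1 : ℂ) ^ ((p + 1) / 2)) • ∑ n ∈ Finset.Ico 1 p,
    (q ^ (n ^ 2) / (qFact q (p - n) * qFact q n) * Complex.exp (-lam * n / p)) •
      ((etaP p q ^ (p - n) * deltaPow p q (n : ZMod p)) ⊗ₜ[ℂ] (etaP p q ^ n))

/-- The nilpotent part of
`Δ(z₋) = z₋ ⊗ 1 + e^{λ} ⊗ z₋ + (-1)^{(p+1)/2} ∑_{0<n<p} q^{-n²} / ([p-n]![n]!)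
  η₋^{p-n} δ^{-n} e^{λn/p} ⊗ η₋ⁿ`. -/
def nilM (p : ℕ) (q : ℂ) (lam : ℝ) : QAlg p q ⊗[ℂ] QAlg p q :=
  ((-1 : ℂ) ^ ((p + 1) / 2)) • ∑ n ∈ Finset.Ico 1 p,
    (q⁻¹ ^ (n ^ 2) / (qFact q (p - n) * qFact q n) * Complex.exp (lam * n / p)) •
      ((etaM p q ^ (p - n) * deltaPow p q (-(n : ZMod p))) ⊗ₜ[ℂ] (etaM p q ^ n))

/-- The group law `(g₀, g₀')`, i.e. the scalar part of the coproduct of `z₊, z₋, λ`. -/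
def ptMul (g g' : Pt) : Pt :=
  (g.1 + Real.exp (-g.2.2) * g'.1, g.2.1 + Real.exp g.2.2 * g'.2.1, g.2.2 + g'.2.2)

/-- `∂₊^a ∂₋^b f` at a point. -/
def partialDeriv (a b : ℕ) (f : Pt → ℂ) (g : Pt) : ℂ :=
  iteratedDeriv a (fun u => iteratedDeriv b (fun w => f (u, w, g.2.2)) g.2.1) g.1

/-- `Δ(f) = f(Δ(z₊), Δ(z₋), Δ(λ))` for a smooth function `f`, evaluated at two points. The
nilpotent parts `N_±` of `Δ(z_±)` satisfy `N_±^p = 0`, so this is an exact Taylor expansion. -/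
def coprodFun (p : ℕ) (q : ℂ) (f : Pt → ℂ) (g g' : Pt) : QAlg p q ⊗[ℂ] QAlg p q :=
  ∑ a ∈ Finset.range p, ∑ b ∈ Finset.range p,
    (partialDeriv a b f (ptMul g g') / ((a.factorial : ℂ) * (b.factorial : ℂ))) •
      (nilP p q g.2.2 ^ a * nilM p q g.2.2 ^ b)

/-- The coproduct of the element `∑_b f_b · η₊ⁿ η₋ᵐ ζ(k, δ)` of `𝒜_F`, at two points. -/
def coprod (p : ℕ) [NeZero p] (q : ℂ) (f : Idx p → Pt → ℂ) (g g' : Pt) :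
    QAlg p q ⊗[ℂ] QAlg p q :=
  ∑ b : Idx p, coprodEtaP p q g.2.2 ^ (b.1 : ℕ) * coprodEtaM p q g.2.2 ^ (b.2.1 : ℕ) *
    coprodZeta p q b.2.2 * coprodFun p q (f b) g g'

/-- The counit of `∑_b f_b · η₊ⁿ η₋ᵐ ζ(k, δ)`: `ε(η_±) = 0`, `ε(δ) = 1`, and evaluation of
functions at the unit `z_± = λ = 0`. -/
def counit (p : ℕ) [NeZero p] (q : ℂ) (f : Idx p → Pt → ℂ) : ℂ :=
  ∑ b : Idx p, (0 : ℂ) ^ (b.1 : ℕ) * (0 : ℂ) ^ (b.2.1 : ℕ) *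
    ((1 / (p : ℂ)) * ∑ n ∈ Finset.range p, q⁻¹ ^ (n * b.2.2.val)) * f b (0, 0, 0)

/-! ### The representation `π_r`

A vector `∑_j f_j(x) t^j` (with `t^p = 1`) is the family `j ↦ f_j`. -/

abbrev Vec (p : ℕ) : Type := ZMod p → ℝ → ℂ

/-- `π_r(p₊)`: multiplication by `(-r)^{1/p} e^{x/p} t`. -/
def actSmallPP (p : ℕ) (r : ℝ) (v : Vec p) : Vec p := fun j x =>
  (realRoot p (-r) * Real.exp (x / p) : ℝ) * v (j - 1) x

/-- `π_r(p₋)`: multiplication by `(-r)^{1/p} e^{-x/p} t⁻¹`. -/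
def actSmallPM (p : ℕ) (r : ℝ) (v : Vec p) : Vec p := fun j x =>
  (realRoot p (-r) * Real.exp (-x / p) : ℝ) * v (j + 1) x

/-- `π_r(P₊)`: multiplication by `-r e^x`. -/
def actPP (p : ℕ) (r : ℝ) (v : Vec p) : Vec p := fun j x => (-r * Real.exp x : ℝ) * v j x

/-- `π_r(P₋)`: multiplication by `-r e^{-x}`. -/
def actPM (p : ℕ) (r : ℝ) (v : Vec p) : Vec p := fun j x => (-r * Real.exp (-x) : ℝ) * v j x

/-- `π_r(H) = -i d/dx`. -/
def actH (p : ℕ) (v : Vec p) : Vec p := fun j x => -Complex.I * deriv (v j) x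

/-- `π_r(κ)`: `a(t) ↦ a(qt)`. -/
def actKappa (p : ℕ) (q : ℂ) (v : Vec p) : Vec p := fun j x => q ^ j.val * v j x

/-- `π_r(φ^{nmktsu})` for the basis element
`φ^{nmktsu} = p₊ⁿ p₋ᵐ κᵏ P₊ᵗ P₋ˢ Hᵘ` of `U_F`. -/
def actPhi (p : ℕ) (q : ℂ) (r : ℝ) (n m k t s u : ℕ) (v : Vec p) : Vec p :=
  (actSmallPP p r)^[n] ((actSmallPM p r)^[m] ((actKappa p q)^[k]
    ((actPP p r)^[t] ((actPM p r)^[s] ((actH p)^[u] v)))))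

/-- The duality pairing `⟨φ^{nmktsu}, a^{n'm'k't's'u'}⟩`, where
`a^{nmktsu} = η₊ⁿ η₋ᵐ ζ(k, δ) z₊ᵗ z₋ˢ λᵘ` and `h = q^{1/2}`. -/
def pairing (p : ℕ) (q h : ℂ) (n m k t s u n' m' : ℕ) (k' : ZMod p) (t' s' u' : ℕ) : ℂ :=
  if n = n' ∧ m = m' ∧ t = t' ∧ s = s' ∧ u = u' ∧ ((k + n + m : ℕ) : ZMod p) = k' then
    Complex.I ^ (n + m + t + s + u) * h ^ ((n : ℤ) - m - 2 * (n * m)) *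
      (u.factorial * t.factorial * s.factorial : ℂ) * (qFact q n * qFact q m)
  else 0

/-! ### The Fourier transform -/

/-- `F(ν) = ∫ f(x) e^{νx} dx`. -/
def fourier (f : ℝ → ℂ) (ν : ℂ) : ℂ := ∫ x : ℝ, f x * Complex.exp (ν * x)

/-- `∫_{c-i∞}^{c+i∞} G(μ) dμ`. -/
def verticalIntegral (c : ℝ) (G : ℂ → ℂ) : ℂ :=
  Complex.I * ∫ τ : ℝ, G (c + τ * Complex.I)

/-- `f(x) = (1/2πi) ∫_{-i∞}^{+i∞} F(ν) e^{-νx} dν`. -/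
def invFourier (F : ℂ → ℂ) (x : ℝ) : ℂ :=
  (1 / (2 * Real.pi * Complex.I)) * verticalIntegral 0 (fun ν => F ν * Complex.exp (-ν * x))

/-- The space of Fourier transforms of compactly supported smooth functions. -/
def PW : Set (ℂ → ℂ) :=
  {F | ∃ f : ℝ → ℂ, ContDiff ℝ ∞ f ∧ HasCompactSupport f ∧ F = fourier f}

/-- The space of the functions `F(ν)a(t) = ∑_j F_j(ν) t^j`. -/
def FVec (p : ℕ) : Set (ZMod p → ℂ → ℂ) := {F | ∀ j, F j ∈ PW}

/-- The pseudo-Hermitian form on the space of functions `F(ν)a(t)` that corresponds to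
`(f₁ a₁, f₂ a₂) = ∫ f₁ conj(f₂) dx · Φ(a₁ a₂^*)`, `t^* = t`, `Φ(t^s) = 1` if `p ∣ s` and
`0` otherwise. -/
def form (p : ℕ) [NeZero p] (F G : ZMod p → ℂ → ℂ) : ℂ :=
  ∑ j : ZMod p, ∑ j' : ZMod p, if j + j' = 0 then
    ∫ x : ℝ, invFourier (F j) x * starRingEnd ℂ (invFourier (G j') x) else 0

/-! ### The Fourier transform of `T_r` -/

/-- The Fourier transform of the `(t, s, u)`-th term of
`T_r(v) = ∑ a · π_r(φ) v / ⟨φ, a⟩`, where `φ` runs through the basis elements `φ^{nmktsu}` and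
`a = a^{n m k+n+m t s u}` is the basis element dual to `φ` up to the factor `⟨φ, a⟩`: the
coefficient of `η₊ⁿ η₋ᵐ ζ(k', δ) t^l`, so that `k = k' - n - m` modulo `p`. -/
def QrTerm (p : ℕ) (q h : ℂ) (r : ℝ) (F : ZMod p → ℂ → ℂ) (g : Pt) (b : Idx p)
    (l : ZMod p) (ν : ℂ) (i : ℕ × ℕ × ℕ) : ℂ :=
  let n : ℕ := b.1
  let m : ℕ := b.2.1
  let k : ℕ := (b.2.2 - (n : ZMod p) - (m : ZMod p)).val
  (g.1 : ℂ) ^ i.1 * (g.2.1 : ℂ) ^ i.2.1 * (g.2.2 : ℂ) ^ i.2.2 *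
    fourier (actPhi p q r n m k i.1 i.2.1 i.2.2 (fun j => invFourier (F j)) l) ν /
    pairing p q h n m k i.1 i.2.1 i.2.2 n m b.2.2 i.1 i.2.1 i.2.2

/-- The Fourier transform `Q_r` of `T_r`. The value `Q_r(F) = ∑_b η₊ⁿ η₋ᵐ ζ(k, δ) · Q_r(F)_b` is
given by its coefficients, `Q_r(F)_b (g₀)` being a function of `ν` and `t`. -/
def Qr (p : ℕ) (q h : ℂ) (r : ℝ) (F : ZMod p → ℂ → ℂ) (g : Pt) (b : Idx p) :
    ZMod p → ℂ → ℂ :=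
  fun l ν => ∑' i : ℕ × ℕ × ℕ, QrTerm p q h r F g b l ν i

/-- `R` is a pseudo-unitary corepresentation of `𝒜_F` in the space of functions `F(ν)a(t)`,
where `R F = ∑_b η₊ⁿ η₋ᵐ ζ(k, δ) · (R F)_b(g₀)`. -/
structure IsPseudoUnitaryCorep (p : ℕ) [NeZero p] (q : ℂ)
    (R : (ZMod p → ℂ → ℂ) → Pt → Idx p → ZMod p → ℂ → ℂ) : Prop where
  mem : ∀ F ∈ FVec p, ∀ g b, R F g b ∈ FVec p
  smooth : ∀ F ∈ FVec p, ∀ b l ν, ContDiff ℝ ∞ (fun g => R F g b l ν)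
  add : ∀ F ∈ FVec p, ∀ G ∈ FVec p, R (F + G) = R F + R G
  smul : ∀ F ∈ FVec p, ∀ a : ℂ, R (a • F) = a • R F
  /-- `(ε ⊗ id) R = id` -/
  counit : ∀ F ∈ FVec p, ∀ l ν, counit p q (fun b g => R F g b l ν) = F l ν
  /-- `Δ` applied to the coefficients of `R` is `R` applied twice, the outer application giving
  the first tensor factor (as in `T(gg') = T(g) T(g')`) -/
  coprod : ∀ F ∈ FVec p, ∀ g g' l ν,
    coprod p q (fun b g => R F g b l ν) g g' =
      ∑ b' : Idx p, ∑ b : Idx p,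
        R (R F g' b') g b l ν • (basisElt p q b ⊗ₜ[ℂ] basisElt p q b')
  /-- `(R F, R G) = (F, G) 1`, the form being extended to `𝒜_F`-valued vectors by
  `(a F, a' G) = a'^* a (F, G)` -/
  unitary : ∀ F ∈ FVec p, ∀ G ∈ FVec p, ∀ g,
    ∑ b : Idx p, ∑ b' : Idx p,
        form p (R F g b) (R G g b') • (basisEltStar p q b' * basisElt p q b) =
      form p F G • (1 : QAlg p q)

/-! ### The kernel -/

/-- `ω_s^r(ξ) = ∑_{m=0}^{p-s-1} (i r^{1/p})^{2m+s} / ([m]! [m+s]!) (q^s ξ)^m`. -/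
def omega (p : ℕ) (q : ℂ) (r : ℝ) (s : ℕ) (ξ : QAlg p q) : QAlg p q :=
  ∑ m ∈ Finset.range (p - s),
    ((Complex.I * realRoot p r) ^ (2 * m + s) / (qFact q m * qFact q (m + s))) •
      (q ^ s • ξ) ^ m

/-- `ξ = q η₊ η₋`. -/
def xi (p : ℕ) (q : ℂ) : QAlg p q := q • (etaP p q * etaM p q)

/-- `L` is the (possibly only conditionally convergent) integral of `f` over the real line. -/
def HasImproperIntegral (f : ℝ → ℂ) (L : ℂ) : Prop :=
  Tendsto (fun ab : ℝ × ℝ => ∫ x in ab.1..ab.2, f x) (atBot ×ˢ atTop) (𝓝 L)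

/-- The improper integral of `f` over the real line. -/
def improperIntegral (f : ℝ → ℂ) : ℂ :=
  limUnder (atBot ×ˢ atTop) (fun ab : ℝ × ℝ => ∫ x in ab.1..ab.2, f x)

/-- The integrand `e^{ir(e^x z₊ + e^{-x} z₋) + x(ν - μ + s/p)}`. -/
def KIntegrand (p : ℕ) (r : ℝ) (s : ℤ) (ν μ : ℂ) (g : Pt) (x : ℝ) : ℂ :=
  Complex.exp (Complex.I * r * (Real.exp x * g.1 + Real.exp (-x) * g.2.1) +
    x * (ν - μ + s / p))

/-- `K_s^r(ν, μ, g₀) = (1/2πi) e^{μλ} ∫ e^{ir(e^x z₊ + e^{-x} z₋) + x(ν - μ + s/p)} dx`. -/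
def Kfun (p : ℕ) (r : ℝ) (s : ℤ) (ν μ : ℂ) (g : Pt) : ℂ :=
  (1 / (2 * Real.pi * Complex.I)) * Complex.exp (μ * g.2.2) *
    improperIntegral (KIntegrand p r s ν μ g)

/-- `δ^{k/2}`, where `δ^{1/2} = δ^{(p+1)/2}` is the square root of `δ` among its powers. -/
def deltaHalfPow (p : ℕ) (q : ℂ) (k : ℕ) : QAlg p q := gen p q Gen.delta ^ ((p + 1) / 2 * k)

/-- The kernel `Q_{kl}^r(ν, μ, g)` for `0 ≤ k, l < p`, with `h = q^{1/2}`. -/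
def kernel (p : ℕ) (q h : ℂ) (r : ℝ) (k l : ℕ) (ν μ : ℂ) (g : Pt) : QAlg p q :=
  if k ≤ l then
    Kfun p r ((l : ℤ) - k) ν μ g •
      (deltaHalfPow p q k * ((h⁻¹ • etaP p q) ^ (l - k) * omega p q r (l - k) (xi p q)) *
        deltaHalfPow p q k) +
    Kfun p r ((l : ℤ) - k - p) ν μ g •
      (deltaHalfPow p q k * (omega p q r (p + k - l) (xi p q) * (h • etaM p q) ^ (p + k - l)) *
        deltaHalfPow p q k)
  else
    Kfun p r ((p : ℤ) + l - k) ν μ g •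
      (deltaHalfPow p q k * ((h⁻¹ • etaP p q) ^ (p + l - k) * omega p q r (p + l - k) (xi p q)) *
        deltaHalfPow p q k) +
    Kfun p r ((l : ℤ) - k) ν μ g •
      (deltaHalfPow p q k * (omega p q r (k - l) (xi p q) * (h • etaM p q) ^ (k - l)) *
        deltaHalfPow p q k)

/-! ### Cylinder functions -/

/-- The Bessel function `J_a(z)`. -/
def besselJ (a z : ℂ) : ℂ :=
  ∑' m : ℕ, (-1) ^ m / (m.factorial : ℂ) * (Complex.Gamma (a + m + 1))⁻¹ *
    (z / 2) ^ (a + 2 * m)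

/-- The modified Bessel function `I_a(z)`. -/
def besselI (a z : ℂ) : ℂ :=
  ∑' m : ℕ, 1 / (m.factorial : ℂ) * (Complex.Gamma (a + m + 1))⁻¹ * (z / 2) ^ (a + 2 * m)

open Classical in
/-- The value of `N` at `a`, replaced by the limiting value if `a` is an integer. -/
def integerLimit (N : ℂ → ℂ) (a : ℂ) : ℂ :=
  if ∃ n : ℤ, a = n then limUnder (𝓝[≠] a) N else N a

/-- The Hankel function `H^{(1)}_a(z) = (J_{-a}(z) - e^{-iπa} J_a(z)) / (i sin πa)`. -/
def hankel1 (a z : ℂ) : ℂ :=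
  integerLimit (fun a => (besselJ (-a) z - Complex.exp (-(Complex.I * Real.pi * a)) *
    besselJ a z) / (Complex.I * Complex.sin (Real.pi * a))) a

/-- The Hankel function `H^{(2)}_a(z) = (J_{-a}(z) - e^{iπa} J_a(z)) / (-i sin πa)`. -/
def hankel2 (a z : ℂ) : ℂ :=
  integerLimit (fun a => (besselJ (-a) z - Complex.exp (Complex.I * Real.pi * a) *
    besselJ a z) / (-(Complex.I * Complex.sin (Real.pi * a)))) a

/-- The Macdonald function `K_a(z) = (π/2) (I_{-a}(z) - I_a(z)) / sin πa`. -/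
def macdonaldK (a z : ℂ) : ℂ :=
  integerLimit (fun a => Real.pi / 2 * (besselI (-a) z - besselI a z) /
    Complex.sin (Real.pi * a)) a

end FracPoincare

end

open Filter Topology MeasureTheory
open scoped TensorProduct ContDiff

noncomputable section

set_option linter.unusedSectionVars false

namespace FracPoincare

section

/-! ### Fourier transforms of test functions -/

/-! Everything reduces to one closed formula. The sums over powers of $P_\pm$ and $H$ in $T_r$ are
exponential series: they give multiplication by $e^{ir(e^xz_++e^{-x}z_-)}$ and translation by
$\lambda$. The translation series needs the Fourier transform, since a nonzero test function is not
analytic; after it, $d/dx$ becomes multiplication and the triple series converges absolutely by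
domination on the compact support (`hasSum_fourier_series`, `Qr_fourier`). So each coefficient of
$Q_r$ is the transform of an explicit test function `Tr`. Membership, smoothness, linearity and the
counit follow from this.

Coproduct. Summing over $k$ turns the idempotents $\zeta(k,\delta)$ into powers of $\delta$.
Applying $Q_r$ twice then produces products of truncated $q$-exponentials of $A=\eta_+\otimes1$ and
$B=\delta e^{-\lambda/p}\otimes\eta_+$, where $AB=q^2BA$ and $A^p=B^p=0$, and likewise for $\eta_-$
with $q^{-1}$. Below degree $p$ such a product is $(A+B)^N/[N]!$. Degrees $p,\dots,2p-1$ repeat this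
pattern multiplied by the degree-$p$ part $S$ (`sum_qExp_mul_weight`). Up to sign, $S$ is the
nilpotent part of $\Delta(z_+)$. Since $S^2=0$, the Taylor expansion of $f(\Delta(z_+))$ has only
the terms $1$ and $S$, and $\partial/\partial z_+$ multiplies the integrand by $ire^x$, which
matches raising the degree by $p$. The constants agree because $h^p=-1$ (`root_pow_mul`).

Pseudo-unitarity. The phase is unimodular and Lebesgue measure is translation invariant. What
remains is an alternating $q$-binomial sum, which kills every bidegree except $(0,0)$
(`sum_alternating_weight`).

Kernel. Fourier inversion along $\mathrm{Re}\,\mu=c$ is inserted for $f(x-\lambda)$ and the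
integrals are exchanged on $[-n,n]$. One integration by parts bounds the truncated oscillatory
integrals linearly in $|\mu|$, while $F$ decays rapidly on vertical lines, so $n\to\infty$ is a
dominated limit (`QrInt_eq_verticalIntegral`). For given $k,l$ only $n-m\equiv l-k$ modulo $p$
contributes, which leaves two values of $n-m$ and hence two terms.

Cylinder functions. Write $z=-irz_+$, $z'=-irz_-$. For $\mathrm{Re}\,z,\mathrm{Re}\,z'>0$ each
half-line integral expands into incomplete gamma functions. Completing them to full gamma functions
gives Bessel series, and the corrections from the two half-lines cancel (`half_add_cross`,
`tsum_crossTerm_neg`). The imaginary axis is reached by continuity (`oscInt_negI`), and so is the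
only integral index in the strip, $0$ (`integerLimit_mul`). -/

/-- `f` is smooth with compact support. -/
structure IsTest (f : ℝ → ℂ) : Prop where
  smooth : ContDiff ℝ ∞ f
  supp : HasCompactSupport f

lemma IsTest.continuous {f : ℝ → ℂ} (hf : IsTest f) : Continuous f := hf.smooth.continuous

lemma IsTest.integrable {f : ℝ → ℂ} (hf : IsTest f) : Integrable f :=
  hf.continuous.integrable_of_hasCompactSupport hf.supp

lemma IsTest.mul_left {f : ℝ → ℂ} (hf : IsTest f) {a : ℝ → ℂ} (ha : ContDiff ℝ ∞ a) :
    IsTest (fun x => a x * f x) :=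
  ⟨ha.mul hf.smooth, hf.supp.mul_left⟩

lemma IsTest.mul_right {f : ℝ → ℂ} (hf : IsTest f) {a : ℝ → ℂ} (ha : ContDiff ℝ ∞ a) :
    IsTest (fun x => f x * a x) :=
  ⟨hf.smooth.mul ha, hf.supp.mul_right⟩

lemma IsTest.integrable_mul {f : ℝ → ℂ} (hf : IsTest f) {a : ℝ → ℂ} (ha : Continuous a) :
    Integrable (fun x => f x * a x) :=
  (hf.continuous.mul ha).integrable_of_hasCompactSupport hf.supp.mul_right

lemma IsTest.comp_sub {f : ℝ → ℂ} (hf : IsTest f) (a : ℝ) : IsTest (fun x => f (x - a)) :=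
  ⟨hf.smooth.comp (contDiff_id.sub contDiff_const),
    hf.supp.comp_homeomorph (Homeomorph.subRight a)⟩

lemma IsTest.deriv {f : ℝ → ℂ} (hf : IsTest f) : IsTest (deriv f) :=
  ⟨(contDiff_infty_iff_deriv.1 hf.smooth).2, hf.supp.deriv⟩

lemma IsTest.add {f g : ℝ → ℂ} (hf : IsTest f) (hg : IsTest g) : IsTest (f + g) :=
  ⟨hf.smooth.add hg.smooth, hf.supp.add hg.supp⟩

lemma IsTest.const_smul {f : ℝ → ℂ} (hf : IsTest f) (a : ℂ) : IsTest (a • f) :=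
  ⟨contDiff_const.smul hf.smooth, hf.supp.smul_left (f := fun _ => a)⟩

lemma isTest_zero : IsTest (0 : ℝ → ℂ) := ⟨contDiff_const, HasCompactSupport.zero⟩

lemma contDiff_cexp_mul (w : ℂ) : ContDiff ℝ ∞ (fun x : ℝ => Complex.exp (w * x)) :=
  (contDiff_const.mul Complex.ofRealCLM.contDiff).cexp

lemma fourier_add {f g : ℝ → ℂ} (hf : IsTest f) (hg : IsTest g) :
    fourier (f + g) = fourier f + fourier g := by
  ext ν
  simp only [fourier, Pi.add_apply, add_mul]
  exact integral_add (hf.integrable_mul (contDiff_cexp_mul ν).continuous)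
    (hg.integrable_mul (contDiff_cexp_mul ν).continuous)

lemma fourier_smul (a : ℂ) (f : ℝ → ℂ) : fourier (a • f) = a • fourier f := by
  ext ν
  simp only [fourier, Pi.smul_apply, smul_eq_mul, mul_assoc]
  exact integral_const_mul _ _

/-- The kernel of the ordinary transform is $e^{-2\pi ixw}$, which forces the frequency
$w=-\tau/2\pi$; the real part $c$ is absorbed as a weight. This makes Schwartz theory available on
every vertical line. -/
lemma fourier_vertical (f : ℝ → ℂ) (c τ : ℝ) :
    fourier f (c + τ * Complex.I) =
      FourierTransform.fourier (fun x : ℝ => f x * Complex.exp (c * x)) (-(1 / (2 * Real.pi)) * τ) := by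
  rw [Real.fourier_real_eq_integral_exp_smul, fourier]
  congr 1 with x
  rw [smul_eq_mul, mul_left_comm, ← Complex.exp_add]
  congr 2
  have : (Real.pi : ℂ) ≠ 0 := by exact_mod_cast Real.pi_ne_zero
  push_cast
  field_simp
  ring

lemma IsTest.exp_mul {f : ℝ → ℂ} (hf : IsTest f) (c : ℂ) :
    IsTest (fun x => f x * Complex.exp (c * x)) :=
  hf.mul_right (contDiff_cexp_mul c)

/-- The weight $e^{cx}$ keeps $f$ a test function, so its transform is Schwartz. The powers $0$ and
$1$ are what a kernel of linear growth in $\tau$ requires. -/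
lemma integrable_pow_mul_fourier_vertical {f : ℝ → ℂ} (hf : IsTest f) (c : ℝ) (k : ℕ) :
    Integrable (fun τ : ℝ => |τ| ^ k * ‖fourier f (c + τ * Complex.I)‖) := by
  have hg := hf.exp_mul c
  have h1 := (FourierTransform.fourier (hg.supp.toSchwartzMap hg.smooth)).integrable_pow_mul
    volume k
  have h2 := (h1.comp_mul_left' (R := -(1 / (2 * Real.pi)))
    (by have := Real.pi_ne_zero; simp [this])).const_mul ((2 * Real.pi) ^ k)
  refine h2.congr (Eventually.of_forall fun τ => ?_)
  simp only [fourier_vertical]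
  rw [← mul_assoc]
  congr 1
  rw [Real.norm_eq_abs, ← abs_of_pos Real.two_pi_pos, ← mul_pow, ← abs_mul,
    abs_of_pos Real.two_pi_pos, ← abs_neg]
  congr 2
  have := Real.pi_ne_zero
  field_simp

lemma continuous_fourier_vertical {f : ℝ → ℂ} (hf : IsTest f) (c : ℝ) :
    Continuous (fun τ : ℝ => fourier f (c + τ * Complex.I)) := by
  have hg := hf.exp_mul c
  have h1 := (FourierTransform.fourier (hg.supp.toSchwartzMap hg.smooth)).continuous
  simp only [fourier_vertical]
  exact h1.comp (continuous_const_mul (-(1 / (2 * Real.pi))))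

lemma integrable_fourier_vertical {f : ℝ → ℂ} (hf : IsTest f) (c : ℝ) :
    Integrable (fun τ : ℝ => fourier f (c + τ * Complex.I)) := by
  have := integrable_pow_mul_fourier_vertical hf c 0
  simp only [pow_zero, one_mul] at this
  exact (integrable_norm_iff (continuous_fourier_vertical hf c).aestronglyMeasurable).1 this

/-- Fourier inversion along the vertical line through `c`. -/
lemma fourier_inversion {f : ℝ → ℂ} (hf : IsTest f) (c x : ℝ) :
    1 / (2 * Real.pi * Complex.I) *
      verticalIntegral c (fun μ => fourier f μ * Complex.exp (-μ * x)) = f x := by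
  have hg := hf.exp_mul c
  set G := fun x : ℝ => f x * Complex.exp (c * x) with hG
  have h1 : Integrable (FourierTransform.fourier G) :=
    (FourierTransform.fourier (hg.supp.toSchwartzMap hg.smooth)).integrable
  have h2 := congrFun (hg.continuous.fourierInv_fourier_eq hg.integrable h1) x
  rw [Real.fourierInv_eq'] at h2
  have hpi : (Real.pi : ℂ) ≠ 0 := by exact_mod_cast Real.pi_ne_zero
  have h3 : ∀ τ : ℝ, fourier f (c + τ * Complex.I) * Complex.exp (-(c + τ * Complex.I) * x) =
      Complex.exp (-(c * x)) * (fun w : ℝ => Complex.exp (↑(2 * Real.pi * inner ℝ w x) * Complex.I) •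
        FourierTransform.fourier G w) (-(1 / (2 * Real.pi)) * τ) := by
    intro τ
    rw [fourier_vertical]
    simp only [smul_eq_mul]
    rw [← mul_assoc, ← Complex.exp_add, mul_comm]
    congr 2
    simp only [RCLike.inner_apply, conj_trivial]
    push_cast
    field_simp
    ring
  rw [verticalIntegral, integral_congr_ae (Eventually.of_forall h3), integral_const_mul,
    Measure.integral_comp_mul_left (fun w : ℝ => Complex.exp (↑(2 * Real.pi * inner ℝ w x) *
      Complex.I) • FourierTransform.fourier G w), h2, hG]
  have h4 : |(-(1 / (2 * Real.pi)))⁻¹| = 2 * Real.pi := by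
    rw [inv_neg, abs_neg, one_div, inv_inv, abs_of_pos Real.two_pi_pos]
  rw [h4, Complex.real_smul]
  have h5 : Complex.exp (-(c * x)) * Complex.exp (c * x) = 1 := by
    rw [← Complex.exp_add]; simp
  have hI := Complex.I_ne_zero
  push_cast
  field_simp
  linear_combination f x * h5

lemma invFourier_fourier {f : ℝ → ℂ} (hf : IsTest f) : invFourier (fourier f) = f := by
  ext x
  have := fourier_inversion hf 0 x
  rwa [invFourier]

lemma mem_PW_iff {F : ℂ → ℂ} : F ∈ PW ↔ ∃ f, IsTest f ∧ F = fourier f :=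
  ⟨fun ⟨f, h1, h2, h3⟩ => ⟨f, ⟨h1, h2⟩, h3⟩, fun ⟨f, h, h3⟩ => ⟨f, h.1, h.2, h3⟩⟩

lemma exists_of_mem_FVec {p : ℕ} {F : ZMod p → ℂ → ℂ} (hF : F ∈ FVec p) :
    ∃ f : Vec p, (∀ j, IsTest (f j)) ∧ F = fun j => fourier (f j) := by
  choose f hf using fun j => mem_PW_iff.1 (hF j)
  exact ⟨f, fun j => (hf j).1, funext fun j => (hf j).2⟩

end

section

/-! ### The series defining `Q_r` -/

lemma hasSum_cexp (z : ℂ) : HasSum (fun n : ℕ => z ^ n / (n.factorial : ℂ)) (Complex.exp z) := by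
  rw [Complex.exp_eq_exp_ℂ]
  exact NormedSpace.expSeries_div_hasSum_exp z

/-- The base of the $u$-th power depends on $t$ and $s$, so this is not a product of series. The
bound $y^u/u!\le e^{2y}2^{-u}$ restores a product: $e^{2y}$ factors through $e^{2Lt}e^{2Ls}$ and
only rescales $A$ and $B$. -/
lemma summable_triple_real {A B L c : ℝ} (hA : 0 ≤ A) (hB : 0 ≤ B) (hL : 0 ≤ L) (hc : 0 ≤ c) :
    Summable (fun i : ℕ × ℕ × ℕ => A ^ i.1 / (i.1.factorial : ℝ) *
      (B ^ i.2.1 / (i.2.1.factorial : ℝ)) *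
      ((L * (c + i.1 + i.2.1)) ^ i.2.2 / (i.2.2.factorial : ℝ))) := by
  set e := Real.exp (2 * L)
  have h1 : Summable fun i : ℕ × ℕ × ℕ => (A * e) ^ i.1 / (i.1.factorial : ℝ) *
      ((B * e) ^ i.2.1 / (i.2.1.factorial : ℝ) * (1 / 2 : ℝ) ^ i.2.2) :=
    (Real.summable_pow_div_factorial (A * e)).mul_of_nonneg
      ((Real.summable_pow_div_factorial (B * e)).mul_of_nonneg
        (summable_geometric_two) (fun n => by positivity) (fun n => by positivity))
      (fun n => by positivity) (fun n => by positivity)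
  refine Summable.of_nonneg_of_le (fun i => by positivity) (fun i => ?_)
    (h1.mul_left (Real.exp (2 * L * c)))
  have h2 : (L * (c + i.1 + i.2.1)) ^ i.2.2 / (i.2.2.factorial : ℝ) ≤
      Real.exp (2 * (L * (c + i.1 + i.2.1))) * (1 / 2 : ℝ) ^ i.2.2 := by
    have := Real.pow_div_factorial_le_exp (x := 2 * (L * (c + i.1 + i.2.1))) (by positivity) i.2.2
    calc (L * (c + i.1 + i.2.1)) ^ i.2.2 / (i.2.2.factorial : ℝ)
        = (2 * (L * (c + i.1 + i.2.1))) ^ i.2.2 / (i.2.2.factorial : ℝ) * (1 / 2 : ℝ) ^ i.2.2 := by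
          rw [mul_pow 2, one_div, inv_pow]; field_simp
      _ ≤ _ := by gcongr
  have h3 : Real.exp (2 * (L * (c + i.1 + i.2.1))) =
      Real.exp (2 * L * c) * (e ^ i.1 * e ^ i.2.1) := by
    rw [← Real.exp_nat_mul, ← Real.exp_nat_mul, ← Real.exp_add, ← Real.exp_add]
    ring_nf
  calc _ ≤ A ^ i.1 / (i.1.factorial : ℝ) * (B ^ i.2.1 / (i.2.1.factorial : ℝ)) *
        (Real.exp (2 * (L * (c + i.1 + i.2.1))) * (1 / 2 : ℝ) ^ i.2.2) := by gcongr
    _ = _ := by rw [h3, mul_pow, mul_pow]; ring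

lemma norm_triple_le (A B L c : ℂ) (i : ℕ × ℕ × ℕ) :
    ‖A ^ i.1 / (i.1.factorial : ℂ) * (B ^ i.2.1 / (i.2.1.factorial : ℂ)) *
      ((L * (c + i.1 - i.2.1)) ^ i.2.2 / (i.2.2.factorial : ℂ))‖ ≤
    ‖A‖ ^ i.1 / (i.1.factorial : ℝ) * (‖B‖ ^ i.2.1 / (i.2.1.factorial : ℝ)) *
      ((‖L‖ * (‖c‖ + i.1 + i.2.1)) ^ i.2.2 / (i.2.2.factorial : ℝ)) := by
  simp only [norm_mul, norm_div, norm_pow, Complex.norm_natCast]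
  gcongr
  refine (norm_sub_le _ _).trans ?_
  refine add_le_add ((norm_add_le _ _).trans ?_) ?_ <;> simp

/-- Summing over $u$ first gives $e^{L(c+t-s)}$, which rescales $A$ by $e^L$ and $B$ by $e^{-L}$;
two exponential series remain. Absolute summability justifies the iterated summation. -/
lemma hasSum_triple (A B L c : ℂ) :
    HasSum (fun i : ℕ × ℕ × ℕ => A ^ i.1 / (i.1.factorial : ℂ) *
      (B ^ i.2.1 / (i.2.1.factorial : ℂ)) *
      ((L * (c + i.1 - i.2.1)) ^ i.2.2 / (i.2.2.factorial : ℂ)))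
      (Complex.exp (A * Complex.exp L + B * Complex.exp (-L) + L * c)) := by
  have hs : Summable (fun i : ℕ × ℕ × ℕ => A ^ i.1 / (i.1.factorial : ℂ) *
      (B ^ i.2.1 / (i.2.1.factorial : ℂ)) *
      ((L * (c + i.1 - i.2.1)) ^ i.2.2 / (i.2.2.factorial : ℂ))) :=
    Summable.of_norm_bounded (summable_triple_real (norm_nonneg A) (norm_nonneg B)
      (norm_nonneg L) (norm_nonneg c)) (norm_triple_le A B L c)
  have h1 : ∀ t : ℕ, HasSum (fun i : ℕ × ℕ => A ^ t / (t.factorial : ℂ) *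
      (B ^ i.1 / (i.1.factorial : ℂ)) *
      ((L * (c + t - i.1)) ^ i.2 / (i.2.factorial : ℂ)))
      ((A * Complex.exp L) ^ t / (t.factorial : ℂ) *
        (Complex.exp (B * Complex.exp (-L)) * Complex.exp (L * c))) := by
    intro t
    have hs' := hs.prod_factor t
    have h2 := hs'.hasSum.prod_fiberwise (fun s => (hasSum_cexp (L * (c + t - s))).mul_left
      (A ^ t / (t.factorial : ℂ) * (B ^ s / (s.factorial : ℂ))))
    have h3 := (hasSum_cexp (B * Complex.exp (-L))).mul_left
      ((A * Complex.exp L) ^ t / (t.factorial : ℂ) * Complex.exp (L * c))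
    have h4 : ∀ s : ℕ, A ^ t / (t.factorial : ℂ) * (B ^ s / (s.factorial : ℂ)) *
        Complex.exp (L * (c + t - s)) = (A * Complex.exp L) ^ t / (t.factorial : ℂ) *
        Complex.exp (L * c) * ((B * Complex.exp (-L)) ^ s / (s.factorial : ℂ)) := by
      intro s
      rw [mul_pow, mul_pow, ← Complex.exp_nat_mul, ← Complex.exp_nat_mul,
        show L * (c + t - s) = t * L + L * c + s * (-L) by ring, Complex.exp_add, Complex.exp_add]
      ring
    simp only [h4] at h2
    have h5 := h2.unique h3
    have h6 := hs'.hasSum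
    rw [h5] at h6
    convert! h6 using 1
    ring
  have h2 := hs.hasSum.prod_fiberwise h1
  have h3 := (hasSum_cexp (A * Complex.exp L)).mul_right
    (Complex.exp (B * Complex.exp (-L)) * Complex.exp (L * c))
  have h5 := h2.unique h3
  have h6 := hs.hasSum
  rw [h5] at h6
  convert! h6 using 1
  rw [Complex.exp_add, Complex.exp_add]
  ring

lemma IsTest.exists_bound {f : ℝ → ℂ} (hf : IsTest f) :
    ∃ R : ℝ, 0 ≤ R ∧ ∀ x, f x ≠ 0 → |x| ≤ R := by
  obtain ⟨R, hR⟩ := hf.supp.isCompact.isBounded.exists_norm_le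
  refine ⟨max R 0, le_max_right _ _, fun x hx => ?_⟩
  exact (hR x (subset_tsupport _ hx)).trans (le_max_left _ _)

/-- Under the integral the terms form the series of `hasSum_triple` with $A=ae^y$ and $B=be^{-y}$.
These are bounded on the support of $f$, so summation and integration may be exchanged. -/
lemma hasSum_fourier_series {f : ℝ → ℂ} (hf : IsTest f) (a b : ℂ) (L : ℝ) (c : ℂ) :
    HasSum (fun i : ℕ × ℕ × ℕ => a ^ i.1 / (i.1.factorial : ℂ) *
      (b ^ i.2.1 / (i.2.1.factorial : ℂ)) *
      ((L * (c + i.1 - i.2.1)) ^ i.2.2 / (i.2.2.factorial : ℂ)) * fourier f (c + i.1 - i.2.1))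
      (fourier (fun x => Complex.exp (a * Real.exp x + b * Real.exp (-x)) * f (x - L)) c) := by
  obtain ⟨R, hR0, hR⟩ := hf.exists_bound
  have key := hasSum_integral_of_dominated_convergence (μ := volume)
    (F := fun (i : ℕ × ℕ × ℕ) (y : ℝ) => f y * Complex.exp (c * y) *
      ((a * Real.exp y) ^ i.1 / (i.1.factorial : ℂ) *
      ((b * Real.exp (-y)) ^ i.2.1 / (i.2.1.factorial : ℂ)) *
      ((L * (c + i.1 - i.2.1)) ^ i.2.2 / (i.2.2.factorial : ℂ))))
    (f := fun y : ℝ => f y * Complex.exp (c * y) * Complex.exp (a * Real.exp y * Complex.exp L +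
      b * Real.exp (-y) * Complex.exp (-L) + L * c))
    (fun i y => ‖f y * Complex.exp (c * y)‖ * ((‖a‖ * Real.exp R) ^ i.1 / (i.1.factorial : ℝ) *
      ((‖b‖ * Real.exp R) ^ i.2.1 / (i.2.1.factorial : ℝ)) *
      ((‖(L : ℂ)‖ * (‖c‖ + i.1 + i.2.1)) ^ i.2.2 / (i.2.2.factorial : ℝ))))
    ?_ ?_ ?_ ?_ ?_
  · have h2 : ∀ i : ℕ × ℕ × ℕ, ∫ y : ℝ, f y * Complex.exp (c * y) *
        ((a * Real.exp y) ^ i.1 / (i.1.factorial : ℂ) *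
        ((b * Real.exp (-y)) ^ i.2.1 / (i.2.1.factorial : ℂ)) *
        ((L * (c + i.1 - i.2.1)) ^ i.2.2 / (i.2.2.factorial : ℂ))) =
        a ^ i.1 / (i.1.factorial : ℂ) * (b ^ i.2.1 / (i.2.1.factorial : ℂ)) *
        ((L * (c + i.1 - i.2.1)) ^ i.2.2 / (i.2.2.factorial : ℂ)) *
          fourier f (c + i.1 - i.2.1) := by
      intro i
      rw [fourier, ← integral_const_mul]
      congr 1 with y
      rw [Complex.ofReal_exp, Complex.ofReal_exp, mul_pow, mul_pow, ← Complex.exp_nat_mul,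
        ← Complex.exp_nat_mul, show (c + i.1 - i.2.1) * (y : ℂ) =
        c * y + i.1 * y + i.2.1 * ((-y : ℝ) : ℂ) by push_cast; ring, Complex.exp_add,
        Complex.exp_add]
      ring
    simp only [h2] at key
    convert! key using 1
    -- The substitution $x=y+L$ frees $f$ from the translation and produces the factors $e^{\pm L}$
    -- of the summed series.
    rw [fourier, ← integral_add_right_eq_self _ L]
    congr 1 with y
    rw [add_sub_cancel_right, mul_comm _ (f y), mul_assoc, mul_assoc, ← Complex.exp_add,
      ← Complex.exp_add]
    congr 2
    push_cast
    rw [neg_add, Complex.exp_add, Complex.exp_add]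
    ring
  · intro i
    exact (((hf.exp_mul c).continuous).mul (by fun_prop)).aestronglyMeasurable
  · intro i
    refine Eventually.of_forall fun y => ?_
    rw [norm_mul]
    by_cases hy : f y = 0
    · simp [hy]
    have h1 := abs_le.1 (hR y hy)
    refine mul_le_mul_of_nonneg_left ((norm_triple_le _ _ _ _ i).trans ?_) (norm_nonneg _)
    have e1 : ‖a * (Real.exp y : ℂ)‖ ≤ ‖a‖ * Real.exp R := by
      rw [norm_mul, Complex.norm_real, Real.norm_eq_abs, Real.abs_exp]
      gcongr; exact h1.2
    have e2 : ‖b * (Real.exp (-y) : ℂ)‖ ≤ ‖b‖ * Real.exp R := by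
      rw [norm_mul, Complex.norm_real, Real.norm_eq_abs, Real.abs_exp]
      gcongr; linarith [h1.1]
    gcongr
  · exact Eventually.of_forall fun y => (summable_triple_real (by positivity) (by positivity)
      (norm_nonneg _) (norm_nonneg _)).mul_left _
  · simp only [tsum_mul_left]
    exact (hf.exp_mul c).integrable.norm.mul_const _
  · exact Eventually.of_forall fun y => (hasSum_triple _ _ _ _).mul_left _

lemma fourier_deriv {f : ℝ → ℂ} (hf : IsTest f) (w : ℂ) :
    fourier (deriv f) w = -w * fourier f w := by
  have hd : ∀ x : ℝ, HasDerivAt (fun x : ℝ => Complex.exp (w * x)) (w * Complex.exp (w * x)) x := by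
    intro x
    have := ((hasDerivAt_id (x : ℂ)).const_mul w).cexp.comp_ofReal
    simpa [mul_comm] using this
  have hc : Continuous fun x : ℝ => Complex.exp (w * x) := (contDiff_cexp_mul w).continuous
  have := integral_mul_deriv_eq_deriv_mul_of_integrable (A := ℂ)
    (u := fun x : ℝ => Complex.exp (w * x))
    (v := f) (u' := fun x : ℝ => w * Complex.exp (w * x)) (v' := deriv f)
    (fun x _ => hd x) (fun x _ => (hf.smooth.differentiable (by simp)).differentiableAt.hasDerivAt)
    ((hf.deriv.integrable_mul hc).congr (Eventually.of_forall fun x => mul_comm _ _))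
    ((hf.integrable_mul (continuous_const.mul hc)).congr
      (Eventually.of_forall fun x => mul_comm _ _))
    ((hf.integrable_mul hc).congr (Eventually.of_forall fun x => mul_comm _ _))
  simp only [fourier]
  simp only [mul_comm (deriv f _), mul_comm (f _)]
  rw [this, ← integral_const_mul, ← integral_neg]
  simp only [neg_mul, mul_assoc]

lemma IsTest.iterate_deriv {f : ℝ → ℂ} (hf : IsTest f) (u : ℕ) : IsTest (_root_.deriv^[u] f) := by
  induction u with
  | zero => exact hf
  | succ u ih => rw [Function.iterate_succ_apply']; exact ih.deriv

lemma fourier_iterate_deriv {f : ℝ → ℂ} (hf : IsTest f) (w : ℂ) (u : ℕ) :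
    fourier (deriv^[u] f) w = (-w) ^ u * fourier f w := by
  induction u with
  | zero => simp
  | succ u ih =>
    rw [Function.iterate_succ_apply', fourier_deriv (hf.iterate_deriv u), ih, pow_succ]; ring

end

section

/-! ### An explicit formula for `Q_r` -/

lemma realRoot_neg (p : ℕ) (r : ℝ) : realRoot p (-r) = -realRoot p r := by
  simp [realRoot, Real.sign_neg]

lemma realRoot_pow {p : ℕ} (hp : Odd p) (r : ℝ) : realRoot p r ^ p = r := by
  have hp0 : p ≠ 0 := by rintro rfl; simp at hp
  have hs : Real.sign r ^ p = Real.sign r := by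
    rcases Real.sign_apply_eq r with h | h | h <;> simp [h, hp.neg_one_pow, hp0]
  rw [realRoot, mul_pow, hs, ← Real.rpow_natCast, ← Real.rpow_mul (abs_nonneg r), one_div,
    inv_mul_cancel₀ (by exact_mod_cast hp0), Real.rpow_one]
  rcases lt_trichotomy r 0 with h | h | h
  · rw [Real.sign_of_neg h, abs_of_neg h]; ring
  · simp [h]
  · rw [Real.sign_of_pos h, abs_of_pos h, one_mul]

/-- `q^x` for an exponent modulo `p`. -/
def qPow (p : ℕ) (q : ℂ) (x : ZMod p) : ℂ := q ^ x.val

section qPow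

variable {p : ℕ} {q : ℂ}

lemma qPow_natCast (hq : q ^ p = 1) (n : ℕ) : qPow p q n = q ^ n := by
  rw [qPow, ZMod.val_natCast]
  exact (pow_eq_pow_mod n hq).symm

@[simp] lemma qPow_zero : qPow p q 0 = 1 := by simp [qPow]

variable [NeZero p]

lemma qPow_add (hq : q ^ p = 1) (x y : ZMod p) : qPow p q (x + y) = qPow p q x * qPow p q y := by
  rw [← ZMod.natCast_zmod_val x, ← ZMod.natCast_zmod_val y, ← Nat.cast_add, qPow_natCast hq,
    qPow_natCast hq, qPow_natCast hq, pow_add]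

lemma qPow_neg (hq : q ^ p = 1) (x : ZMod p) : qPow p q (-x) = (qPow p q x)⁻¹ := by
  refine eq_inv_of_mul_eq_one_left ?_
  rw [← qPow_add hq, neg_add_cancel, qPow_zero]

lemma qPow_intCast (hq : q ^ p = 1) (n : ℤ) : qPow p q n = q ^ n := by
  obtain ⟨k, rfl | rfl⟩ := n.eq_nat_or_neg
  · rw [Int.cast_natCast, qPow_natCast hq, zpow_natCast]
  · rw [Int.cast_neg, Int.cast_natCast, qPow_neg hq, qPow_natCast hq, zpow_neg, zpow_natCast]

lemma pow_val_mul_val (hq : q ^ p = 1) (x y : ZMod p) : q ^ (x.val * y.val) = qPow p q (x * y) := by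
  rw [← qPow_natCast hq]
  simp

end qPow

/-- The multiplier `e^{ir(e^x z₊ + e^{-x} z₋)}`. -/
def phase (r : ℝ) (g : Pt) (x : ℝ) : ℂ :=
  Complex.exp (Complex.I * r * (Real.exp x * g.1 + Real.exp (-x) * g.2.1))

/-- The scalar factor of `Q_r(f t^j)_b`. -/
def QrCoeff (p : ℕ) (q h : ℂ) (r : ℝ) (b : Idx p) (j : ZMod p) : ℂ :=
  (Complex.I * realRoot p r) ^ ((b.1 : ℕ) + (b.2.1 : ℕ)) /
    (h ^ (((b.1 : ℕ) : ℤ) - (b.2.1 : ℕ) - 2 * ((b.1 : ℕ) * (b.2.1 : ℕ))) *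
      (qFact q b.1 * qFact q b.2.1)) *
    qPow p q ((b.2.2 - ((b.1 : ℕ) : ZMod p) - ((b.2.1 : ℕ) : ZMod p)) * j)

/-- The sum over `(t, s, u)` of the terms of `T_r` that contain `η₊ⁿ η₋ᵐ ζ(k, δ)`. -/
def Tr (p : ℕ) (q h : ℂ) (r : ℝ) (f : Vec p) (g : Pt) (b : Idx p) : Vec p := fun l x =>
  QrCoeff p q h r b (l - ((b.1 : ℕ) : ZMod p) + ((b.2.1 : ℕ) : ZMod p)) *
    (phase r g x * Complex.exp ((((b.1 : ℕ) : ℂ) - (b.2.1 : ℕ)) / p * x) *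
      f (l - ((b.1 : ℕ) : ZMod p) + ((b.2.1 : ℕ) : ZMod p)) (x - g.2.2))

lemma contDiff_phase (r : ℝ) (g : Pt) : ContDiff ℝ ∞ (phase r g) := by
  unfold phase
  refine ContDiff.cexp (contDiff_const.mul (ContDiff.add ?_ ?_))
  · exact (Complex.ofRealCLM.contDiff.comp Real.contDiff_exp).mul contDiff_const
  · exact (Complex.ofRealCLM.contDiff.comp (Real.contDiff_exp.comp contDiff_neg)).mul contDiff_const

lemma isTest_Tr {p : ℕ} (q h : ℂ) (r : ℝ) {f : Vec p} (hf : ∀ j, IsTest (f j)) (g : Pt)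
    (b : Idx p) (l : ZMod p) : IsTest (Tr p q h r f g b l) :=
  ((((hf _).comp_sub g.2.2).mul_left ((contDiff_phase r g).mul (contDiff_cexp_mul _))).mul_left
    contDiff_const)

lemma iterate_actSmallPP (p : ℕ) (r : ℝ) (n : ℕ) (v : Vec p) (j : ZMod p) (x : ℝ) :
    (actSmallPP p r)^[n] v j x =
      ((realRoot p (-r) * Real.exp (x / p) : ℝ) : ℂ) ^ n * v (j - n) x := by
  induction n generalizing j with
  | zero => simp
  | succ n ih =>
    rw [Function.iterate_succ_apply', actSmallPP, ih, pow_succ', mul_assoc]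
    congr 3
    push_cast; ring

lemma iterate_actSmallPM (p : ℕ) (r : ℝ) (n : ℕ) (v : Vec p) (j : ZMod p) (x : ℝ) :
    (actSmallPM p r)^[n] v j x =
      ((realRoot p (-r) * Real.exp (-x / p) : ℝ) : ℂ) ^ n * v (j + n) x := by
  induction n generalizing j with
  | zero => simp
  | succ n ih =>
    rw [Function.iterate_succ_apply', actSmallPM, ih, pow_succ', mul_assoc]
    congr 3
    push_cast; ring

lemma iterate_actPP (p : ℕ) (r : ℝ) (n : ℕ) (v : Vec p) (j : ZMod p) (x : ℝ) :
    (actPP p r)^[n] v j x = ((-r * Real.exp x : ℝ) : ℂ) ^ n * v j x := by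
  induction n with
  | zero => simp
  | succ n ih => rw [Function.iterate_succ_apply', actPP, ih, pow_succ', mul_assoc]

lemma iterate_actPM (p : ℕ) (r : ℝ) (n : ℕ) (v : Vec p) (j : ZMod p) (x : ℝ) :
    (actPM p r)^[n] v j x = ((-r * Real.exp (-x) : ℝ) : ℂ) ^ n * v j x := by
  induction n with
  | zero => simp
  | succ n ih => rw [Function.iterate_succ_apply', actPM, ih, pow_succ', mul_assoc]

lemma iterate_actKappa (p : ℕ) (q : ℂ) (n : ℕ) (v : Vec p) (j : ZMod p) (x : ℝ) :
    (actKappa p q)^[n] v j x = q ^ (n * j.val) * v j x := by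
  induction n with
  | zero => simp
  | succ n ih =>
    rw [Function.iterate_succ_apply', actKappa, ih, ← mul_assoc, ← pow_add]
    congr 2; ring

lemma iterate_actH (p : ℕ) (n : ℕ) (v : Vec p) (j : ZMod p) :
    (actH p)^[n] v j = fun x => (-Complex.I) ^ n * deriv^[n] (v j) x := by
  induction n with
  | zero => simp
  | succ n ih =>
    ext x
    rw [Function.iterate_succ_apply', actH, ih, Function.iterate_succ_apply']
    simp only [deriv_const_mul_field, pow_succ]
    ring

lemma actPhi_apply (p : ℕ) (q : ℂ) (r : ℝ) (n m k t s u : ℕ) (v : Vec p) (l : ZMod p) (x : ℝ) :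
    actPhi p q r n m k t s u v l x =
      ((-realRoot p r : ℝ) : ℂ) ^ (n + m) * q ^ (k * (l - n + m : ZMod p).val) *
        (-r : ℂ) ^ t * (-r : ℂ) ^ s * (-Complex.I) ^ u *
      (deriv^[u] (v (l - n + m)) x * Complex.exp (((n - m) / p + t - s) * x)) := by
  rw [actPhi, iterate_actSmallPP, iterate_actSmallPM, iterate_actKappa, iterate_actPP,
    iterate_actPM, iterate_actH, realRoot_neg]
  have e : Complex.exp ((((n : ℂ) - m) / p + t - s) * x) = Complex.exp (x / p) ^ n *
      Complex.exp (-x / p) ^ m * Complex.exp x ^ t * Complex.exp (-x) ^ s := by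
    rw [← Complex.exp_nat_mul, ← Complex.exp_nat_mul, ← Complex.exp_nat_mul,
      ← Complex.exp_nat_mul, ← Complex.exp_add, ← Complex.exp_add, ← Complex.exp_add]
    congr 1; ring
  rw [e]
  push_cast
  rw [mul_pow, mul_pow, mul_pow, mul_pow, pow_add]
  ring

lemma fourier_mul_exp (f : ℝ → ℂ) (a c ν : ℂ) :
    fourier (fun x => c * (f x * Complex.exp (a * x))) ν = c * fourier f (ν + a) := by
  rw [fourier, fourier, ← integral_const_mul]
  congr 1 with x
  rw [add_mul, Complex.exp_add]
  ring

section

variable {p : ℕ} [NeZero p] {q h : ℂ}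

lemma pairing_self (n m t s u : ℕ) (k : ZMod p) :
    pairing p q h n m ((k - (n : ZMod p) - (m : ZMod p)).val) t s u n m k t s u =
      Complex.I ^ (n + m + t + s + u) * h ^ ((n : ℤ) - m - 2 * (n * m)) *
      (u.factorial * t.factorial * s.factorial : ℂ) * (qFact q n * qFact q m) := by
  rw [pairing, if_pos]
  refine ⟨rfl, rfl, rfl, rfl, rfl, ?_⟩
  push_cast
  rw [ZMod.natCast_zmod_val]
  ring

/-- Since $1/i=-i$, the powers of $i$ in the pairing turn each $(-r)^{1/p}$ into $ir^{1/p}$ and each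
$-r$ into $ir$. -/
lemma QrTerm_fourier (hq : q ^ p = 1) (r : ℝ) {f : Vec p} (hf : ∀ j, IsTest (f j)) (g : Pt)
    (b : Idx p) (l : ZMod p) (ν : ℂ) (i : ℕ × ℕ × ℕ) :
    QrTerm p q h r (fun j => fourier (f j)) g b l ν i =
      QrCoeff p q h r b (l - ((b.1 : ℕ) : ZMod p) + ((b.2.1 : ℕ) : ZMod p)) *
      ((Complex.I * r * g.1) ^ i.1 / (i.1.factorial : ℂ) *
      ((Complex.I * r * g.2.1) ^ i.2.1 / (i.2.1.factorial : ℂ)) *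
      (((g.2.2 : ℝ) * (ν + (((b.1 : ℕ) : ℂ) - (b.2.1 : ℕ)) / p + i.1 - i.2.1)) ^ i.2.2 /
        (i.2.2.factorial : ℂ)) *
      fourier (f (l - ((b.1 : ℕ) : ZMod p) + ((b.2.1 : ℕ) : ZMod p)))
        (ν + (((b.1 : ℕ) : ℂ) - (b.2.1 : ℕ)) / p + i.1 - i.2.1)) := by
  obtain ⟨⟨n, hn⟩, ⟨m, hm⟩, k⟩ := b
  obtain ⟨t, s, u⟩ := i
  simp only [QrTerm, invFourier_fourier (hf _), pairing_self, QrCoeff]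
  have h1 := fourier_mul_exp (deriv^[u] (f (l - n + m))) (((n : ℂ) - m) / p + t - s)
    (((-realRoot p r : ℝ) : ℂ) ^ (n + m) * q ^ ((k - n - m : ZMod p).val * (l - n + m : ZMod p).val) *
        (-r : ℂ) ^ t * (-r : ℂ) ^ s * (-Complex.I) ^ u) ν
  have h2 : actPhi p q r n m (k - n - m : ZMod p).val t s u f l = fun x =>
      ((-realRoot p r : ℝ) : ℂ) ^ (n + m) * q ^ ((k - n - m : ZMod p).val *
        (l - n + m : ZMod p).val) * (-r : ℂ) ^ t * (-r : ℂ) ^ s * (-Complex.I) ^ u *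
      (deriv^[u] (f (l - n + m)) x * Complex.exp (((n - m) / p + t - s) * x)) :=
    funext fun x => actPhi_apply _ _ _ _ _ _ _ _ _ _ _ _
  rw [h2, h1, fourier_iterate_deriv (hf _), pow_val_mul_val hq]
  have hI : ∀ k : ℕ, (Complex.I ^ k)⁻¹ = (-Complex.I) ^ k := by
    intro k; rw [← inv_pow, Complex.inv_I]
  rw [show ν + (((n : ℂ) - m) / p + t - s) = ν + ((n : ℂ) - m) / p + t - s by ring]
  set w := ν + ((n : ℂ) - m) / p + t - s
  rw [div_eq_mul_inv]
  simp only [mul_inv, hI, div_eq_mul_inv]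
  push_cast
  have e1 : ∀ k : ℕ, (-(realRoot p r : ℂ)) ^ k * (-Complex.I) ^ k =
      (Complex.I * realRoot p r) ^ k := by intro k; rw [← mul_pow]; ring
  have e2 : ∀ k : ℕ, (-(r : ℂ)) ^ k * (-Complex.I) ^ k = (Complex.I * r) ^ k := by
    intro k; rw [← mul_pow]; ring
  -- Each factor $H$ contributes $-i$ from $\pi_r(H)$, $1/i=-i$ from the pairing and $-w$ from the
  -- transform of $d/dx$; the product is $w$.
  have e3 : (-Complex.I) ^ u * (-Complex.I) ^ u * (-w) ^ u = w ^ u := by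
    rw [← mul_pow, ← mul_pow]
    congr 1
    linear_combination (-w) * Complex.I_sq
  rw [mul_pow _ (g.1 : ℂ), mul_pow _ (g.2.1 : ℂ), mul_pow (g.2.2 : ℂ), ← e1, ← e2, ← e2, ← e3]
  rw [show n + m + t + s + u = (n + m) + (t + (s + u)) by ring, pow_add _ (n + m),
    pow_add _ t, pow_add _ s]
  ring

lemma hasSum_QrTerm (hq : q ^ p = 1) (r : ℝ) {f : Vec p} (hf : ∀ j, IsTest (f j)) (g : Pt)
    (b : Idx p) (l : ZMod p) (ν : ℂ) :
    HasSum (QrTerm p q h r (fun j => fourier (f j)) g b l ν)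
      (fourier (Tr p q h r f g b l) ν) := by
  have h1 := (hasSum_fourier_series (hf (l - ((b.1 : ℕ) : ZMod p) + ((b.2.1 : ℕ) : ZMod p)))
    (Complex.I * r * g.1) (Complex.I * r * g.2.1) g.2.2
    (ν + (((b.1 : ℕ) : ℂ) - (b.2.1 : ℕ)) / p)).mul_left
    (QrCoeff p q h r b (l - ((b.1 : ℕ) : ZMod p) + ((b.2.1 : ℕ) : ZMod p)))
  have h2 : QrTerm p q h r (fun j => fourier (f j)) g b l ν = _ :=
    funext fun i => QrTerm_fourier hq r hf g b l ν i
  rw [h2]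
  convert! h1 using 1
  rw [← fourier_mul_exp]
  congr 1 with x
  rw [Tr, phase]
  have : Complex.I * r * (Real.exp x * g.1 + Real.exp (-x) * g.2.1) =
    Complex.I * r * g.1 * Real.exp x + Complex.I * r * g.2.1 * Real.exp (-x) := by ring
  rw [this]
  ring

lemma Qr_fourier (hq : q ^ p = 1) (r : ℝ) {f : Vec p} (hf : ∀ j, IsTest (f j)) (g : Pt)
    (b : Idx p) :
    Qr p q h r (fun j => fourier (f j)) g b = fun l => fourier (Tr p q h r f g b l) := by
  ext l ν
  exact (hasSum_QrTerm hq r hf g b l ν).tsum_eq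

end

end

section

/-! ### Linearity, smoothness and the counit -/

/-- An integral of a smooth function depending smoothly on a parameter is smooth, provided that
the integrand is supported in a fixed compact set. -/
lemma contDiff_integral_of_compact {P : Type*} [NormedAddCommGroup P] [NormedSpace ℝ P]
    {G : P → ℝ → ℂ} {k : Set ℝ} (hk : IsCompact k) (hG : ∀ a x, x ∉ k → G a x = 0)
    (hs : ContDiff ℝ ∞ ↿G) : ContDiff ℝ ∞ (fun a => ∫ x, G a x) := by
  -- The integral is the convolution of the constant $1$ with $x\mapsto G(a,-x)$, evaluated at $0$.
  have h1 := contDiffOn_convolution_right_with_param_comp (𝕜 := ℝ) (n := ⊤) (μ := volume)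
    (ContinuousLinearMap.lsmul ℝ ℝ) (s := Set.univ) (v := fun _ : P => (0 : ℝ)) contDiffOn_const
    (f := fun _ : ℝ => (1 : ℝ)) (g := fun a x => G a (-x)) isOpen_univ hk.neg
    (fun a x _ hx => hG a (-x) (by simpa using hx)) (locallyIntegrable_const 1)
    (ContDiff.contDiffOn (hs.comp (contDiff_fst.prodMk contDiff_snd.neg)))
  rw [contDiffOn_univ] at h1
  simpa [convolution] using h1

/-- The substitution $x=y+\lambda$ moves the parameter out of the argument of $f$, so that the
integrand is supported in a compact set independent of $g_0$. -/
lemma contDiff_fourier_Tr {p : ℕ} (q h : ℂ) (r : ℝ) {f : Vec p} (hf : ∀ j, IsTest (f j))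
    (b : Idx p) (l : ZMod p) (ν : ℂ) :
    ContDiff ℝ ∞ (fun g => fourier (Tr p q h r f g b l) ν) := by
  set j := l - ((b.1 : ℕ) : ZMod p) + ((b.2.1 : ℕ) : ZMod p) with hj
  set a : ℂ := (((b.1 : ℕ) : ℂ) - (b.2.1 : ℕ)) / p with ha
  have h1 : ∀ g : Pt, fourier (Tr p q h r f g b l) ν = ∫ y, (QrCoeff p q h r b j *
      (phase r g (y + g.2.2) * Complex.exp (a * (y + g.2.2 : ℝ)) * f j y)) *
      Complex.exp (ν * (y + g.2.2 : ℝ)) := by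
    intro g
    rw [fourier, ← integral_add_right_eq_self _ g.2.2]
    congr 1 with y
    simp only [Tr, add_sub_cancel_right, ← hj, ← ha]
  simp only [h1]
  refine contDiff_integral_of_compact (hf j).supp.isCompact (fun g y hy => ?_) ?_
  · simp [image_eq_zero_of_notMem_tsupport hy]
  · have e1 : ContDiff ℝ ∞ (fun x : Pt × ℝ => ((x.2 + x.1.2.2 : ℝ) : ℂ)) :=
      Complex.ofRealCLM.contDiff.comp (contDiff_snd.add contDiff_fst.snd.snd)
    have e2 : ContDiff ℝ ∞ (fun x : Pt × ℝ => phase r x.1 (x.2 + x.1.2.2)) := by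
      unfold phase
      refine ContDiff.cexp (contDiff_const.mul (ContDiff.add ?_ ?_))
      · exact (Complex.ofRealCLM.contDiff.comp
          (Real.contDiff_exp.comp (contDiff_snd.add contDiff_fst.snd.snd))).mul
          (Complex.ofRealCLM.contDiff.comp contDiff_fst.fst)
      · exact (Complex.ofRealCLM.contDiff.comp
          (Real.contDiff_exp.comp (contDiff_snd.add contDiff_fst.snd.snd).neg)).mul
          (Complex.ofRealCLM.contDiff.comp contDiff_fst.snd.fst)
    exact ((contDiff_const.mul ((e2.mul (contDiff_const.mul e1).cexp).mul
      ((hf j).smooth.comp contDiff_snd))).mul (contDiff_const.mul e1).cexp)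

lemma sum_inv_pow_mul_val {p : ℕ} [NeZero p] {q : ℂ} (hq : IsPrimitiveRoot q p) (k : ZMod p) :
    ∑ n ∈ Finset.range p, q⁻¹ ^ (n * k.val) = if k = 0 then (p : ℂ) else 0 := by
  split_ifs with hk
  · simp [hk]
  · have h1 : (q⁻¹ ^ k.val) ≠ 1 := by
      rw [inv_pow, ne_eq, inv_eq_one]
      intro h2
      have h3 := Nat.eq_zero_of_dvd_of_lt ((hq.pow_eq_one_iff_dvd _).1 h2) (ZMod.val_lt k)
      exact hk ((ZMod.val_eq_zero k).1 h3)
    have h2 := mul_geom_sum (q⁻¹ ^ k.val) p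
    rw [← pow_mul, mul_comm k.val, pow_mul, inv_pow q p, hq.pow_eq_one, inv_one, one_pow,
      sub_self] at h2
    simp only [mul_comm _ k.val, pow_mul]
    exact (mul_eq_zero.1 h2).resolve_left (sub_ne_zero.2 h1)

section

variable {p : ℕ} [NeZero p] {q h : ℂ}

lemma summable_QrTerm (hq : q ^ p = 1) (r : ℝ) {F : ZMod p → ℂ → ℂ} (hF : F ∈ FVec p) (g : Pt)
    (b : Idx p) (l : ZMod p) (ν : ℂ) : Summable (QrTerm p q h r F g b l ν) := by
  obtain ⟨f, hf, rfl⟩ := exists_of_mem_FVec hF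
  exact (hasSum_QrTerm hq r hf g b l ν).summable

lemma Qr_mem (hq : q ^ p = 1) (r : ℝ) {F : ZMod p → ℂ → ℂ} (hF : F ∈ FVec p) (g : Pt)
    (b : Idx p) : Qr p q h r F g b ∈ FVec p := by
  obtain ⟨f, hf, rfl⟩ := exists_of_mem_FVec hF
  rw [Qr_fourier hq r hf]
  exact fun l => mem_PW_iff.2 ⟨_, isTest_Tr q h r hf g b l, rfl⟩

lemma contDiff_Qr (hq : q ^ p = 1) (r : ℝ) {F : ZMod p → ℂ → ℂ} (hF : F ∈ FVec p)
    (b : Idx p) (l : ZMod p) (ν : ℂ) : ContDiff ℝ ∞ (fun g => Qr p q h r F g b l ν) := by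
  obtain ⟨f, hf, rfl⟩ := exists_of_mem_FVec hF
  simp only [Qr_fourier hq r hf]
  exact contDiff_fourier_Tr q h r hf b l ν

lemma Qr_add (hq : q ^ p = 1) (r : ℝ) {F G : ZMod p → ℂ → ℂ} (hF : F ∈ FVec p)
    (hG : G ∈ FVec p) : Qr p q h r (F + G) = Qr p q h r F + Qr p q h r G := by
  obtain ⟨f, hf, rfl⟩ := exists_of_mem_FVec hF
  obtain ⟨f', hf', rfl⟩ := exists_of_mem_FVec hG
  ext g b l ν
  have h1 : (fun j => fourier (f j)) + (fun j => fourier (f' j)) =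
      fun j => fourier ((f + f') j) := by
    ext j; simp [fourier_add (hf j) (hf' j)]
  rw [h1, Pi.add_apply, Pi.add_apply, Pi.add_apply, Pi.add_apply, Qr_fourier (f := f + f') hq r (fun j => (hf j).add (hf' j)), Qr_fourier hq r hf,
    Qr_fourier hq r hf']
  have h2 : Tr p q h r (f + f') g b l = Tr p q h r f g b l + Tr p q h r f' g b l := by
    ext x; simp only [Tr, Pi.add_apply]; ring
  beta_reduce
  rw [h2, fourier_add (isTest_Tr q h r hf g b l) (isTest_Tr q h r hf' g b l)]
  rfl

lemma Qr_smul (hq : q ^ p = 1) (r : ℝ) {F : ZMod p → ℂ → ℂ} (hF : F ∈ FVec p) (a : ℂ) :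
    Qr p q h r (a • F) = a • Qr p q h r F := by
  obtain ⟨f, hf, rfl⟩ := exists_of_mem_FVec hF
  ext g b l ν
  have h1 : a • (fun j => fourier (f j)) = fun j => fourier ((a • f) j) := by
    ext j; simp [fourier_smul]
  rw [h1, Pi.smul_apply, Pi.smul_apply, Pi.smul_apply, Pi.smul_apply, Qr_fourier (f := a • f) hq r (fun j => (hf j).const_smul a), Qr_fourier hq r hf]
  have h2 : Tr p q h r (a • f) g b l = a • Tr p q h r f g b l := by
    ext x; simp only [Tr, Pi.smul_apply, smul_eq_mul]; ring
  beta_reduce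
  rw [h2, fourier_smul]
  rfl

/-- The counit kills $\eta_\pm$, and it kills $\zeta(k,\delta)$ for $k\ne0$ by orthogonality of
characters. The one surviving coefficient is the identity at the unit point. -/
lemma counit_Qr (hq : IsPrimitiveRoot q p) (r : ℝ) {F : ZMod p → ℂ → ℂ} (hF : F ∈ FVec p)
    (l : ZMod p) (ν : ℂ) : counit p q (fun b g => Qr p q h r F g b l ν) = F l ν := by
  obtain ⟨f, hf, rfl⟩ := exists_of_mem_FVec hF
  simp only [Qr_fourier hq.pow_eq_one r hf, counit, sum_inv_pow_mul_val hq]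
  have hp0 : (p : ℂ) ≠ 0 := by exact_mod_cast NeZero.ne p
  rw [Finset.sum_eq_single ((0, 0, 0) : Idx p)]
  · have h1 : Tr p q h r f (0, 0, 0) ((0, 0, 0) : Idx p) l = f l := by
      ext x
      simp [Tr, QrCoeff, phase, qFact]
    simp [h1, hp0]
  · rintro ⟨n, m, k⟩ - hb
    by_cases hn : (n : ℕ) = 0
    · by_cases hm : (m : ℕ) = 0
      · have hk : k ≠ 0 := by
          rintro rfl
          exact hb (by ext <;> simp [hn, hm])
        simp [hk]
      · simp [hm]
    · simp [hn]
  · simp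

end

end

section

/-! ### `q`-numbers -/

lemma qNum_zero (q : ℂ) : qNum q 0 = 0 := by simp [qNum]

lemma qNum_inv (q : ℂ) (n : ℕ) : qNum q⁻¹ n = qNum q n := by
  rw [qNum, qNum, inv_inv, ← neg_sub (q ^ n), ← neg_sub q, neg_div_neg_eq]

lemma qFact_inv (q : ℂ) (n : ℕ) : qFact q⁻¹ n = qFact q n := by
  simp [qFact, qNum_inv]

lemma qFact_zero (q : ℂ) : qFact q 0 = 1 := by simp [qFact]

lemma qFact_succ (q : ℂ) (n : ℕ) : qFact q (n + 1) = qFact q n * qNum q (n + 1) := by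
  rw [qFact, Finset.prod_range_succ, qFact]

/-- The source of the $q$-Pascal rule: both binomial arguments below split $[N]$ in this way. -/
lemma qNum_add {q : ℂ} (hq : q ≠ 0) (i j : ℕ) :
    qNum q (i + j) = q ^ j * qNum q i + q⁻¹ ^ i * qNum q j := by
  simp only [qNum]
  rw [← mul_div_assoc, ← mul_div_assoc, ← add_div]
  congr 1
  rw [pow_add, pow_add]
  have : q ^ j * q⁻¹ ^ j = 1 := by rw [← mul_pow, mul_inv_cancel₀ hq, one_pow]
  have h2 : q⁻¹ ^ i * q ^ i = 1 := by rw [← mul_pow, inv_mul_cancel₀ hq, one_pow]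
  ring

lemma qNum_self {p : ℕ} {q : ℂ} (hq : q ^ p = 1) : qNum q p = 0 := by
  simp [qNum, hq]

lemma qNum_add_self {p : ℕ} {q : ℂ} (hq : q ^ p = 1) (n : ℕ) : qNum q (p + n) = qNum q n := by
  simp [qNum, pow_add, hq]

/-- $[n]=0$ would give $q^{2n}=1$, hence $p\mid2n$ and, $p$ being odd, $p\mid n$. -/
lemma qNum_ne_zero {p : ℕ} (hp : Odd p) {q : ℂ} (hq : IsPrimitiveRoot q p) {n : ℕ} (h0 : 0 < n)
    (hn : n < p) : qNum q n ≠ 0 := by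
  have hq0 : q ≠ 0 := hq.ne_zero (by omega)
  have key : ∀ k : ℕ, 0 < k → k < p → q ^ k - q⁻¹ ^ k ≠ 0 := by
    intro k hk hkp h
    have h1 : q ^ (2 * k) = 1 := by
      rw [two_mul, pow_add]
      nth_rewrite 1 [sub_eq_zero.1 h]
      rw [← mul_pow, inv_mul_cancel₀ hq0, one_pow]
    have h2 := (hq.pow_eq_one_iff_dvd _).1 h1
    have h3 := (Nat.Coprime.dvd_of_dvd_mul_left (Nat.Coprime.symm (Nat.coprime_two_left.2 hp)) h2)
    exact absurd (Nat.le_of_dvd hk h3) (by omega)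
  have h1 := key 1 one_pos (by omega)
  rw [pow_one, pow_one] at h1
  exact div_ne_zero (key n h0 hn) h1

/-- Because the inverse of $0$ is $0$ by convention, coefficients containing $1/[n]!$ with $n\ge p$
vanish, and sums over full antidiagonals truncate themselves. -/
lemma qFact_eq_zero {p : ℕ} (hp : 0 < p) {q : ℂ} (hq : q ^ p = 1) {n : ℕ} (hn : p ≤ n) :
    qFact q n = 0 := by
  refine Finset.prod_eq_zero (i := p - 1) (Finset.mem_range.2 (by omega)) ?_
  rw [Nat.sub_add_cancel hp, qNum_self hq]

/-! ### The `q`-binomial formula at a root of unity -/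

section QBinomial

variable {T : Type*} [Ring T] [Algebra ℂ T]

/-- The part of degree `N` of the product of the truncated `q`-exponentials of `A` and `B`. -/
def qExpDeg (q : ℂ) (A B : T) (N : ℕ) : T :=
  ∑ x ∈ Finset.HasAntidiagonal.antidiagonal N,
    (q⁻¹ ^ (x.1 * x.2) * ((qFact q x.1)⁻¹ * (qFact q x.2)⁻¹)) • (A ^ x.1 * B ^ x.2)

variable {p : ℕ} {q : ℂ} {A B : T}

lemma mul_pow_of_qcomm {c : ℂ} (h : B * A = c • (A * B)) (i : ℕ) :
    B * A ^ i = c ^ i • (A ^ i * B) := by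
  induction i with
  | zero => simp
  | succ i ih =>
    rw [pow_succ, ← mul_assoc, ih, smul_mul_assoc, mul_assoc, h, mul_smul_comm, smul_smul,
      pow_succ, ← mul_assoc]

lemma pow_mul_pow_of_qcomm {c : ℂ} (h : B * A = c • (A * B)) (i j : ℕ) :
    B ^ j * A ^ i = c ^ (i * j) • (A ^ i * B ^ j) := by
  induction j with
  | zero => simp
  | succ j ih =>
    rw [pow_succ, mul_assoc, mul_pow_of_qcomm h, mul_smul_comm, ← mul_assoc, ih, smul_mul_assoc,
      smul_smul, mul_assoc, mul_add, mul_one, pow_add, mul_comm (c ^ i)]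

/-- Cancelling $[i+1]$ is illegitimate at $i+1=p$, where it vanishes. From there on $A^{i+1}=0$, so
the identity survives in the algebra. -/
lemma qFact_inv_smul_pow (hp : Odd p) (hq : IsPrimitiveRoot q p) (hA : A ^ p = 0) (i : ℕ) :
    (qNum q (i + 1) * (qFact q (i + 1))⁻¹) • A ^ (i + 1) = (qFact q i)⁻¹ • A ^ (i + 1) := by
  by_cases hi : i + 1 < p
  · congr 1
    have := qNum_ne_zero hp hq (Nat.succ_pos i) hi
    rw [qFact_succ, mul_inv, mul_left_comm, mul_inv_cancel₀ this, mul_one]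
  · rw [pow_eq_zero_of_le (by omega) hA, smul_zero, smul_zero]

/-- Split $[k+1]=[i+j]$ by `qNum_add`: one part cancels against $[i]!$ and restores a factor $A$,
the other cancels against $[j]!$ and restores a factor $B$ moved past $A^i$. Unlike the closed form
$(A+B)^k/[k]!$, the recursion makes sense in every degree, also across $k+1=p$. -/
lemma add_mul_qExpDeg (hp : Odd p) (hq : IsPrimitiveRoot q p)
    (hAB : A * B = q ^ 2 • (B * A)) (hA : A ^ p = 0) (hB : B ^ p = 0) (k : ℕ) :
    (A + B) * qExpDeg q A B k = qNum q (k + 1) • qExpDeg q A B (k + 1) := by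
  have hq0 : q ≠ 0 := hq.ne_zero (by rintro rfl; simp at hp)
  have hBA : B * A = q⁻¹ ^ 2 • (A * B) := by
    rw [hAB, smul_smul, ← mul_pow, inv_mul_cancel₀ hq0, one_pow, one_smul]
  have h1 : qNum q (k + 1) • qExpDeg q A B (k + 1) =
      (∑ x ∈ Finset.HasAntidiagonal.antidiagonal (k + 1), (q⁻¹ ^ (x.1 * x.2) * q ^ x.2 * (qFact q x.2)⁻¹) •
        (((qNum q x.1 * (qFact q x.1)⁻¹) • A ^ x.1) * B ^ x.2)) +
      ∑ x ∈ Finset.HasAntidiagonal.antidiagonal (k + 1), (q⁻¹ ^ (x.1 * x.2) * q⁻¹ ^ x.1 * (qFact q x.1)⁻¹) •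
        (A ^ x.1 * ((qNum q x.2 * (qFact q x.2)⁻¹) • B ^ x.2)) := by
    rw [qExpDeg, Finset.smul_sum, ← Finset.sum_add_distrib]
    refine Finset.sum_congr rfl fun x hx => ?_
    rw [← Finset.HasAntidiagonal.mem_antidiagonal.1 hx, qNum_add hq0, smul_mul_assoc, mul_smul_comm, smul_smul,
      smul_smul, smul_smul, ← add_smul]
    congr 1
    ring
  rw [h1, Finset.Nat.sum_antidiagonal_succ, Finset.Nat.sum_antidiagonal_succ', qNum_zero]
  simp only [zero_mul, zero_smul, smul_zero, mul_zero, zero_add]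
  rw [add_mul, qExpDeg, Finset.mul_sum, Finset.mul_sum]
  congr 1
  · refine Finset.sum_congr rfl fun x _ => ?_
    rw [qFact_inv_smul_pow hp hq hA, mul_smul_comm, ← mul_assoc A, ← pow_succ', smul_mul_assoc,
      smul_smul]
    congr 1
    have : q⁻¹ ^ ((x.1 + 1) * x.2) * q ^ x.2 = q⁻¹ ^ (x.1 * x.2) := by
      rw [add_mul, one_mul, pow_add, mul_assoc, ← mul_pow, inv_mul_cancel₀ hq0, one_pow, mul_one]
    rw [this]; ring
  · refine Finset.sum_congr rfl fun x _ => ?_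
    rw [qFact_inv_smul_pow hp hq hB, mul_smul_comm, ← mul_assoc B, mul_pow_of_qcomm hBA,
      smul_mul_assoc, mul_assoc, ← pow_succ', mul_smul_comm, smul_smul, smul_smul]
    congr 1
    rw [← pow_mul]
    ring

lemma qExpDeg_zero : qExpDeg q A B 0 = 1 := by simp [qExpDeg, qFact_zero]

/-- Since $[p+n]=[n]$, the recursion from degree $p$ upwards has the same invertible coefficients
$[1],\dots,[p-1]$ as from degree $0$. It therefore restarts at $p$ with the degree-$p$ part as
initial value. -/
lemma qExpDeg_add (hp : Odd p) (hq : IsPrimitiveRoot q p) (hAB : A * B = q ^ 2 • (B * A))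
    (hA : A ^ p = 0) (hB : B ^ p = 0) {s : ℕ} (hs : s = 0 ∨ s = p) {N : ℕ} (hN : N < p) :
    qExpDeg q A B (s + N) = (qFact q N)⁻¹ • ((A + B) ^ N * qExpDeg q A B s) := by
  induction N with
  | zero => simp [qFact_zero]
  | succ N ih =>
    have h1 := add_mul_qExpDeg hp hq hAB hA hB (s + N)
    have h2 := qNum_ne_zero hp hq (Nat.succ_pos N) hN
    have h3 : qNum q (s + N + 1) = qNum q (N + 1) := by
      rcases hs with rfl | rfl
      · simp
      · rw [add_assoc, qNum_add_self hq.pow_eq_one]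
    rw [h3, ih (by omega)] at h1
    rw [← add_assoc, ← one_smul ℂ (qExpDeg q A B (s + N + 1)), ← inv_mul_cancel₀ h2, mul_smul, ← h1,
      mul_smul_comm, smul_smul, qFact_succ, mul_inv, pow_succ', mul_assoc, mul_comm (qNum _ _)⁻¹]

lemma qExpDeg_of_lt (hp : Odd p) (hq : IsPrimitiveRoot q p) (hAB : A * B = q ^ 2 • (B * A))
    (hA : A ^ p = 0) (hB : B ^ p = 0) {N : ℕ} (hN : N < p) :
    qExpDeg q A B N = (qFact q N)⁻¹ • (A + B) ^ N := by
  have := qExpDeg_add hp hq hAB hA hB (Or.inl rfl) hN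
  rwa [zero_add, qExpDeg_zero, mul_one] at this

/-- The product of the truncated `q`-exponentials of `A` and `B`, with weights depending on the
total degree. -/
lemma sum_qExp_mul_weight (hp : Odd p) (hq : IsPrimitiveRoot q p) (hAB : A * B = q ^ 2 • (B * A))
    (hA : A ^ p = 0) (hB : B ^ p = 0) (w : ℕ → T) :
    ∑ n ∈ Finset.range p, ∑ n' ∈ Finset.range p,
      (q⁻¹ ^ (n * n') * ((qFact q n)⁻¹ * (qFact q n')⁻¹)) • (A ^ n * B ^ n' * w (n + n')) =
    ∑ N ∈ Finset.range p,
      (qFact q N)⁻¹ • ((A + B) ^ N * (w N + qExpDeg q A B p * w (N + p))) := by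
  have h1 : ∑ N ∈ Finset.range (p + p), qExpDeg q A B N * w N = ∑ N ∈ Finset.range p,
      (qFact q N)⁻¹ • ((A + B) ^ N * (w N + qExpDeg q A B p * w (N + p))) := by
    rw [Finset.sum_range_add, ← Finset.sum_add_distrib]
    refine Finset.sum_congr rfl fun N hN => ?_
    rw [qExpDeg_of_lt hp hq hAB hA hB (Finset.mem_range.1 hN),
      qExpDeg_add hp hq hAB hA hB (Or.inr rfl) (Finset.mem_range.1 hN), mul_add, smul_add,
      smul_mul_assoc, smul_mul_assoc, mul_assoc, add_comm N p]
  rw [← h1, ← Finset.sum_product', ← Finset.sum_fiberwise_of_maps_to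
    (t := Finset.range (p + p)) (g := fun x => x.1 + x.2)]
  · refine Finset.sum_congr rfl fun N _ => ?_
    rw [qExpDeg, Finset.sum_mul]
    have hsub : (Finset.range p ×ˢ Finset.range p).filter (fun x => x.1 + x.2 = N) ⊆
        Finset.HasAntidiagonal.antidiagonal N := fun x hx => Finset.HasAntidiagonal.mem_antidiagonal.2 (Finset.mem_filter.1 hx).2
    -- The pairs of total degree $N$ outside the square $[0,p)^2$ have an index at least $p$, and
    -- their monomials vanish.
    rw [← Finset.sum_subset hsub]
    · refine Finset.sum_congr rfl fun x hx => ?_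
      rw [(Finset.mem_filter.1 hx).2, smul_mul_assoc]
    · intro x hx hx'
      have hx2 := Finset.HasAntidiagonal.mem_antidiagonal.1 hx
      have : p ≤ x.1 ∨ p ≤ x.2 := by
        by_contra! h
        exact hx' (Finset.mem_filter.2 ⟨Finset.mem_product.2
          ⟨Finset.mem_range.2 h.1, Finset.mem_range.2 h.2⟩, hx2⟩)
      rcases this with h | h
      · rw [pow_eq_zero_of_le h hA, zero_mul, smul_zero, zero_mul]
      · rw [pow_eq_zero_of_le h hB, mul_zero, smul_zero, zero_mul]
  · intro x hx
    simp only [Finset.mem_product, Finset.mem_range] at hx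
    exact Finset.mem_range.2 (by omega)

/-- Every monomial of the product has total degree $2p$, so after reordering one of the two
exponents is at least $p$. -/
lemma qExpDeg_mul_self (hq0 : q ≠ 0) (hAB : A * B = q ^ 2 • (B * A))
    (hA : A ^ p = 0) (hB : B ^ p = 0) : qExpDeg q A B p * qExpDeg q A B p = 0 := by
  have hBA : B * A = q⁻¹ ^ 2 • (A * B) := by
    rw [hAB, smul_smul, ← mul_pow, inv_mul_cancel₀ hq0, one_pow, one_smul]
  rw [qExpDeg, Finset.sum_mul_sum]
  refine Finset.sum_eq_zero fun x hx => Finset.sum_eq_zero fun y hy => ?_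
  have hx2 := Finset.HasAntidiagonal.mem_antidiagonal.1 hx
  have hy2 := Finset.HasAntidiagonal.mem_antidiagonal.1 hy
  rw [smul_mul_smul_comm, mul_assoc (A ^ x.1), ← mul_assoc (B ^ x.2), pow_mul_pow_of_qcomm hBA,
    smul_mul_assoc, mul_smul_comm, mul_assoc (A ^ y.1), ← pow_add, ← mul_assoc (A ^ x.1), ← pow_add]
  rcases le_or_gt p (x.1 + y.1) with h | h
  · rw [pow_eq_zero_of_le h hA, zero_mul, smul_zero, smul_zero]
  · rw [pow_eq_zero_of_le (n := x.2 + y.2) (by omega) hB, mul_zero, smul_zero, smul_zero]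

/-- This identifies the degree-$p$ part with the sum prescribed in $\Delta(z_\pm)$: modulo $q^p=1$,
the exponent $-(p-n)n$ is $n^2$. -/
lemma qExpDeg_self_eq (hp : 0 < p) (hq : q ^ p = 1) :
    qExpDeg q A B p = ∑ n ∈ Finset.Ico 1 p,
      (q ^ (n ^ 2) / (qFact q (p - n) * qFact q n)) • (A ^ (p - n) * B ^ n) := by
  rw [qExpDeg, ← Finset.Nat.sum_antidiagonal_swap, Finset.Nat.sum_antidiagonal_eq_sum_range_succ_mk,
    Finset.sum_range_succ, Finset.range_eq_Ico, Finset.sum_eq_sum_Ico_succ_bot hp]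
  -- The two end terms contain $1/[p]!$, which is $0$ by convention; this leaves $0<n<p$.
  simp only [Prod.swap_prod_mk, tsub_zero, qFact_eq_zero hp hq le_rfl, inv_zero, mul_zero, zero_mul,
    zero_smul, zero_add, add_zero]
  refine Finset.sum_congr rfl fun n hn => ?_
  have hn' := Finset.mem_Ico.1 hn
  congr 1
  have : q⁻¹ ^ ((p - n) * n) = q ^ (n ^ 2) := by
    rw [inv_pow]
    refine inv_eq_of_mul_eq_one_right ?_
    rw [← pow_add, show (p - n) * n + n ^ 2 = p * n by rw [sq, ← add_mul]; congr 1; omega, pow_mul, hq, one_pow]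
  rw [this, div_eq_mul_inv, mul_inv]

lemma commute_qExpDeg {C : T} {c d : ℂ} (hcd : ∀ x : ℕ × ℕ, x.1 + x.2 = p → c ^ x.1 * d ^ x.2 = 1)
    (hA : C * A = c • (A * C)) (hB : C * B = d • (B * C)) : Commute C (qExpDeg q A B p) := by
  rw [qExpDeg]
  refine Commute.sum_right _ _ _ fun x hx => Commute.smul_right ?_ _
  rw [Commute, SemiconjBy, ← mul_assoc, mul_pow_of_qcomm hA, smul_mul_assoc, mul_assoc,
    mul_pow_of_qcomm hB, mul_smul_comm, smul_smul, hcd x (Finset.HasAntidiagonal.mem_antidiagonal.1 hx), one_smul,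
    mul_assoc]

end QBinomial

end

/-! ### The $q$-binomial formula for two pairs of variables -/

section

/-- The one-pair formula is applied with $q^{-1}$ to the inner pair and with $q$ to the outer pair.
The hypothesis `hS` moves the degree-$p$ part of the outer pair past $(A'+B')^M$, so that both
binomial powers stand on the left. -/
lemma sum_qExp_mul_weight₂ {T : Type*} [Ring T] [Algebra ℂ T] {p : ℕ} {q : ℂ} {A B A' B' : T}
    (hp : Odd p) (hq : IsPrimitiveRoot q p)
    (hAB : A * B = q ^ 2 • (B * A)) (hA : A ^ p = 0) (hB : B ^ p = 0)
    (hAB' : A' * B' = q⁻¹ ^ 2 • (B' * A')) (hA' : A' ^ p = 0) (hB' : B' ^ p = 0)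
    (hS : Commute (A' + B') (qExpDeg q A B p)) (W : ℕ → ℕ → T) :
    ∑ n ∈ Finset.range p, ∑ n' ∈ Finset.range p, ∑ m ∈ Finset.range p, ∑ m' ∈ Finset.range p,
      (q⁻¹ ^ (n * n') * ((qFact q n)⁻¹ * (qFact q n')⁻¹) *
        (q ^ (m * m') * ((qFact q m)⁻¹ * (qFact q m')⁻¹))) •
        (A ^ n * B ^ n' * (A' ^ m * B' ^ m' * W (n + n') (m + m'))) =
    ∑ N ∈ Finset.range p, ∑ M ∈ Finset.range p, ((qFact q N)⁻¹ * (qFact q M)⁻¹) •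
      ((A + B) ^ N * (A' + B') ^ M * (W N M + qExpDeg q⁻¹ A' B' p * W N (M + p) +
        qExpDeg q A B p * (W (N + p) M + qExpDeg q⁻¹ A' B' p * W (N + p) (M + p)))) := by
  have h2 : ∀ w : ℕ → T, _ := fun w => sum_qExp_mul_weight hp hq.inv hAB' hA' hB' w
  simp only [inv_inv, qFact_inv] at h2
  have h1 := sum_qExp_mul_weight hp hq hAB hA hB fun N => ∑ M ∈ Finset.range p,
      (qFact q M)⁻¹ • ((A' + B') ^ M * (W N M + qExpDeg q⁻¹ A' B' p * W N (M + p)))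
  convert h1 using 1
  · refine Finset.sum_congr rfl fun n _ => Finset.sum_congr rfl fun n' _ => ?_
    rw [← h2 (W (n + n')), Finset.mul_sum, Finset.smul_sum]
    refine Finset.sum_congr rfl fun m _ => ?_
    rw [Finset.mul_sum, Finset.smul_sum]
    refine Finset.sum_congr rfl fun m' _ => ?_
    rw [mul_smul_comm, smul_smul]
  · refine Finset.sum_congr rfl fun N _ => ?_
    rw [Finset.mul_sum, ← Finset.sum_add_distrib, Finset.mul_sum, Finset.smul_sum]
    refine Finset.sum_congr rfl fun M _ => ?_
    rw [mul_smul_comm (qFact q M)⁻¹ (qExpDeg q A B p), ← smul_add, mul_smul_comm, smul_smul,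
      mul_assoc ((A + B) ^ N), mul_add ((A' + B') ^ M), ← mul_assoc (qExpDeg q A B p),
      ← (hS.pow_left M).eq, mul_assoc ((A' + B') ^ M) (qExpDeg q A B p)]

/-! ### Relations in the algebra -/

section Relations

variable (p : ℕ) (q : ℂ)

lemma gen_rel {x y : FreeAlgebra ℂ Gen} (h : Rel p q x y) :
    RingQuot.mkAlgHom ℂ (Rel p q) x = RingQuot.mkAlgHom ℂ (Rel p q) y :=
  RingQuot.mkAlgHom_rel ℂ h

lemma etaM_mul_etaP : etaM p q * etaP p q = q ^ 2 • (etaP p q * etaM p q) := by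
  have h := gen_rel p q Rel.eta_eta
  simp only [map_mul, map_smul] at h
  exact h

lemma etaP_mul_delta :
    etaP p q * gen p q Gen.delta = q ^ 2 • (gen p q Gen.delta * etaP p q) := by
  have h := gen_rel p q Rel.etaP_delta
  simp only [map_mul, map_smul] at h
  exact h

lemma etaM_mul_delta :
    etaM p q * gen p q Gen.delta = q ^ 2 • (gen p q Gen.delta * etaM p q) := by
  have h := gen_rel p q Rel.etaM_delta
  simp only [map_mul, map_smul] at h
  exact h

lemma etaP_pow_self : etaP p q ^ p = 0 := by
  have h := gen_rel p q Rel.etaP_pow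
  simp only [map_pow, map_zero] at h
  exact h

lemma etaM_pow_self : etaM p q ^ p = 0 := by
  have h := gen_rel p q Rel.etaM_pow
  simp only [map_pow, map_zero] at h
  exact h

lemma delta_pow_self : gen p q Gen.delta ^ p = 1 := by
  have h := gen_rel p q Rel.delta_pow
  simp only [map_pow, map_one] at h
  exact h

variable {p q}

lemma deltaPow_natCast (n : ℕ) : deltaPow p q n = gen p q Gen.delta ^ n := by
  rw [deltaPow, ZMod.val_natCast]
  exact (pow_eq_pow_mod n (delta_pow_self p q)).symm

lemma deltaPow_zero : deltaPow p q 0 = 1 := by simp [deltaPow]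

lemma etaM_pow_mul_etaP_pow (m n : ℕ) :
    etaM p q ^ m * etaP p q ^ n = q ^ (2 * (n * m)) • (etaP p q ^ n * etaM p q ^ m) := by
  rw [pow_mul_pow_of_qcomm (etaM_mul_etaP p q), ← pow_mul]

variable [NeZero p]

lemma deltaPow_add (x y : ZMod p) : deltaPow p q (x + y) = deltaPow p q x * deltaPow p q y := by
  rw [← ZMod.natCast_zmod_val x, ← ZMod.natCast_zmod_val y, ← Nat.cast_add, deltaPow_natCast,
    deltaPow_natCast, deltaPow_natCast, pow_add]

lemma deltaPow_pow (x : ZMod p) (n : ℕ) : deltaPow p q x ^ n = deltaPow p q (n * x) := by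
  rw [← ZMod.natCast_zmod_val x, ← Nat.cast_mul, deltaPow_natCast, deltaPow_natCast, ← pow_mul,
    mul_comm]

lemma etaP_pow_mul_deltaPow (hq : q ^ p = 1) (n : ℕ) (x : ZMod p) :
    etaP p q ^ n * deltaPow p q x = qPow p q (2 * n * x) • (deltaPow p q x * etaP p q ^ n) := by
  rw [deltaPow, pow_mul_pow_of_qcomm (etaP_mul_delta p q), ← pow_mul, ← qPow_natCast hq]
  congr 2
  push_cast
  rw [ZMod.natCast_zmod_val]
  ring

lemma etaM_pow_mul_deltaPow (hq : q ^ p = 1) (n : ℕ) (x : ZMod p) :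
    etaM p q ^ n * deltaPow p q x = qPow p q (2 * n * x) • (deltaPow p q x * etaM p q ^ n) := by
  rw [deltaPow, pow_mul_pow_of_qcomm (etaM_mul_delta p q), ← pow_mul, ← qPow_natCast hq]
  congr 2
  push_cast
  rw [ZMod.natCast_zmod_val]
  ring

lemma deltaPow_mul_etaP_pow (hq : q ^ p = 1) (n : ℕ) (x : ZMod p) :
    deltaPow p q x * etaP p q ^ n = qPow p q (-(2 * n * x)) • (etaP p q ^ n * deltaPow p q x) := by
  rw [etaP_pow_mul_deltaPow hq, smul_smul, ← qPow_add hq, neg_add_cancel, qPow_zero, one_smul]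

lemma deltaPow_mul_etaM_pow (hq : q ^ p = 1) (n : ℕ) (x : ZMod p) :
    deltaPow p q x * etaM p q ^ n = qPow p q (-(2 * n * x)) • (etaM p q ^ n * deltaPow p q x) := by
  rw [etaM_pow_mul_deltaPow hq, smul_smul, ← qPow_add hq, neg_add_cancel, qPow_zero, one_smul]

lemma sum_zmod_val {M : Type*} [AddCommMonoid M] (f : ℕ → M) :
    ∑ k : ZMod p, f k.val = ∑ n ∈ Finset.range p, f n := by
  cases p with
  | zero => exact absurd rfl (NeZero.ne 0)
  | succ n => exact Fin.sum_univ_eq_sum_range f (n + 1)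

lemma sum_qPow_mul (hq : IsPrimitiveRoot q p) (x : ZMod p) :
    ∑ k : ZMod p, qPow p q (k * x) = if x = 0 then (p : ℂ) else 0 := by
  have h1 := sum_inv_pow_mul_val hq (-x)
  simp only [neg_eq_zero] at h1
  rw [← h1, ← sum_zmod_val]
  refine Finset.sum_congr rfl fun k _ => ?_
  rw [inv_pow, pow_val_mul_val hq.pow_eq_one, ← qPow_neg hq.pow_eq_one]
  congr 1; ring

/-- Fourier inversion on `ℤ/p`. -/
lemma sum_qPow_smul_spectral {T : Type*} [Ring T] [Algebra ℂ T] (hq : IsPrimitiveRoot q p)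
    (D : T) (j : ZMod p) :
    ∑ k : ZMod p, qPow p q (k * j) •
      ((1 / (p : ℂ)) • ∑ n ∈ Finset.range p, (q⁻¹ ^ (n * k.val)) • D ^ n) = D ^ j.val := by
  have hp0 : (p : ℂ) ≠ 0 := by exact_mod_cast NeZero.ne p
  have h1 : ∀ k : ZMod p, qPow p q (k * j) •
      ((1 / (p : ℂ)) • ∑ n ∈ Finset.range p, (q⁻¹ ^ (n * k.val)) • D ^ n) =
      ∑ n : ZMod p, ((1 / (p : ℂ)) * qPow p q (k * (j - n))) • D ^ n.val := by
    intro k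
    rw [← sum_zmod_val, smul_smul, Finset.smul_sum]
    refine Finset.sum_congr rfl fun n _ => ?_
    rw [smul_smul, inv_pow, pow_val_mul_val hq.pow_eq_one, ← qPow_neg hq.pow_eq_one,
      mul_comm (qPow _ _ _), mul_assoc, ← qPow_add hq.pow_eq_one]
    congr 3; ring
  simp only [h1]
  rw [Finset.sum_comm, Finset.sum_eq_single j]
  · rw [← Finset.sum_smul, ← Finset.mul_sum, sum_qPow_mul hq, if_pos (sub_self j),
      one_div, inv_mul_cancel₀ hp0, one_smul]
  · intro n _ hn
    rw [← Finset.sum_smul, ← Finset.mul_sum, sum_qPow_mul hq,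
      if_neg (sub_ne_zero.2 (Ne.symm hn)), mul_zero, zero_smul]
  · simp

lemma sum_qPow_smul_zeta (hq : IsPrimitiveRoot q p) (j : ZMod p) :
    ∑ k : ZMod p, qPow p q (k * j) • zeta p q k = deltaPow p q j :=
  sum_qPow_smul_spectral hq _ j

lemma sum_qPow_smul_coprodZeta (hq : IsPrimitiveRoot q p) (j : ZMod p) :
    ∑ k : ZMod p, qPow p q (k * j) • coprodZeta p q k =
      deltaPow p q j ⊗ₜ[ℂ] deltaPow p q j := by
  have := sum_qPow_smul_spectral hq (gen p q Gen.delta ⊗ₜ[ℂ] gen p q Gen.delta) j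
  simp only [Algebra.TensorProduct.tmul_pow] at this
  exact this

end Relations

/-! ### Relations for the coproducts of the generators -/

section Coprod

variable {p : ℕ} [NeZero p] {q : ℂ}

variable (p q) in
/-- `δ e^{-λ/p} ⊗ η₊`. -/
def coprodTailP (lam : ℝ) : QAlg p q ⊗[ℂ] QAlg p q :=
  Complex.exp (-lam / p) • (deltaPow p q 1 ⊗ₜ[ℂ] etaP p q)

variable (p q) in
/-- `δ⁻¹ e^{λ/p} ⊗ η₋`. -/
def coprodTailM (lam : ℝ) : QAlg p q ⊗[ℂ] QAlg p q :=
  Complex.exp (lam / p) • (deltaPow p q (-1) ⊗ₜ[ℂ] etaM p q)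

lemma coprodTailP_pow (lam : ℝ) (n : ℕ) : coprodTailP p q lam ^ n =
    Complex.exp (-lam * n / p) • (deltaPow p q n ⊗ₜ[ℂ] (etaP p q ^ n)) := by
  rw [coprodTailP, smul_pow, ← Complex.exp_nat_mul, Algebra.TensorProduct.tmul_pow, deltaPow_pow,
    mul_one]
  congr 2; ring

lemma coprodTailM_pow (lam : ℝ) (n : ℕ) : coprodTailM p q lam ^ n =
    Complex.exp (lam * n / p) • (deltaPow p q (-n) ⊗ₜ[ℂ] (etaM p q ^ n)) := by
  rw [coprodTailM, smul_pow, ← Complex.exp_nat_mul, Algebra.TensorProduct.tmul_pow, deltaPow_pow,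
    mul_neg_one]
  congr 2; ring

lemma coprodTailP_pow_self (lam : ℝ) : coprodTailP p q lam ^ p = 0 := by
  rw [coprodTailP_pow, etaP_pow_self, TensorProduct.tmul_zero, smul_zero]

lemma coprodTailM_pow_self (lam : ℝ) : coprodTailM p q lam ^ p = 0 := by
  rw [coprodTailM_pow, etaM_pow_self, TensorProduct.tmul_zero, smul_zero]

lemma etaP_tmul_one_pow_self : (etaP p q ⊗ₜ[ℂ] (1 : QAlg p q)) ^ p = 0 := by
  rw [Algebra.TensorProduct.tmul_pow, etaP_pow_self, TensorProduct.zero_tmul]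

lemma etaM_tmul_one_pow_self : (etaM p q ⊗ₜ[ℂ] (1 : QAlg p q)) ^ p = 0 := by
  rw [Algebra.TensorProduct.tmul_pow, etaM_pow_self, TensorProduct.zero_tmul]

lemma qPow_two (hq : q ^ p = 1) : qPow p q 2 = q ^ 2 := by
  exact_mod_cast qPow_natCast hq 2

lemma etaP_mul_deltaPow (hq : q ^ p = 1) (x : ZMod p) :
    etaP p q * deltaPow p q x = qPow p q (2 * x) • (deltaPow p q x * etaP p q) := by
  have := etaP_pow_mul_deltaPow hq 1 x
  simpa using this

lemma etaM_mul_deltaPow (hq : q ^ p = 1) (x : ZMod p) :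
    etaM p q * deltaPow p q x = qPow p q (2 * x) • (deltaPow p q x * etaM p q) := by
  have := etaM_pow_mul_deltaPow hq 1 x
  simpa using this

lemma deltaPow_mul_etaP (hq : q ^ p = 1) (x : ZMod p) :
    deltaPow p q x * etaP p q = qPow p q (-(2 * x)) • (etaP p q * deltaPow p q x) := by
  have := deltaPow_mul_etaP_pow hq 1 x
  simpa using this

lemma deltaPow_mul_etaM (hq : q ^ p = 1) (x : ZMod p) :
    deltaPow p q x * etaM p q = qPow p q (-(2 * x)) • (etaM p q * deltaPow p q x) := by
  have := deltaPow_mul_etaM_pow hq 1 x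
  simpa using this

lemma deltaPow_mul_comm (x y : ZMod p) :
    deltaPow p q x * deltaPow p q y = deltaPow p q y * deltaPow p q x := by
  rw [← deltaPow_add, ← deltaPow_add, add_comm]

lemma head_mul_tailP (hq : q ^ p = 1) (lam : ℝ) :
    (etaP p q ⊗ₜ[ℂ] (1 : QAlg p q)) * coprodTailP p q lam =
      q ^ 2 • (coprodTailP p q lam * (etaP p q ⊗ₜ[ℂ] 1)) := by
  rw [coprodTailP, mul_smul_comm, smul_mul_assoc, Algebra.TensorProduct.tmul_mul_tmul,
    Algebra.TensorProduct.tmul_mul_tmul, etaP_mul_deltaPow hq, one_mul, mul_one, mul_one,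
    qPow_two hq, ← TensorProduct.smul_tmul', smul_comm]

lemma head_mul_tailM (hq : q ^ p = 1) (lam : ℝ) :
    (etaM p q ⊗ₜ[ℂ] (1 : QAlg p q)) * coprodTailM p q lam =
      q⁻¹ ^ 2 • (coprodTailM p q lam * (etaM p q ⊗ₜ[ℂ] 1)) := by
  rw [coprodTailM, mul_smul_comm, smul_mul_assoc, Algebra.TensorProduct.tmul_mul_tmul,
    Algebra.TensorProduct.tmul_mul_tmul, etaM_mul_deltaPow hq, one_mul, mul_one, mul_neg_one,
    qPow_neg hq, qPow_two hq, ← TensorProduct.smul_tmul', smul_comm, inv_pow]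

/-- Both summands of $\Delta(\eta_-)$ move past $A$ and past $B$ with the same factor $q^2$. On
terms of degree $p$ the total factor is $q^{2p}=1$. -/
lemma commute_coprodEtaM (hq : q ^ p = 1) (lam : ℝ) :
    Commute (etaM p q ⊗ₜ[ℂ] (1 : QAlg p q) + coprodTailM p q lam)
      (qExpDeg q (etaP p q ⊗ₜ[ℂ] (1 : QAlg p q)) (coprodTailP p q lam) p) := by
  have h0 : ∀ x : ℕ × ℕ, x.1 + x.2 = p → (q ^ 2) ^ x.1 * (q ^ 2) ^ x.2 = 1 := by
    intro x hx
    rw [← pow_add, hx, ← pow_mul, mul_comm, pow_mul, hq, one_pow]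
  refine Commute.add_left ?_ ?_
  · refine commute_qExpDeg h0 ?_ ?_
    · rw [Algebra.TensorProduct.tmul_mul_tmul, Algebra.TensorProduct.tmul_mul_tmul,
        etaM_mul_etaP, ← TensorProduct.smul_tmul']
    · rw [coprodTailP, mul_smul_comm, smul_mul_assoc, Algebra.TensorProduct.tmul_mul_tmul,
        Algebra.TensorProduct.tmul_mul_tmul, etaM_mul_deltaPow hq, mul_one, qPow_two hq, one_mul,
        mul_one, ← TensorProduct.smul_tmul', smul_comm]
  · refine commute_qExpDeg h0 ?_ ?_
    · rw [coprodTailM, mul_smul_comm, smul_mul_assoc, Algebra.TensorProduct.tmul_mul_tmul,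
        Algebra.TensorProduct.tmul_mul_tmul, deltaPow_mul_etaP hq, mul_neg_one, neg_neg,
        qPow_two hq, mul_one, one_mul, ← TensorProduct.smul_tmul', smul_comm]
    · rw [coprodTailM, coprodTailP, smul_mul_smul_comm, smul_mul_smul_comm,
        Algebra.TensorProduct.tmul_mul_tmul, Algebra.TensorProduct.tmul_mul_tmul,
        deltaPow_mul_comm, etaM_mul_etaP, TensorProduct.tmul_smul, smul_comm, mul_comm (Complex.exp _)]

lemma inv_sq_pow_eq_one (hq : q ^ p = 1) (x : ℕ × ℕ) (hx : x.1 + x.2 = p) :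
    (q⁻¹ ^ 2) ^ x.1 * (q⁻¹ ^ 2) ^ x.2 = 1 := by
  rw [← pow_add, hx, ← pow_mul, mul_comm, pow_mul, inv_pow, hq, inv_one, one_pow]

/-- Here the factor is $q^{-2}$ for each variable, again trivial in degree $p$. This and its
companion allow $\Delta(\delta^j)$ to pass the nilpotent parts of $\Delta(z_\pm)$. -/
lemma commute_delta_qExpDegP (hq : q ^ p = 1) (lam : ℝ) :
    Commute (deltaPow p q 1 ⊗ₜ[ℂ] deltaPow p q 1)
      (qExpDeg q (etaP p q ⊗ₜ[ℂ] (1 : QAlg p q)) (coprodTailP p q lam) p) := by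
  refine commute_qExpDeg (inv_sq_pow_eq_one hq) ?_ ?_
  · rw [Algebra.TensorProduct.tmul_mul_tmul, Algebra.TensorProduct.tmul_mul_tmul,
      deltaPow_mul_etaP hq, mul_one, qPow_neg hq, qPow_two hq, ← TensorProduct.smul_tmul', one_mul,
      mul_one, inv_pow]
  · rw [coprodTailP, mul_smul_comm, smul_mul_assoc, Algebra.TensorProduct.tmul_mul_tmul,
      Algebra.TensorProduct.tmul_mul_tmul, deltaPow_mul_etaP hq, mul_one, qPow_neg hq, qPow_two hq,
      TensorProduct.tmul_smul, smul_comm, inv_pow]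

lemma commute_delta_qExpDegM (hq : q ^ p = 1) (lam : ℝ) :
    Commute (deltaPow p q 1 ⊗ₜ[ℂ] deltaPow p q 1)
      (qExpDeg q⁻¹ (etaM p q ⊗ₜ[ℂ] (1 : QAlg p q)) (coprodTailM p q lam) p) := by
  refine commute_qExpDeg (inv_sq_pow_eq_one hq) ?_ ?_
  · rw [Algebra.TensorProduct.tmul_mul_tmul, Algebra.TensorProduct.tmul_mul_tmul,
      deltaPow_mul_etaM hq, mul_one, qPow_neg hq, qPow_two hq, ← TensorProduct.smul_tmul', one_mul,
      mul_one, inv_pow]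
  · rw [coprodTailM, mul_smul_comm, smul_mul_assoc, Algebra.TensorProduct.tmul_mul_tmul,
      Algebra.TensorProduct.tmul_mul_tmul, deltaPow_mul_etaM hq, mul_one, qPow_neg hq, qPow_two hq,
      TensorProduct.tmul_smul, smul_comm, inv_pow, deltaPow_mul_comm]

lemma nilP_eq (hq : q ^ p = 1) (lam : ℝ) : nilP p q lam = ((-1 : ℂ) ^ ((p + 1) / 2)) •
    qExpDeg q (etaP p q ⊗ₜ[ℂ] (1 : QAlg p q)) (coprodTailP p q lam) p := by
  rw [nilP, qExpDeg_self_eq (Nat.pos_of_ne_zero (NeZero.ne p)) hq]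
  congr 1
  refine Finset.sum_congr rfl fun n _ => ?_
  rw [coprodTailP_pow, mul_smul_comm, smul_smul, Algebra.TensorProduct.tmul_pow,
    Algebra.TensorProduct.tmul_mul_tmul, one_pow, one_mul]

lemma nilM_eq (hq : q ^ p = 1) (lam : ℝ) : nilM p q lam = ((-1 : ℂ) ^ ((p + 1) / 2)) •
    qExpDeg q⁻¹ (etaM p q ⊗ₜ[ℂ] (1 : QAlg p q)) (coprodTailM p q lam) p := by
  rw [nilM, qExpDeg_self_eq (Nat.pos_of_ne_zero (NeZero.ne p)) (by rw [inv_pow, hq, inv_one])]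
  congr 1
  refine Finset.sum_congr rfl fun n _ => ?_
  rw [coprodTailM_pow, mul_smul_comm, smul_smul, Algebra.TensorProduct.tmul_pow,
    Algebra.TensorProduct.tmul_mul_tmul, one_pow, one_mul, qFact_inv, qFact_inv]

end Coprod

end

section

/-! ### Derivatives of `Q_r` with respect to `z_±` -/

lemma hasDerivAt_integral_mul_cexp {Φ ψ : ℝ → ℂ} (hΦ : Continuous Φ) (hs : HasCompactSupport Φ)
    (hψ : Continuous ψ) (w₀ : ℝ) :
    HasDerivAt (fun w : ℝ => ∫ x, Φ x * Complex.exp (ψ x * w))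
      (∫ x, Φ x * ψ x * Complex.exp (ψ x * w₀)) w₀ := by
  refine (hasDerivAt_integral_of_dominated_loc_of_deriv_le (μ := volume)
    (F := fun (w : ℝ) x => Φ x * Complex.exp (ψ x * w))
    (F' := fun (w : ℝ) x => Φ x * ψ x * Complex.exp (ψ x * w))
    (bound := fun x => ‖Φ x * ψ x‖ * Real.exp (‖ψ x‖ * (|w₀| + 1)))
    (Metric.ball_mem_nhds w₀ one_pos) ?_ ?_ ?_ ?_ ?_ ?_).2
  · exact Eventually.of_forall fun w => (by fun_prop : Continuous fun x =>
      Φ x * Complex.exp (ψ x * w)).aestronglyMeasurable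
  · exact (by fun_prop : Continuous fun x => Φ x * Complex.exp (ψ x * w₀))
      |>.integrable_of_hasCompactSupport hs.mul_right
  · exact (by fun_prop : Continuous fun x =>
      Φ x * ψ x * Complex.exp (ψ x * w₀)).aestronglyMeasurable
  · refine Eventually.of_forall fun x w hw => ?_
    rw [norm_mul]
    refine mul_le_mul_of_nonneg_left ?_ (norm_nonneg _)
    refine (Complex.norm_exp_le_exp_norm _).trans (Real.exp_le_exp.2 ?_)
    rw [norm_mul, Complex.norm_real, Real.norm_eq_abs]
    gcongr
    rw [Metric.mem_ball, Real.dist_eq] at hw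
    have := abs_sub_abs_le_abs_sub w w₀
    linarith
  · refine (by fun_prop : Continuous fun x => ‖Φ x * ψ x‖ * Real.exp (‖ψ x‖ * (|w₀| + 1)))
      |>.integrable_of_hasCompactSupport ?_
    exact (HasCompactSupport.mul_right hs).norm.mul_right
  · refine Eventually.of_forall fun x w _ => ?_
    have := (((hasDerivAt_id (w : ℂ)).const_mul (ψ x)).cexp.const_mul (Φ x)).comp_ofReal
    convert! this using 1
    simp only [id, mul_one]
    ring

lemma iteratedDeriv_integral_mul_cexp {Φ ψ : ℝ → ℂ} (hΦ : Continuous Φ)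
    (hs : HasCompactSupport Φ) (hψ : Continuous ψ) (n : ℕ) :
    iteratedDeriv n (fun w : ℝ => ∫ x, Φ x * Complex.exp (ψ x * w)) =
      fun w : ℝ => ∫ x, Φ x * ψ x ^ n * Complex.exp (ψ x * w) := by
  induction n with
  | zero => simp
  | succ n ih =>
    rw [iteratedDeriv_succ, ih]
    ext w
    rw [(hasDerivAt_integral_mul_cexp (Φ := fun x => Φ x * ψ x ^ n) (hΦ.mul (hψ.pow n))
      hs.mul_right hψ w).deriv]
    congr 1 with x
    ring

/-- The basic integrals in terms of which the coefficients of `Q_r` are expressed. -/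
def QrInt (p : ℕ) (r : ℝ) (f : ℝ → ℂ) (ν : ℂ) (g : Pt) (s : ℤ) : ℂ :=
  ∫ x, phase r g x * Complex.exp (s / p * x) * f (x - g.2.2) * Complex.exp (ν * x)

/-- The part of `QrCoeff` that does not depend on `k` and `j`. -/
def etaCoeff (p : ℕ) (q h : ℂ) (r : ℝ) (n m : ℕ) : ℂ :=
  (Complex.I * realRoot p r) ^ (n + m) * h ^ ((m : ℤ) - n) * q ^ (n * m) *
    ((qFact q n)⁻¹ * (qFact q m)⁻¹)

section

variable {p : ℕ} [NeZero p] {q h : ℂ}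

lemma QrCoeff_eq (hh : h ^ 2 = q) (hh0 : h ≠ 0) (r : ℝ) (b : Idx p) (j : ZMod p) :
    QrCoeff p q h r b j = etaCoeff p q h r b.1 b.2.1 *
      qPow p q ((b.2.2 - ((b.1 : ℕ) : ZMod p) - ((b.2.1 : ℕ) : ZMod p)) * j) := by
  rw [QrCoeff, etaCoeff, div_eq_mul_inv, mul_inv, mul_inv, ← zpow_neg]
  have : h ^ (-((((b.1 : ℕ) : ℤ)) - ((b.2.1 : ℕ) : ℤ) - 2 * (((b.1 : ℕ) : ℤ) * ((b.2.1 : ℕ) : ℤ)))) =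
      h ^ (((b.2.1 : ℕ) : ℤ) - (b.1 : ℕ)) * q ^ ((b.1 : ℕ) * (b.2.1 : ℕ)) := by
    rw [← hh, ← pow_mul, ← zpow_natCast, ← zpow_add₀ hh0]
    congr 1
    push_cast
    ring
  rw [this]
  ring

lemma fourier_Tr_eq (r : ℝ) (f : Vec p) (ν : ℂ) (g : Pt) (b : Idx p) (l : ZMod p) :
    fourier (Tr p q h r f g b l) ν =
      QrCoeff p q h r b (l - ((b.1 : ℕ) : ZMod p) + ((b.2.1 : ℕ) : ZMod p)) *
        QrInt p r (f (l - ((b.1 : ℕ) : ZMod p) + ((b.2.1 : ℕ) : ZMod p))) ν g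
          (((b.1 : ℕ) : ℤ) - (b.2.1 : ℕ)) := by
  rw [fourier, QrInt, ← integral_const_mul]
  congr 1 with x
  rw [Tr]
  push_cast
  ring

/-- Each derivative in $z_\pm$ brings down $ire^{\pm x}$, and $e^{\pm x}=e^{\pm px/p}$ shifts the
index by $\pm p$: the family `QrInt` is closed under these derivatives up to scalars. -/
lemma partialDeriv_QrInt (hp0 : (p : ℂ) ≠ 0) (r : ℝ) {f : ℝ → ℂ} (hf : IsTest f) (ν : ℂ)
    (s : ℤ) (c : ℂ) (a b : ℕ) (g : Pt) :
    partialDeriv a b (fun g => c * QrInt p r f ν g s) g =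
      c * ((Complex.I * r) ^ (a + b) * QrInt p r f ν g (s + p * a - p * b)) := by
  set Φ : ℝ → ℂ := fun x => c * (Complex.exp (s / p * x) * f (x - g.2.2) * Complex.exp (ν * x))
    with hΦ
  have hfs := hf.comp_sub g.2.2
  have hΦc : Continuous Φ := by
    have := hfs.continuous
    exact continuous_const.mul (((contDiff_cexp_mul _).continuous.mul this).mul
      (contDiff_cexp_mul _).continuous)
  have hΦs : HasCompactSupport Φ := by
    have := hfs.supp
    exact ((this.mul_left).mul_right).mul_left
  have h1 : ∀ u w : ℝ, c * QrInt p r f ν (u, w, g.2.2) s = ∫ x,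
      (Φ x * Complex.exp (Complex.I * r * Real.exp x * u)) *
        Complex.exp ((Complex.I * r * Real.exp (-x)) * w) := by
    intro u w
    rw [QrInt, ← integral_const_mul]
    congr 1 with x
    simp only [hΦ, phase]
    rw [mul_add, Complex.exp_add, mul_assoc _ (Real.exp x : ℂ), mul_assoc _ (Real.exp (-x) : ℂ)]
    ring
  have h2 : ∀ u : ℝ, iteratedDeriv b (fun w => c * QrInt p r f ν (u, w, g.2.2) s) g.2.1 = ∫ x,
      (Φ x * (Complex.I * r * Real.exp (-x)) ^ b *
        Complex.exp ((Complex.I * r * Real.exp (-x)) * g.2.1)) *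
        Complex.exp ((Complex.I * r * Real.exp x) * u) := by
    intro u
    simp only [h1]
    rw [iteratedDeriv_integral_mul_cexp
      (Φ := fun x => Φ x * Complex.exp (Complex.I * r * Real.exp x * u))
      (ψ := fun x => Complex.I * r * Real.exp (-x)) (by fun_prop) hΦs.mul_right (by fun_prop)]
    beta_reduce
    congr 1 with x
    ring
  rw [partialDeriv]
  simp only [h2]
  rw [iteratedDeriv_integral_mul_cexp (Φ := fun x => Φ x * (Complex.I * r * Real.exp (-x)) ^ b *
        Complex.exp ((Complex.I * r * Real.exp (-x)) * g.2.1))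
      (ψ := fun x => Complex.I * r * Real.exp x) (by fun_prop)
      (HasCompactSupport.mul_right hΦs.mul_right) (by fun_prop), QrInt,
    ← integral_const_mul, ← integral_const_mul]
  beta_reduce
  congr 1 with x
  have e1 : Complex.exp (((s + p * a - p * b : ℤ) : ℂ) / p * x) =
      Complex.exp (s / p * x) * Complex.exp x ^ a * Complex.exp (-x) ^ b := by
    rw [← Complex.exp_nat_mul, ← Complex.exp_nat_mul, ← Complex.exp_add, ← Complex.exp_add]
    congr 1
    push_cast
    field_simp
    ring
  simp only [hΦ, phase]
  rw [e1, mul_add (Complex.I * (r : ℂ)), Complex.exp_add, ← mul_assoc _ (Real.exp x : ℂ),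
    ← mul_assoc _ (Real.exp (-x) : ℂ)]
  push_cast
  rw [mul_pow _ (Complex.exp x), mul_pow _ (Complex.exp (-x)), pow_add]
  ring

/-- Translation by $\lambda$ multiplies $e^{\pm x}$ by $e^{\mp\lambda}$, which is exactly the twist
in the group law `ptMul`. -/
lemma phase_mul_phase (r : ℝ) (g g' : Pt) (x : ℝ) :
    phase r g x * phase r g' (x - g.2.2) = phase r (ptMul g g') x := by
  simp only [phase, ptMul]
  rw [← Complex.exp_add]
  congr 1
  push_cast
  rw [neg_sub, show (x : ℂ) - g.2.2 = x + -g.2.2 by ring,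
    show (g.2.2 : ℂ) - x = -x + g.2.2 by ring, Complex.exp_add, Complex.exp_add]
  ring

/-- The exponential of the inner operator is evaluated at $x-\lambda$, which leaves the factor
$e^{-\lambda(n'-m')/p}$ found in $\Delta(\eta_\pm)$. -/
lemma fourier_Tr_Tr (hp0 : (p : ℂ) ≠ 0) (r : ℝ) (f : Vec p) (ν : ℂ) (g g' : Pt) (b b' : Idx p)
    (l : ZMod p) :
    fourier (Tr p q h r (Tr p q h r f g' b') g b l) ν =
      QrCoeff p q h r b (l - ((b.1 : ℕ) : ZMod p) + ((b.2.1 : ℕ) : ZMod p)) *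
      QrCoeff p q h r b' (l - ((b.1 : ℕ) : ZMod p) + ((b.2.1 : ℕ) : ZMod p) -
        ((b'.1 : ℕ) : ZMod p) + ((b'.2.1 : ℕ) : ZMod p)) *
      (Complex.exp (-g.2.2 * (b'.1 : ℕ) / p) * Complex.exp (g.2.2 * (b'.2.1 : ℕ) / p)) *
        QrInt p r (f (l - ((b.1 : ℕ) : ZMod p) + ((b.2.1 : ℕ) : ZMod p) -
        ((b'.1 : ℕ) : ZMod p) + ((b'.2.1 : ℕ) : ZMod p))) ν (ptMul g g')
          ((((b.1 : ℕ) + (b'.1 : ℕ) : ℕ) : ℤ) - ((b.2.1 : ℕ) + (b'.2.1 : ℕ) : ℕ)) := by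
  rw [fourier, QrInt, ← integral_const_mul]
  congr 1 with x
  rw [Tr, Tr, ← phase_mul_phase]
  have e1 : x - (ptMul g g').2.2 = x - g.2.2 - g'.2.2 := by simp only [ptMul]; ring
  have e2 : Complex.exp (((((b.1 : ℕ) + (b'.1 : ℕ) : ℕ) : ℤ) - ((b.2.1 : ℕ) + (b'.2.1 : ℕ) : ℕ) : ℤ)
      / p * x) * (Complex.exp (-g.2.2 * (b'.1 : ℕ) / p) * Complex.exp (g.2.2 * (b'.2.1 : ℕ) / p)) =
      Complex.exp ((((b.1 : ℕ) : ℂ) - (b.2.1 : ℕ)) / p * x) *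
      Complex.exp ((((b'.1 : ℕ) : ℂ) - (b'.2.1 : ℕ)) / p * (x - g.2.2 : ℝ)) := by
    rw [← Complex.exp_add, ← Complex.exp_add, ← Complex.exp_add]
    congr 1
    push_cast
    field_simp
    ring
  rw [e1]
  linear_combination (-(QrCoeff p q h r b (l - ((b.1 : ℕ) : ZMod p) + ((b.2.1 : ℕ) : ZMod p)) *
      QrCoeff p q h r b' (l - ((b.1 : ℕ) : ZMod p) + ((b.2.1 : ℕ) : ZMod p) -
        ((b'.1 : ℕ) : ZMod p) + ((b'.2.1 : ℕ) : ZMod p)) * phase r g x * phase r g' (x - g.2.2) *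
        f (l - ((b.1 : ℕ) : ZMod p) + ((b.2.1 : ℕ) : ZMod p) -
        ((b'.1 : ℕ) : ZMod p) + ((b'.2.1 : ℕ) : ZMod p)) (x - g.2.2 - g'.2.2) *
        Complex.exp (ν * x))) * e2

end

end

section

/-! ### The coproduct of the coefficients -/

/-- Collapses a Taylor sum of length $p$ when the nilpotent part squares to zero. For $p=1$ the
index $1$ is outside the range, hence the separate hypothesis. -/
lemma sum_range_eq_add {M : Type*} [AddCommMonoid M] {p : ℕ} (hp : p ≠ 0) (G : ℕ → M)
    (h2 : ∀ a, 2 ≤ a → G a = 0) (h1 : p = 1 → G 1 = 0) :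
    ∑ a ∈ Finset.range p, G a = G 0 + G 1 := by
  rcases Nat.lt_or_ge p 2 with h | h
  · obtain rfl : p = 1 := by omega
    simp [h1 rfl]
  · refine (Finset.sum_subset (Finset.range_mono h) fun a _ ha => h2 a ?_).symm.trans ?_
    · simpa [Nat.succ_le_iff] using ha
    · simp [Finset.sum_range_succ]

section

variable {p : ℕ} [NeZero p] {q h : ℂ}

variable (p q) in
/-- The nilpotent part of `Δ(z₊)`, up to sign. -/
def nilDegP (lam : ℝ) : QAlg p q ⊗[ℂ] QAlg p q :=
  qExpDeg q (etaP p q ⊗ₜ[ℂ] (1 : QAlg p q)) (coprodTailP p q lam) p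

variable (p q) in
/-- The nilpotent part of `Δ(z₋)`, up to sign. -/
def nilDegM (lam : ℝ) : QAlg p q ⊗[ℂ] QAlg p q :=
  qExpDeg q⁻¹ (etaM p q ⊗ₜ[ℂ] (1 : QAlg p q)) (coprodTailM p q lam) p

lemma nilDegP_mul_self (hq : q ^ p = 1) (lam : ℝ) : nilDegP p q lam * nilDegP p q lam = 0 := by
  have hq0 : q ≠ 0 := by rintro rfl; simp [NeZero.ne p] at hq
  exact qExpDeg_mul_self hq0 (head_mul_tailP hq lam) etaP_tmul_one_pow_self
    (coprodTailP_pow_self lam)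

lemma nilDegM_mul_self (hq : q ^ p = 1) (lam : ℝ) : nilDegM p q lam * nilDegM p q lam = 0 := by
  have hq0 : q ≠ 0 := by rintro rfl; simp [NeZero.ne p] at hq
  exact qExpDeg_mul_self (inv_ne_zero hq0) (head_mul_tailM hq lam) etaM_tmul_one_pow_self
    (coprodTailM_pow_self lam)

lemma nilP_pow (hq : q ^ p = 1) (lam : ℝ) (a : ℕ) :
    nilP p q lam ^ a = (((-1 : ℂ) ^ ((p + 1) / 2)) ^ a) • nilDegP p q lam ^ a := by
  rw [nilP_eq hq, smul_pow]; rfl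

lemma nilM_pow (hq : q ^ p = 1) (lam : ℝ) (a : ℕ) :
    nilM p q lam ^ a = (((-1 : ℂ) ^ ((p + 1) / 2)) ^ a) • nilDegM p q lam ^ a := by
  rw [nilM_eq hq, smul_pow]; rfl

/-- The scalar $y$ collects the factor $ir$ of a derivative and the sign of the nilpotent part. In
the mixed term the shifts $+p$ and $-p$ cancel. -/
lemma coprodFun_QrInt (hq : q ^ p = 1) (r : ℝ) {f : ℝ → ℂ} (hf : IsTest f) (ν : ℂ) (s : ℤ)
    (c y : ℂ) (hy : y = Complex.I * r * (-1) ^ ((p + 1) / 2)) (g g' : Pt) :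
    coprodFun p q (fun g => c * QrInt p r f ν g s) g g' =
      c • (QrInt p r f ν (ptMul g g') s • (1 : QAlg p q ⊗[ℂ] QAlg p q) +
        (y * QrInt p r f ν (ptMul g g') (s - p)) • nilDegM p q g.2.2 +
        nilDegP p q g.2.2 * ((y * QrInt p r f ν (ptMul g g') (s + p)) • 1 +
          (y * y * QrInt p r f ν (ptMul g g') s) • nilDegM p q g.2.2)) := by
  have hp0 : (p : ℂ) ≠ 0 := by exact_mod_cast NeZero.ne p
  have hpos := Nat.pos_of_ne_zero (NeZero.ne p)
  have hP2 : ∀ a, 2 ≤ a → nilDegP p q g.2.2 ^ a = 0 := fun a ha =>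
    pow_eq_zero_of_le ha (by rw [sq, nilDegP_mul_self hq])
  have hM2 : ∀ a, 2 ≤ a → nilDegM p q g.2.2 ^ a = 0 := fun a ha =>
    pow_eq_zero_of_le ha (by rw [sq, nilDegM_mul_self hq])
  have hP1 : p = 1 → nilDegP p q g.2.2 = 0 := by
    rintro rfl
    rw [nilDegP, qExpDeg_self_eq hpos hq]; simp
  have hM1 : p = 1 → nilDegM p q g.2.2 = 0 := by
    rintro rfl
    rw [nilDegM, qExpDeg_self_eq hpos (by rw [inv_pow, hq, inv_one])]; simp
  have h1 : ∀ a b : ℕ, (partialDeriv a b (fun g => c * QrInt p r f ν g s) (ptMul g g') /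
      ((a.factorial : ℂ) * (b.factorial : ℂ))) • (nilP p q g.2.2 ^ a * nilM p q g.2.2 ^ b) =
      (c * (y ^ (a + b) * QrInt p r f ν (ptMul g g') (s + p * a - p * b) /
        ((a.factorial : ℂ) * (b.factorial : ℂ)))) •
        (nilDegP p q g.2.2 ^ a * nilDegM p q g.2.2 ^ b) := by
    intro a b
    rw [partialDeriv_QrInt hp0 r hf, nilP_pow hq, nilM_pow hq, smul_mul_smul_comm, smul_smul]
    congr 1
    rw [hy, mul_pow _ ((-1 : ℂ) ^ ((p + 1) / 2)), pow_add ((-1 : ℂ) ^ ((p + 1) / 2))]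
    ring
  rw [coprodFun]
  simp only [h1]
  rw [sum_range_eq_add (NeZero.ne p), sum_range_eq_add (NeZero.ne p),
    sum_range_eq_add (NeZero.ne p)]
  · simp only [pow_zero, Nat.factorial_zero, Nat.factorial_one, Nat.cast_one, Nat.cast_zero, pow_one,
      mul_one, mul_zero, add_zero, sub_zero, zero_add, one_mul, div_one, add_sub_cancel_right]
    simp only [smul_add, mul_add, mul_smul_comm, smul_smul, mul_one]
    rw [show (y : ℂ) ^ (1 + 1) = y * y by ring]
  · intro b hb; rw [hM2 b hb, mul_zero, smul_zero]
  · intro h; rw [pow_one (nilDegM p q g.2.2), hM1 h, mul_zero, smul_zero]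
  · intro b hb; rw [hM2 b hb, mul_zero, smul_zero]
  · intro h; rw [pow_one (nilDegM p q g.2.2), hM1 h, mul_zero, smul_zero]
  · intro a ha
    refine Finset.sum_eq_zero fun b _ => ?_
    rw [hP2 a ha, zero_mul, smul_zero]
  · intro h
    refine Finset.sum_eq_zero fun b _ => ?_
    rw [hP1 h, pow_one, zero_mul, smul_zero]

lemma sum_Idx {M : Type*} [AddCommMonoid M] (G : ℕ → ℕ → ZMod p → M) :
    ∑ b : Idx p, G b.1 b.2.1 b.2.2 =
      ∑ n ∈ Finset.range p, ∑ m ∈ Finset.range p, ∑ k : ZMod p, G n m k := by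
  rw [Fintype.sum_prod_type]
  simp only [Fintype.sum_prod_type]
  rw [Fin.sum_univ_eq_sum_range (fun n => ∑ m : Fin p, ∑ k : ZMod p, G n m k)]
  refine Finset.sum_congr rfl fun n _ => ?_
  exact Fin.sum_univ_eq_sum_range (fun m => ∑ k : ZMod p, G n m k) p

/-- The weight of the terms of bidegree `(N, M)`. -/
def coprodWeight (p : ℕ) (q h : ℂ) (r : ℝ) (f : Vec p) (ν : ℂ) (g : Pt) (l : ZMod p) (N M : ℕ) :
    QAlg p q ⊗[ℂ] QAlg p q :=
  ((Complex.I * realRoot p r) ^ (N + M) * h ^ ((M : ℤ) - N) * q ^ (N * M) *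
    qPow p q (-(N + M) * (l - N + M)) * QrInt p r (f (l - N + M)) ν g ((N : ℤ) - M)) •
    (deltaPow p q (l - N + M) ⊗ₜ[ℂ] deltaPow p q (l - N + M))

lemma I_mul_neg_one_pow {p : ℕ} (hp : Odd p) :
    Complex.I * (-1) ^ ((p + 1) / 2) = -Complex.I ^ p := by
  obtain ⟨k, rfl⟩ := hp
  rw [show (2 * k + 1 + 1) / 2 = k + 1 by omega, pow_succ Complex.I, pow_mul, Complex.I_sq]
  ring

/-- The left sides are the factors gained by the coefficients when $M$, respectively $N$, is raised
by $p$; the right side is the Taylor factor $y$. They agree for both signs because $h^p=h^{-p}=-1$.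
-/
lemma root_pow_mul (hp : Odd p) (hhp : h ^ p = -1) (r : ℝ) :
    (Complex.I * realRoot p r) ^ p * h ^ (p : ℤ) = Complex.I * r * (-1) ^ ((p + 1) / 2) ∧
    (Complex.I * realRoot p r) ^ p * h ^ (-(p : ℤ)) = Complex.I * r * (-1) ^ ((p + 1) / 2) := by
  have h1 : (realRoot p r : ℂ) ^ p = r := by exact_mod_cast realRoot_pow hp r
  rw [zpow_neg, zpow_natCast, hhp, mul_pow, h1, mul_right_comm Complex.I, I_mul_neg_one_pow hp]
  norm_num

lemma commute_deltaPow {S : QAlg p q ⊗[ℂ] QAlg p q}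
    (hS : Commute (deltaPow p q 1 ⊗ₜ[ℂ] deltaPow p q 1) S) (x : ZMod p) :
    Commute (deltaPow p q x ⊗ₜ[ℂ] deltaPow p q x) S := by
  have : deltaPow p q x = deltaPow p q 1 ^ x.val := by
    rw [deltaPow_pow, mul_one, ZMod.natCast_zmod_val]
  rw [this, ← Algebra.TensorProduct.tmul_pow]
  exact hS.pow_left _

/-- The sum over $k$ turns $\Delta(\zeta(k,\delta))$ into $\delta^j\otimes\delta^j$. The four Taylor
terms are then the weights at $(N,M)$, $(N,M+p)$, $(N+p,M)$ and $(N+p,M+p)$, once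
$\delta^j\otimes\delta^j$ is moved to the right. -/
lemma coprod_fourier_Tr (hp : Odd p) (hq : IsPrimitiveRoot q p) (hh : h ^ 2 = q)
    (hhp : h ^ p = -1) (r : ℝ) {f : Vec p} (hf : ∀ j, IsTest (f j)) (g g' : Pt) (l : ZMod p)
    (ν : ℂ) :
    coprod p q (fun b g => fourier (Tr p q h r f g b l) ν) g g' =
    ∑ N ∈ Finset.range p, ∑ M ∈ Finset.range p, ((qFact q N)⁻¹ * (qFact q M)⁻¹) •
      (coprodEtaP p q g.2.2 ^ N * coprodEtaM p q g.2.2 ^ M *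
        (coprodWeight p q h r f ν (ptMul g g') l N M +
          nilDegM p q g.2.2 * coprodWeight p q h r f ν (ptMul g g') l N (M + p) +
        nilDegP p q g.2.2 * (coprodWeight p q h r f ν (ptMul g g') l (N + p) M +
          nilDegM p q g.2.2 * coprodWeight p q h r f ν (ptMul g g') l (N + p) (M + p)))) := by
  have hh0 : h ≠ 0 := by rintro rfl; simp [NeZero.ne p] at hhp
  set y : ℂ := Complex.I * r * (-1) ^ ((p + 1) / 2) with hy
  obtain ⟨hy1, hy2⟩ := root_pow_mul hp hhp r
  rw [← hy] at hy1 hy2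
  have h1 := fun b : Idx p => coprodFun_QrInt hq.pow_eq_one r
    (hf (l - ((b.1 : ℕ) : ZMod p) + ((b.2.1 : ℕ) : ZMod p))) ν (((b.1 : ℕ) : ℤ) - (b.2.1 : ℕ))
    (QrCoeff p q h r b (l - ((b.1 : ℕ) : ZMod p) + ((b.2.1 : ℕ) : ZMod p))) y hy g g'
  rw [coprod]
  simp only [fourier_Tr_eq, h1]
  simp only [QrCoeff_eq hh hh0]
  rw [sum_Idx (fun n m k => coprodEtaP p q g.2.2 ^ n * coprodEtaM p q g.2.2 ^ m *
    coprodZeta p q k * ((etaCoeff p q h r n m * qPow p q ((k - n - m) * (l - n + m))) •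
      (QrInt p r (f (l - n + m)) ν (ptMul g g') ((n : ℤ) - m) • (1 : QAlg p q ⊗[ℂ] QAlg p q) +
        (y * QrInt p r (f (l - n + m)) ν (ptMul g g') ((n : ℤ) - m - p)) • nilDegM p q g.2.2 +
        nilDegP p q g.2.2 * ((y * QrInt p r (f (l - n + m)) ν (ptMul g g') ((n : ℤ) - m + p)) • 1 +
          (y * y * QrInt p r (f (l - n + m)) ν (ptMul g g') ((n : ℤ) - m)) •
            nilDegM p q g.2.2))))]
  refine Finset.sum_congr rfl fun n _ => Finset.sum_congr rfl fun m _ => ?_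
  set J : ℤ → ℂ := QrInt p r (f (l - n + m)) ν (ptMul g g') with hJ
  set E := coprodEtaP p q g.2.2 ^ n * coprodEtaM p q g.2.2 ^ m
  set X := J ((n : ℤ) - m) • (1 : QAlg p q ⊗[ℂ] QAlg p q) +
        (y * J ((n : ℤ) - m - p)) • nilDegM p q g.2.2 +
        nilDegP p q g.2.2 * ((y * J ((n : ℤ) - m + p)) • 1 +
          (y * y * J ((n : ℤ) - m)) • nilDegM p q g.2.2) with hX
  set j : ZMod p := l - n + m with hj
  have h2 : ∀ k : ZMod p, E * coprodZeta p q k *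
      ((etaCoeff p q h r n m * qPow p q ((k - n - m) * j)) • X) =
      (etaCoeff p q h r n m * qPow p q (-(n + m) * j)) •
        (E * (qPow p q (k * j) • coprodZeta p q k) * X) := by
    intro k
    rw [mul_smul_comm, mul_smul_comm, smul_mul_assoc, smul_smul]
    congr 1
    rw [mul_assoc, ← qPow_add hq.pow_eq_one]
    congr 2; ring
  simp only [h2]
  rw [← Finset.smul_sum, ← Finset.sum_mul, ← Finset.mul_sum, sum_qPow_smul_coprodZeta hq]
  have hDP : Commute (deltaPow p q j ⊗ₜ[ℂ] deltaPow p q j) (nilDegP p q g.2.2) :=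
    commute_deltaPow (commute_delta_qExpDegP hq.pow_eq_one _) j
  have hDM : Commute (deltaPow p q j ⊗ₜ[ℂ] deltaPow p q j) (nilDegM p q g.2.2) :=
    commute_deltaPow (commute_delta_qExpDegM hq.pow_eq_one _) j
  set κ : ℂ := (Complex.I * realRoot p r) ^ (n + m) * h ^ ((m : ℤ) - n) * q ^ (n * m) *
    qPow p q (-(n + m) * j) with hκ
  have hqp : ∀ a b : ℕ, q ^ (a * p) = 1 ∧ q ^ (p * b) = 1 := fun a b =>
    ⟨by rw [mul_comm, pow_mul, hq.pow_eq_one, one_pow], by rw [pow_mul, hq.pow_eq_one, one_pow]⟩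
  have w00 : coprodWeight p q h r f ν (ptMul g g') l n m =
      (κ * J ((n : ℤ) - m)) • (deltaPow p q j ⊗ₜ[ℂ] deltaPow p q j) := rfl
  have w01 : coprodWeight p q h r f ν (ptMul g g') l n (m + p) =
      (κ * (y * J ((n : ℤ) - m - p))) • (deltaPow p q j ⊗ₜ[ℂ] deltaPow p q j) := by
    rw [coprodWeight]
    push_cast
    rw [CharP.cast_eq_zero (ZMod p) p, add_zero, ← hj, sub_add_eq_sub_sub]
    congr 1
    rw [← hy1, hκ, ← hJ, ← add_assoc, pow_add _ (n + m),
      show (m : ℤ) + p - n = (m - n) + p by ring, zpow_add₀ hh0, mul_add, pow_add q, (hqp n m).1]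
    ring
  have w10 : coprodWeight p q h r f ν (ptMul g g') l (n + p) m =
      (κ * (y * J ((n : ℤ) - m + p))) • (deltaPow p q j ⊗ₜ[ℂ] deltaPow p q j) := by
    rw [coprodWeight]
    push_cast
    rw [CharP.cast_eq_zero (ZMod p) p, add_zero, ← hj, show (n : ℤ) + p - m = n - m + p by ring]
    congr 1
    rw [← hy2, hκ, ← hJ, show n + p + m = n + m + p by ring, pow_add _ (n + m),
      show (m : ℤ) - (n + p) = (m - n) + -p by ring, zpow_add₀ hh0, add_mul, pow_add q, (hqp n m).2]
    ring
  have w11 : coprodWeight p q h r f ν (ptMul g g') l (n + p) (m + p) =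
      (κ * (y * y * J ((n : ℤ) - m))) • (deltaPow p q j ⊗ₜ[ℂ] deltaPow p q j) := by
    rw [coprodWeight]
    push_cast
    rw [CharP.cast_eq_zero (ZMod p) p, add_zero, add_zero, ← hj,
      show (n : ℤ) + p - (m + p) = n - m by ring]
    congr 1
    nth_rewrite 1 [← hy1]
    rw [← hy2, hκ, ← hJ, show n + p + (m + p) = n + m + p + p by ring, pow_add _ (n + m + p),
      pow_add _ (n + m),
      show (m : ℤ) + p - (n + p) = (m - n) + p + -p by ring, zpow_add₀ hh0, zpow_add₀ hh0,
      show (n + p) * (m + p) = n * m + n * p + p * (m + p) by ring, pow_add q, pow_add q,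
      (hqp n m).1, (hqp n (m + p)).2]
    ring
  rw [w00, w01, w10, w11, etaCoeff, hX]
  rw [show (Complex.I * realRoot p r) ^ (n + m) * h ^ ((m : ℤ) - n) * q ^ (n * m) *
      ((qFact q n)⁻¹ * (qFact q m)⁻¹) * qPow p q (-(n + m) * j) =
      ((qFact q n)⁻¹ * (qFact q m)⁻¹) * κ by rw [hκ]; ring, mul_smul]
  congr 1
  rw [mul_assoc E, ← mul_smul_comm]
  congr 1
  simp only [mul_add, mul_smul_comm, smul_add, smul_smul, mul_one]
  have hPM : (deltaPow p q j ⊗ₜ[ℂ] deltaPow p q j) * (nilDegP p q g.2.2 * nilDegM p q g.2.2) =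
      nilDegP p q g.2.2 * (nilDegM p q g.2.2 * (deltaPow p q j ⊗ₜ[ℂ] deltaPow p q j)) := by
    rw [← mul_assoc, hDP.eq, mul_assoc, hDM.eq]
  rw [hDM.eq, hDP.eq, hPM]

/-- The indices $k,k'$ enter only through characters, so summing over them gives powers of $\delta$.
Reordering then makes everything except the $q$-exponential coefficients depend on the total degrees
$n+n'$ and $m+m'$ alone. -/
lemma sum_Idx_Qr_Qr (hq : IsPrimitiveRoot q p) (hh : h ^ 2 = q)
    (hhp : h ^ p = -1) (r : ℝ) (f : Vec p) (g g' : Pt) (l : ZMod p)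
    (ν : ℂ) :
    ∑ b' : Idx p, ∑ b : Idx p, fourier (Tr p q h r (Tr p q h r f g' b') g b l) ν •
      (basisElt p q b ⊗ₜ[ℂ] basisElt p q b') =
    ∑ n ∈ Finset.range p, ∑ n' ∈ Finset.range p, ∑ m ∈ Finset.range p, ∑ m' ∈ Finset.range p,
      (q⁻¹ ^ (n * n') * ((qFact q n)⁻¹ * (qFact q n')⁻¹) *
        (q ^ (m * m') * ((qFact q m)⁻¹ * (qFact q m')⁻¹))) •
        ((etaP p q ⊗ₜ[ℂ] (1 : QAlg p q)) ^ n * coprodTailP p q g.2.2 ^ n' *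
        ((etaM p q ⊗ₜ[ℂ] (1 : QAlg p q)) ^ m * coprodTailM p q g.2.2 ^ m' *
          coprodWeight p q h r f ν (ptMul g g') l (n + n') (m + m'))) := by
  have hp0 : (p : ℂ) ≠ 0 := by exact_mod_cast NeZero.ne p
  have hh0 : h ≠ 0 := by rintro rfl; simp [NeZero.ne p] at hhp
  have hq1 := hq.pow_eq_one
  set H : ℕ → ℕ → ZMod p → ℕ → ℕ → ZMod p → QAlg p q ⊗[ℂ] QAlg p q := fun n m k n' m' k' =>
    (etaCoeff p q h r n m * qPow p q ((k - n - m) * (l - n + m)) *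
      (etaCoeff p q h r n' m' * qPow p q ((k' - n' - m') * (l - n + m - n' + m'))) *
      (Complex.exp (-g.2.2 * n' / p) * Complex.exp (g.2.2 * m' / p)) *
      QrInt p r (f (l - n + m - n' + m')) ν (ptMul g g') (((n + n' : ℕ) : ℤ) - (m + m' : ℕ))) •
      ((etaP p q ^ n * etaM p q ^ m * zeta p q k) ⊗ₜ[ℂ]
        (etaP p q ^ n' * etaM p q ^ m' * zeta p q k')) with hH
  have hterm : ∀ b b' : Idx p, fourier (Tr p q h r (Tr p q h r f g' b') g b l) ν •
      (basisElt p q b ⊗ₜ[ℂ] basisElt p q b') = H b.1 b.2.1 b.2.2 b'.1 b'.2.1 b'.2.2 := by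
    intro b b'
    rw [fourier_Tr_Tr hp0, QrCoeff_eq hh hh0, QrCoeff_eq hh hh0]
    rfl
  simp only [hterm]
  have hk : ∀ n m n' m' : ℕ, ∑ k' : ZMod p, ∑ k : ZMod p, H n m k n' m' k' =
      (q⁻¹ ^ (n * n') * ((qFact q n)⁻¹ * (qFact q n')⁻¹) *
        (q ^ (m * m') * ((qFact q m)⁻¹ * (qFact q m')⁻¹))) •
        ((etaP p q ⊗ₜ[ℂ] (1 : QAlg p q)) ^ n * coprodTailP p q g.2.2 ^ n' *
        ((etaM p q ⊗ₜ[ℂ] (1 : QAlg p q)) ^ m * coprodTailM p q g.2.2 ^ m' *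
          coprodWeight p q h r f ν (ptMul g g') l (n + n') (m + m'))) := by
    intro n m n' m'
    set j₁ : ZMod p := l - n + m with hj₁
    set j : ZMod p := j₁ - n' + m' with hj
    have e1 : (l - ((n + n' : ℕ) : ZMod p) + ((m + m' : ℕ) : ZMod p)) = j := by
      rw [hj, hj₁]; push_cast; ring
    set Q := QrInt p r (f j) ν (ptMul g g') (((n + n' : ℕ) : ℤ) - (m + m' : ℕ)) with hQ
    have e2 : (etaP p q ^ n * etaM p q ^ m * deltaPow p q j₁) ⊗ₜ[ℂ]
        (etaP p q ^ n' * etaM p q ^ m' * deltaPow p q j) = ∑ k' : ZMod p, ∑ k : ZMod p,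
        (qPow p q (k' * j) * qPow p q (k * j₁)) • ((etaP p q ^ n * etaM p q ^ m * zeta p q k) ⊗ₜ[ℂ]
          (etaP p q ^ n' * etaM p q ^ m' * zeta p q k')) := by
      rw [← sum_qPow_smul_zeta hq j₁, ← sum_qPow_smul_zeta hq j, Finset.mul_sum, Finset.mul_sum,
        TensorProduct.tmul_sum]
      refine Finset.sum_congr rfl fun k' _ => ?_
      rw [TensorProduct.sum_tmul]
      refine Finset.sum_congr rfl fun k _ => ?_
      rw [mul_smul_comm, mul_smul_comm, TensorProduct.tmul_smul, ← TensorProduct.smul_tmul',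
        smul_smul]
    have e3 : (etaP p q ⊗ₜ[ℂ] (1 : QAlg p q)) ^ n * coprodTailP p q g.2.2 ^ n' *
        ((etaM p q ⊗ₜ[ℂ] (1 : QAlg p q)) ^ m * coprodTailM p q g.2.2 ^ m' *
          (deltaPow p q j ⊗ₜ[ℂ] deltaPow p q j)) =
        (Complex.exp (-g.2.2 * n' / p) * Complex.exp (g.2.2 * m' / p) *
          qPow p q (-(2 * m * n'))) • ((etaP p q ^ n * etaM p q ^ m * deltaPow p q j₁) ⊗ₜ[ℂ]
        (etaP p q ^ n' * etaM p q ^ m' * deltaPow p q j)) := by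
      rw [coprodTailP_pow, coprodTailM_pow, Algebra.TensorProduct.tmul_pow,
        Algebra.TensorProduct.tmul_pow, one_pow, one_pow]
      simp only [mul_smul_comm, smul_mul_assoc, Algebra.TensorProduct.tmul_mul_tmul, one_mul]
      have e4 : etaP p q ^ n * deltaPow p q n' * (etaM p q ^ m * deltaPow p q (-m') *
          deltaPow p q j) = qPow p q (-(2 * m * n')) •
            (etaP p q ^ n * etaM p q ^ m * deltaPow p q j₁) := by
        rw [mul_assoc (etaM p q ^ m), ← deltaPow_add, mul_assoc (etaP p q ^ n),
          ← mul_assoc (deltaPow p q n'), deltaPow_mul_etaM_pow hq1, smul_mul_assoc,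
          mul_assoc (etaM p q ^ m), ← deltaPow_add, mul_smul_comm, ← mul_assoc]
        congr 3
        rw [hj]; ring
      rw [e4, ← TensorProduct.smul_tmul', smul_smul, smul_smul, mul_assoc (etaP p q ^ n')]
      congr 1
      ring
    rw [coprodWeight, e1, mul_smul_comm, mul_smul_comm, e3, smul_smul, smul_smul, e2,
      Finset.smul_sum]
    refine Finset.sum_congr rfl fun k' _ => ?_
    rw [Finset.smul_sum]
    refine Finset.sum_congr rfl fun k _ => ?_
    rw [hH, smul_smul]
    dsimp only
    rw [← hj₁, ← hj, ← hQ]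
    congr 1
    -- All powers of $q$ are collected modulo $p$; the factor $q^{-2mn'}$ comes from moving
    -- $\delta^{n'}$ past $\eta_-^m$.
    have e5 : qPow p q ((k - n - m) * j₁) * qPow p q ((k' - n' - m') * j) *
        (qPow p q (n * m) * qPow p q (n' * m')) =
        qPow p q (-(n * n')) * qPow p q (m * m') * (qPow p q ((n + n') * (m + m')) *
        qPow p q (-((n + n') + (m + m')) * j)) * qPow p q (-(2 * m * n')) *
        (qPow p q (k' * j) * qPow p q (k * j₁)) := by
      simp only [← qPow_add hq1]
      congr 1
      rw [hj]; ring
    have e6 : ∀ a b : ℕ, q ^ (a * b) = qPow p q (a * b) := by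
      intro a b; rw [← qPow_natCast hq1]; push_cast; rfl
    rw [etaCoeff, etaCoeff, inv_pow, e6, e6, e6, e6, e6, ← qPow_neg hq1]
    have e7 : h ^ (((m + m' : ℕ) : ℤ) - (n + n' : ℕ)) = h ^ ((m : ℤ) - n) * h ^ ((m' : ℤ) - n') := by
      rw [← zpow_add₀ hh0]; congr 1; push_cast; ring
    rw [e7, show n + n' + (m + m') = (n + m) + (n' + m') by ring, pow_add]
    push_cast
    linear_combination ((Complex.I * realRoot p r) ^ (n + m) * (Complex.I * realRoot p r) ^ (n' + m')
      * h ^ ((m : ℤ) - n) * h ^ ((m' : ℤ) - n') * (qFact q n)⁻¹ * (qFact q n')⁻¹ * (qFact q m)⁻¹ *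
      (qFact q m')⁻¹ * Complex.exp (-g.2.2 * n' / p) * Complex.exp (g.2.2 * m' / p) * Q) * e5
  calc ∑ b' : Idx p, ∑ b : Idx p, H b.1 b.2.1 b.2.2 b'.1 b'.2.1 b'.2.2
      = ∑ n' ∈ Finset.range p, ∑ m' ∈ Finset.range p, ∑ k' : ZMod p,
          ∑ n ∈ Finset.range p, ∑ m ∈ Finset.range p, ∑ k : ZMod p, H n m k n' m' k' := by
        rw [sum_Idx (fun n' m' k' => ∑ b : Idx p, H b.1 b.2.1 b.2.2 n' m' k')]
        exact Finset.sum_congr rfl fun n' _ => Finset.sum_congr rfl fun m' _ =>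
          Finset.sum_congr rfl fun k' _ => sum_Idx fun n m k => H n m k n' m' k'
    _ = ∑ n' ∈ Finset.range p, ∑ m' ∈ Finset.range p,
          ∑ n ∈ Finset.range p, ∑ m ∈ Finset.range p,
            ∑ k' : ZMod p, ∑ k : ZMod p, H n m k n' m' k' := by
        refine Finset.sum_congr rfl fun n' _ => Finset.sum_congr rfl fun m' _ => ?_
        rw [Finset.sum_comm]
        exact Finset.sum_congr rfl fun n _ => Finset.sum_comm
    _ = _ := by
        simp only [hk]
        refine (Finset.sum_congr rfl fun n' _ => Finset.sum_comm).trans ?_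
        rw [Finset.sum_comm]
        exact Finset.sum_congr rfl fun n _ => Finset.sum_congr rfl fun n' _ => Finset.sum_comm

lemma coprodEtaP_eq (lam : ℝ) :
    coprodEtaP p q lam = etaP p q ⊗ₜ[ℂ] 1 + coprodTailP p q lam := rfl

lemma coprodEtaM_eq (lam : ℝ) :
    coprodEtaM p q lam = etaM p q ⊗ₜ[ℂ] 1 + coprodTailM p q lam := rfl

/-- The Taylor expansion of the left side and the $q$-binomial formula on the right side give the
same sum over $(N,M)$ of powers of $\Delta(\eta_\pm)$. -/
lemma coprod_Qr (hp : Odd p) (hq : IsPrimitiveRoot q p) (hh : h ^ 2 = q)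
    (hhp : h ^ p = -1) (r : ℝ) {F : ZMod p → ℂ → ℂ} (hF : F ∈ FVec p) (g g' : Pt) (l : ZMod p)
    (ν : ℂ) :
    coprod p q (fun b g => Qr p q h r F g b l ν) g g' =
      ∑ b' : Idx p, ∑ b : Idx p,
        Qr p q h r (Qr p q h r F g' b') g b l ν • (basisElt p q b ⊗ₜ[ℂ] basisElt p q b') := by
  obtain ⟨f, hf, rfl⟩ := exists_of_mem_FVec hF
  have hq1 := hq.pow_eq_one
  simp only [Qr_fourier hq1 r hf, Qr_fourier hq1 r (isTest_Tr q h r hf _ _)]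
  have key := sum_qExp_mul_weight₂ (A := etaP p q ⊗ₜ[ℂ] (1 : QAlg p q))
    (B := coprodTailP p q g.2.2) (A' := etaM p q ⊗ₜ[ℂ] (1 : QAlg p q))
    (B' := coprodTailM p q g.2.2) hp hq (head_mul_tailP hq1 g.2.2) etaP_tmul_one_pow_self
    (coprodTailP_pow_self _) (head_mul_tailM hq1 g.2.2) etaM_tmul_one_pow_self
    (coprodTailM_pow_self _) (commute_coprodEtaM hq1 _)
    (coprodWeight p q h r f ν (ptMul g g') l)
  rw [coprod_fourier_Tr hp hq hh hhp r hf, sum_Idx_Qr_Qr hq hh hhp, key]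
  simp only [coprodEtaP_eq, coprodEtaM_eq, nilDegP, nilDegM]

end

end

section

/-! ### Pseudo-unitarity -/

/-- The $q$-analogue of $\sum_j(-1)^j\binom{N+1}{j}=0$. After multiplication by $[N+1]\ne0$, the
$q$-Pascal splitting gives two sums which, with shifted indices, cancel term by term. -/
lemma sum_antidiagonal_alternating {p : ℕ} (hp : Odd p) {q : ℂ} (hq : IsPrimitiveRoot q p) {N : ℕ}
    (hN : N + 1 < p) :
    ∑ x ∈ Finset.HasAntidiagonal.antidiagonal (N + 1),
      (-1) ^ x.2 * q ^ (x.1 * N) * ((qFact q x.1)⁻¹ * (qFact q x.2)⁻¹) = 0 := by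
  have hq0 : q ≠ 0 := hq.ne_zero (by omega)
  have hn := qNum_ne_zero hp hq (Nat.succ_pos N) hN
  refine (mul_eq_zero.1 ?_).resolve_left hn
  have hfac : ∀ i, i < N + 1 → qNum q (i + 1) * (qFact q (i + 1))⁻¹ = (qFact q i)⁻¹ := by
    intro i hi
    have := qNum_ne_zero hp hq (Nat.succ_pos i) (by omega)
    rw [qFact_succ, mul_inv, mul_left_comm, mul_inv_cancel₀ this, mul_one]
  have h1 : qNum q (N + 1) * ∑ x ∈ Finset.HasAntidiagonal.antidiagonal (N + 1),
      (-1) ^ x.2 * q ^ (x.1 * N) * ((qFact q x.1)⁻¹ * (qFact q x.2)⁻¹) =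
      (∑ x ∈ Finset.HasAntidiagonal.antidiagonal (N + 1), (-1) ^ x.2 * q ^ (x.1 * N) * q⁻¹ ^ x.2 *
        ((qNum q x.1 * (qFact q x.1)⁻¹) * (qFact q x.2)⁻¹)) +
      ∑ x ∈ Finset.HasAntidiagonal.antidiagonal (N + 1), (-1) ^ x.2 * q ^ (x.1 * N) * q ^ x.1 *
        ((qFact q x.1)⁻¹ * (qNum q x.2 * (qFact q x.2)⁻¹)) := by
    rw [Finset.mul_sum, ← Finset.sum_add_distrib]
    refine Finset.sum_congr rfl fun x hx => ?_
    rw [← Finset.HasAntidiagonal.mem_antidiagonal.1 hx, add_comm, qNum_add hq0]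
    ring
  rw [h1, Finset.Nat.sum_antidiagonal_succ, Finset.Nat.sum_antidiagonal_succ', qNum_zero]
  simp only [zero_mul, mul_zero, zero_add]
  rw [← Finset.sum_add_distrib]
  refine Finset.sum_eq_zero fun x hx => ?_
  have hx' := Finset.HasAntidiagonal.mem_antidiagonal.1 hx
  rw [hfac x.1 (by omega), hfac x.2 (by omega)]
  have h2 : q ^ ((x.1 + 1) * N) * q⁻¹ ^ x.2 = q ^ (x.1 * N) * q ^ x.1 := by
    have h3 : q ^ x.2 * q⁻¹ ^ x.2 = 1 := by rw [← mul_pow, mul_inv_cancel₀ hq0, one_pow]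
    rw [add_mul, one_mul, pow_add]
    nth_rewrite 2 [← hx']
    rw [pow_add, mul_assoc, mul_assoc, h3, mul_one]
  rw [pow_succ]
  linear_combination (-1) ^ x.2 * ((qFact q x.1)⁻¹ * (qFact q x.2)⁻¹) * h2

lemma qPow_inv {p : ℕ} [NeZero p] {q : ℂ} (hq : q ^ p = 1) (x : ZMod p) :
    qPow p q⁻¹ x = qPow p q (-x) := by
  rw [qPow_neg hq, qPow, qPow, inv_pow]

/-- A truncated form of "a $q$-exponential times its inverse is $1$": total degrees $1,\dots,p-1$
cancel by the alternating sum, and higher ones vanish by hypothesis. -/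
lemma sum_alternating_weight {p : ℕ} [NeZero p] (hp : Odd p) {q : ℂ} (hq : IsPrimitiveRoot q p)
    {X : Type*} [AddCommGroup X] [Module ℂ X] (Z : ℕ → X) (hZ : ∀ N, p ≤ N → Z N = 0) :
    ∑ n ∈ Finset.range p, ∑ n' ∈ Finset.range p,
      ((-1) ^ n' * qPow p q (n * (n + n' - 1)) * ((qFact q n)⁻¹ * (qFact q n')⁻¹)) •
        Z (n + n') = Z 0 := by
  have hq1 := hq.pow_eq_one
  have hpos := Nat.pos_of_ne_zero (NeZero.ne p)
  rw [← Finset.sum_product', ← Finset.sum_fiberwise_of_maps_to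
    (t := Finset.range (p + p)) (g := fun x => x.1 + x.2)]
  · rw [Finset.sum_eq_single 0]
    · have : (Finset.range p ×ˢ Finset.range p).filter (fun x => x.1 + x.2 = 0) = {(0, 0)} := by
        ext x
        simp only [Finset.mem_filter, Finset.mem_product, Finset.mem_range, Finset.mem_singleton,
          Prod.ext_iff]
        omega
      rw [this, Finset.sum_singleton]
      simp [qFact_zero]
    · intro N _ hN0
      rcases le_or_gt p N with hN | hN
      · refine Finset.sum_eq_zero fun x hx => ?_
        rw [(Finset.mem_filter.1 hx).2, hZ N hN, smul_zero]
      · obtain ⟨K, rfl⟩ := Nat.exists_eq_succ_of_ne_zero hN0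
        have hset : (Finset.range p ×ˢ Finset.range p).filter (fun x => x.1 + x.2 = K.succ) =
            Finset.HasAntidiagonal.antidiagonal (K + 1) := by
          ext x
          simp only [Finset.mem_filter, Finset.mem_product, Finset.mem_range,
            Finset.HasAntidiagonal.mem_antidiagonal]
          omega
        rw [hset]
        have h1 : ∀ x ∈ Finset.HasAntidiagonal.antidiagonal (K + 1),
            ((-1) ^ x.2 * qPow p q (x.1 * (x.1 + x.2 - 1)) *
              ((qFact q x.1)⁻¹ * (qFact q x.2)⁻¹)) • Z (x.1 + x.2) =
            ((-1) ^ x.2 * q ^ (x.1 * K) * ((qFact q x.1)⁻¹ * (qFact q x.2)⁻¹)) • Z (K + 1) := by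
          intro x hx
          have hx' := Finset.HasAntidiagonal.mem_antidiagonal.1 hx
          rw [hx', ← Nat.cast_add, hx', ← qPow_natCast hq1]
          congr 4
          push_cast; ring
        rw [Finset.sum_congr rfl h1, ← Finset.sum_smul, sum_antidiagonal_alternating hp hq hN,
          zero_smul]
    · intro h0
      exact absurd (Finset.mem_range.2 (by omega)) h0
  · intro x hx
    simp only [Finset.mem_product, Finset.mem_range] at hx
    exact Finset.mem_range.2 (by omega)

section

variable {p : ℕ} [NeZero p] {q h : ℂ}

lemma form_fourier {v w : Vec p} (hv : ∀ j, IsTest (v j)) (hw : ∀ j, IsTest (w j)) :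
    form p (fun j => fourier (v j)) (fun j => fourier (w j)) =
      ∑ j : ZMod p, ∫ x, v j x * starRingEnd ℂ (w (-j) x) := by
  rw [form]
  refine Finset.sum_congr rfl fun j _ => ?_
  rw [Finset.sum_eq_single (-j)]
  · rw [if_pos (add_neg_cancel j), invFourier_fourier (hv j), invFourier_fourier (hw (-j))]
  · intro j' _ hj
    rw [if_neg]
    intro h
    exact hj (eq_neg_of_add_eq_zero_right h)
  · simp

lemma phase_mul_conj (r : ℝ) (g : Pt) (x : ℝ) :
    phase r g x * starRingEnd ℂ (phase r g x) = 1 := by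
  rw [phase, ← Complex.exp_conj, ← Complex.exp_add, ← Complex.exp_zero]
  congr 1
  simp only [map_mul, map_add, Complex.conj_I, Complex.conj_ofReal]
  ring

/-- The integrals occurring in the pseudo-Hermitian form of two values of `Q_r`. -/
def formInt (p : ℕ) (f f' : Vec p) (lam : ℝ) (j j' : ZMod p) (s : ℤ) : ℂ :=
  ∫ x : ℝ, Complex.exp (s / p * x) * f j (x - lam) * starRingEnd ℂ (f' j' (x - lam))

lemma form_Tr (r : ℝ) {f f' : Vec p} (hf : ∀ j, IsTest (f j)) (hf' : ∀ j, IsTest (f' j)) (g : Pt)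
    (b b' : Idx p) :
    form p (fun j => fourier (Tr p q h r f g b j)) (fun j => fourier (Tr p q h r f' g b' j)) =
      ∑ j' : ZMod p, QrCoeff p q h r b (-j' - ((b.1 : ℕ) + (b'.1 : ℕ)) + ((b.2.1 : ℕ) + (b'.2.1 : ℕ))) *
        starRingEnd ℂ (QrCoeff p q h r b' j') *
        formInt p f f' g.2.2 (-j' - ((b.1 : ℕ) + (b'.1 : ℕ)) + ((b.2.1 : ℕ) + (b'.2.1 : ℕ))) j'
          ((((b.1 : ℕ) + (b'.1 : ℕ) : ℕ) : ℤ) - ((b.2.1 : ℕ) + (b'.2.1 : ℕ) : ℕ)) := by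
  rw [form_fourier (isTest_Tr q h r hf g b) (isTest_Tr q h r hf' g b'),
    -- The summation index is replaced by $m'-n'-j'$, so that $j'$ becomes the component of $f'$
    -- that occurs.
    ← Equiv.sum_comp (Equiv.subLeft (((b'.2.1 : ℕ) : ZMod p) - ((b'.1 : ℕ) : ZMod p)))]
  refine Finset.sum_congr rfl fun j' _ => ?_
  rw [formInt, ← integral_const_mul]
  congr 1 with x
  simp only [Equiv.subLeft_apply, Tr]
  rw [show ((b'.2.1 : ℕ) : ZMod p) - ((b'.1 : ℕ) : ZMod p) - j' - ((b.1 : ℕ) : ZMod p) +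
    ((b.2.1 : ℕ) : ZMod p) = -j' - ((b.1 : ℕ) + (b'.1 : ℕ)) + ((b.2.1 : ℕ) + (b'.2.1 : ℕ)) by ring,
    show -(((b'.2.1 : ℕ) : ZMod p) - ((b'.1 : ℕ) : ZMod p) - j') - ((b'.1 : ℕ) : ZMod p) +
    ((b'.2.1 : ℕ) : ZMod p) = j' by ring]
  set j : ZMod p := -j' - ((b.1 : ℕ) + (b'.1 : ℕ)) + ((b.2.1 : ℕ) + (b'.2.1 : ℕ))
  have e1 : Complex.exp (((((b.1 : ℕ) + (b'.1 : ℕ) : ℕ) : ℤ) - ((b.2.1 : ℕ) + (b'.2.1 : ℕ) : ℕ) : ℤ)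
      / p * x) = Complex.exp ((((b.1 : ℕ) : ℂ) - (b.2.1 : ℕ)) / p * x) *
      starRingEnd ℂ (Complex.exp ((((b'.1 : ℕ) : ℂ) - (b'.2.1 : ℕ)) / p * x)) := by
    rw [← Complex.exp_conj, ← Complex.exp_add]
    congr 1
    simp
    ring
  rw [e1]
  simp only [map_mul]
  linear_combination (QrCoeff p q h r b j * starRingEnd ℂ (QrCoeff p q h r b' j') *
    Complex.exp ((((b.1 : ℕ) : ℂ) - (b.2.1 : ℕ)) / p * x) *
      starRingEnd ℂ (Complex.exp ((((b'.1 : ℕ) : ℂ) - (b'.2.1 : ℕ)) / p * x)) *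
      f j (x - g.2.2) * starRingEnd ℂ (f' j' (x - g.2.2))) * phase_mul_conj r g x

lemma conj_eq_inv (hp : p ≠ 0) {z : ℂ} (hz : z ^ p = 1 ∨ z ^ p = -1) : starRingEnd ℂ z = z⁻¹ := by
  have h1 : ‖z‖ = 1 := by
    refine (pow_eq_one_iff_of_nonneg (norm_nonneg z) hp).1 ?_
    rw [← norm_pow]
    rcases hz with hz | hz <;> simp [hz]
  rw [Complex.inv_def, Complex.normSq_eq_norm_sq, h1]
  simp

/-- Conjugation sends $q$ to $q^{-1}$, under which $[n]$ is invariant. -/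
lemma conj_qFact (hq : q ^ p = 1) (n : ℕ) : starRingEnd ℂ (qFact q n) = qFact q n := by
  have h1 := conj_eq_inv (NeZero.ne p) (Or.inl hq)
  rw [qFact, map_prod]
  refine Finset.prod_congr rfl fun i _ => ?_
  conv_rhs => rw [← qNum_inv q]
  simp [qNum, h1]

lemma conj_qPow (hq : q ^ p = 1) (x : ZMod p) : starRingEnd ℂ (qPow p q x) = qPow p q (-x) := by
  rw [← qPow_inv hq, qPow, qPow, map_pow, conj_eq_inv (NeZero.ne p) (Or.inl hq)]

lemma conj_etaCoeff (hq : q ^ p = 1) (hhp : h ^ p = -1) (r : ℝ) (n m : ℕ) :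
    starRingEnd ℂ (etaCoeff p q h r n m) =
      (-1) ^ (n + m) * (Complex.I * realRoot p r) ^ (n + m) * h ^ ((n : ℤ) - m) *
        qPow p q (-(n * m)) * ((qFact q n)⁻¹ * (qFact q m)⁻¹) := by
  have h1 := conj_eq_inv (NeZero.ne p) (Or.inr hhp)
  have h2 : q ^ (n * m) = qPow p q (n * m) := by rw [← qPow_natCast hq]; push_cast; rfl
  rw [etaCoeff, h2]
  simp only [map_mul, map_pow, map_zpow₀, map_inv₀, conj_qFact hq, conj_qPow hq, h1,
    Complex.conj_I, Complex.conj_ofReal]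
  rw [inv_zpow', neg_sub, neg_mul, neg_pow]

lemma sum_conj_qPow_smul_star (hq : IsPrimitiveRoot q p) (j : ZMod p) :
    ∑ k : ZMod p, qPow p q (-(k * j)) • ((1 / (p : ℂ)) • ∑ n ∈ Finset.range p,
      (starRingEnd ℂ (q⁻¹ ^ (n * k.val))) • gen p q Gen.delta ^ n) = deltaPow p q j := by
  have h1 := sum_qPow_smul_spectral hq.inv (gen p q Gen.delta) j
  have h2 : starRingEnd ℂ q⁻¹ = q⁻¹⁻¹ := by
    rw [conj_eq_inv (NeZero.ne p) (Or.inl (by rw [inv_pow, hq.pow_eq_one, inv_one]))]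
  simp only [map_pow, h2, ← qPow_inv hq.pow_eq_one]
  exact h1

/-- The part of bidegree `(N, M)` of the form of two values of `Q_r`. -/
def formWeight (p : ℕ) (q h : ℂ) (r : ℝ) (f f' : Vec p) (lam : ℝ) (j' : ZMod p) (N M : ℕ) :
    QAlg p q :=
  ((Complex.I * realRoot p r) ^ (N + M) * h ^ ((N : ℤ) - M) *
    qPow p q (N * M - (N + M) * j') * formInt p f f' lam (-j' - N + M) j' ((N : ℤ) - M)) •
    (etaP p q ^ N * etaM p q ^ M * deltaPow p q (-N + M))

/-- Summing over $k,k'$ restores powers of $\delta$, and bringing the product into the order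
$\eta_+,\eta_-,\delta$ makes it depend only on the bidegree, up to the displayed scalars. The signs
$(-1)^{n'},(-1)^{m'}$ come from conjugating $ir^{1/p}$. -/
lemma sum_form_spectral (hq : IsPrimitiveRoot q p) (hh : h ^ 2 = q) (hhp : h ^ p = -1) (r : ℝ)
    (f f' : Vec p) (lam : ℝ) (j' : ZMod p) (n m n' m' : ℕ) :
    ∑ k : ZMod p, ∑ k' : ZMod p,
      (etaCoeff p q h r n m * qPow p q ((k - n - m) * (-j' - (n + n') + (m + m'))) *
      starRingEnd ℂ (etaCoeff p q h r n' m' * qPow p q ((k' - n' - m') * j')) *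
      formInt p f f' lam (-j' - (n + n') + (m + m')) j'
        (((n + n' : ℕ) : ℤ) - (m + m' : ℕ))) •
      (((1 / (p : ℂ)) • ∑ n ∈ Finset.range p,
      (starRingEnd ℂ (q⁻¹ ^ (n * k'.val))) • gen p q Gen.delta ^ n) *
      etaM p q ^ m' * etaP p q ^ n' * (etaP p q ^ n * etaM p q ^ m * zeta p q k)) =
    ((-1) ^ n' * qPow p q (n * (n + n' - 1)) * ((qFact q n)⁻¹ * (qFact q n')⁻¹)) •
      ((-1) ^ m' * qPow p q⁻¹ (m * (m + m' - 1)) * ((qFact q m)⁻¹ * (qFact q m')⁻¹)) •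
      formWeight p q h r f f' lam j' (n + n') (m + m') := by
  have hq1 := hq.pow_eq_one
  have hh0 : h ≠ 0 := by rintro rfl; simp [NeZero.ne p] at hhp
  set j : ZMod p := -j' - (n + n') + (m + m') with hj
  set Φ := formInt p f f' lam j j' (((n + n' : ℕ) : ℤ) - (m + m' : ℕ)) with hΦ
  set D : ZMod p → QAlg p q := fun k' => (1 / (p : ℂ)) • ∑ n ∈ Finset.range p,
      (starRingEnd ℂ (q⁻¹ ^ (n * k'.val))) • gen p q Gen.delta ^ n with hD
  have e1 : deltaPow p q j' * etaM p q ^ m' * etaP p q ^ n' *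
      (etaP p q ^ n * etaM p q ^ m * deltaPow p q j) = ∑ k : ZMod p, ∑ k' : ZMod p,
      (qPow p q (k * j) * qPow p q (-(k' * j'))) • (D k' *
      etaM p q ^ m' * etaP p q ^ n' * (etaP p q ^ n * etaM p q ^ m * zeta p q k)) := by
    rw [← sum_qPow_smul_zeta hq j, ← sum_conj_qPow_smul_star hq j', Finset.mul_sum, Finset.mul_sum]
    refine Finset.sum_congr rfl fun k _ => ?_
    rw [Finset.sum_mul, Finset.sum_mul, Finset.sum_mul]
    refine Finset.sum_congr rfl fun k' _ => ?_
    rw [mul_smul_comm, mul_smul_comm, smul_mul_assoc, smul_mul_assoc, smul_mul_assoc, smul_smul]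
  have e2 : deltaPow p q j' * etaM p q ^ m' * etaP p q ^ n' *
      (etaP p q ^ n * etaM p q ^ m * deltaPow p q j) =
      qPow p q (2 * m' * (n + n') - 2 * (n + n' + m + m') * j') •
      (etaP p q ^ (n + n') * etaM p q ^ (m + m') *
        deltaPow p q (-(n + n' : ℕ) + (m + m' : ℕ))) := by
    have e3 : deltaPow p q j' * etaM p q ^ m' * etaP p q ^ n' *
        (etaP p q ^ n * etaM p q ^ m * deltaPow p q j) =
        deltaPow p q j' * (etaM p q ^ m' * etaP p q ^ (n + n')) * (etaM p q ^ m * deltaPow p q j) := by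
      rw [pow_add, (Commute.pow_pow_self (etaP p q) n n').eq]
      simp only [mul_assoc]
    have e4 : deltaPow p q j' * (etaP p q ^ (n + n') * etaM p q ^ (m + m')) =
        qPow p q (-2 * (n + n' + m + m') * j') • (etaP p q ^ (n + n') * etaM p q ^ (m + m') *
          deltaPow p q j') := by
      rw [← mul_assoc, deltaPow_mul_etaP_pow hq1, smul_mul_assoc, mul_assoc (etaP p q ^ (n + n')),
        deltaPow_mul_etaM_pow hq1, mul_smul_comm, smul_smul, ← qPow_add hq1, ← mul_assoc]
      congr 2
      push_cast; ring
    have e5 : deltaPow p q j' * (etaP p q ^ (n + n') * etaM p q ^ m') *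
        (etaM p q ^ m * deltaPow p q j) =
        deltaPow p q j' * (etaP p q ^ (n + n') * etaM p q ^ (m + m')) * deltaPow p q j := by
      rw [pow_add (etaM p q), (Commute.pow_pow_self (etaM p q) m m').eq]
      simp only [mul_assoc]
    rw [e3, etaM_pow_mul_etaP_pow, mul_smul_comm, smul_mul_assoc, e5, e4, smul_mul_assoc, smul_smul,
      mul_assoc _ (deltaPow p q j'), ← deltaPow_add, ← qPow_natCast hq1, ← qPow_add hq1]
    congr 2
    · push_cast; ring
    · congr 1
      rw [hj]; push_cast; ring
  have e6 : ∀ k k' : ZMod p, etaCoeff p q h r n m * qPow p q ((k - n - m) * j) *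
      starRingEnd ℂ (etaCoeff p q h r n' m' * qPow p q ((k' - n' - m') * j')) * Φ =
      (etaCoeff p q h r n m * starRingEnd ℂ (etaCoeff p q h r n' m') *
        qPow p q (-(n + m) * j + (n' + m') * j') * Φ) *
        (qPow p q (k * j) * qPow p q (-(k' * j'))) := by
    intro k k'
    have : qPow p q ((k - n - m) * j) * qPow p q (-((k' - n' - m') * j')) =
        qPow p q (-(n + m) * j + (n' + m') * j') * (qPow p q (k * j) * qPow p q (-(k' * j'))) := by
      simp only [← qPow_add hq1]
      congr 1; ring
    rw [map_mul, conj_qPow hq1]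
    linear_combination (etaCoeff p q h r n m * starRingEnd ℂ (etaCoeff p q h r n' m') * Φ) * this
  simp only [e6, mul_smul _ (qPow p q _ * qPow p q _)]
  simp only [← Finset.smul_sum]
  rw [← e1, e2, formWeight, smul_smul, smul_smul, smul_smul]
  congr 1
  have e7 : formInt p f f' lam (-j' - ((n + n' : ℕ) : ZMod p) + ((m + m' : ℕ) : ZMod p)) j'
      (((n + n' : ℕ) : ℤ) - (m + m' : ℕ)) = Φ := by
    rw [hΦ, hj]; push_cast; rfl
  have e8 : h ^ (((n + n' : ℕ) : ℤ) - (m + m' : ℕ)) = h ^ ((m : ℤ) - n) * h ^ ((n' : ℤ) - m') *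
      qPow p q (n - m) := by
    have : qPow p q ((n : ZMod p) - m) = h ^ (2 * ((n : ℤ) - m)) := by
      rw [zpow_mul, zpow_ofNat, hh, ← qPow_intCast hq1]; push_cast; rfl
    rw [this, ← zpow_add₀ hh0, ← zpow_add₀ hh0]
    congr 1; push_cast; ring
  -- The powers of $q$ modulo $p$: they separate into the alternating weight with $q$ in $n,n'$, the
  -- one with $q^{-1}$ in $m,m'$, a factor balancing that of `e8`, and a function of the bidegree.
  have e9 : qPow p q (n * m) * qPow p q (-(n' * m')) * qPow p q (-(n + m) * j + (n' + m') * j') *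
      qPow p q (2 * m' * (n + n') - 2 * (n + n' + m + m') * j') =
      qPow p q (n * (n + n' - 1)) * qPow p q (-(m * (m + m' - 1))) * qPow p q (n - m) *
      qPow p q ((n + n' : ℕ) * (m + m' : ℕ) - ((n + n' : ℕ) + (m + m' : ℕ)) * j') := by
    simp only [← qPow_add hq1]
    congr 1
    rw [hj]; push_cast; ring
  rw [e7, e8, conj_etaCoeff hq1 hhp, qPow_inv hq1, etaCoeff,
    show q ^ (n * m) = qPow p q (n * m) by rw [← qPow_natCast hq1]; push_cast; rfl,
    show n + n' + (m + m') = (n + m) + (n' + m') by ring, pow_add _ (n + m), pow_add (-1 : ℂ)]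
  linear_combination ((Complex.I * realRoot p r) ^ (n + m) * (Complex.I * realRoot p r) ^ (n' + m')
      * h ^ ((m : ℤ) - n) * h ^ ((n' : ℤ) - m') * (qFact q n)⁻¹ * (qFact q n')⁻¹ * (qFact q m)⁻¹ *
      (qFact q m')⁻¹ * (-1) ^ n' * (-1) ^ m' * Φ) * e9

lemma unitary_Qr (hp : Odd p) (hq : IsPrimitiveRoot q p) (hh : h ^ 2 = q) (hhp : h ^ p = -1)
    (r : ℝ) {F G : ZMod p → ℂ → ℂ} (hF : F ∈ FVec p) (hG : G ∈ FVec p) (g : Pt) :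
    ∑ b : Idx p, ∑ b' : Idx p, form p (Qr p q h r F g b) (Qr p q h r G g b') •
      (basisEltStar p q b' * basisElt p q b) = form p F G • (1 : QAlg p q) := by
  obtain ⟨f, hf, rfl⟩ := exists_of_mem_FVec hF
  obtain ⟨f', hf', rfl⟩ := exists_of_mem_FVec hG
  have hq1 := hq.pow_eq_one
  have hh0 : h ≠ 0 := by rintro rfl; simp [NeZero.ne p] at hhp
  set H : ZMod p → ℕ → ℕ → ZMod p → ℕ → ℕ → ZMod p → QAlg p q := fun j' n m k n' m' k' =>
      (etaCoeff p q h r n m * qPow p q ((k - n - m) * (-j' - (n + n') + (m + m'))) *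
      starRingEnd ℂ (etaCoeff p q h r n' m' * qPow p q ((k' - n' - m') * j')) *
      formInt p f f' g.2.2 (-j' - (n + n') + (m + m')) j'
        (((n + n' : ℕ) : ℤ) - (m + m' : ℕ))) •
      (((1 / (p : ℂ)) • ∑ n ∈ Finset.range p,
      (starRingEnd ℂ (q⁻¹ ^ (n * k'.val))) • gen p q Gen.delta ^ n) *
      etaM p q ^ m' * etaP p q ^ n' * (etaP p q ^ n * etaM p q ^ m * zeta p q k)) with hH
  have h1 : ∀ b b' : Idx p, form p (Qr p q h r (fun j => fourier (f j)) g b)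
      (Qr p q h r (fun j => fourier (f' j)) g b') • (basisEltStar p q b' * basisElt p q b) =
      ∑ j' : ZMod p, H j' b.1 b.2.1 b.2.2 b'.1 b'.2.1 b'.2.2 := by
    intro b b'
    rw [Qr_fourier hq1 r hf, Qr_fourier hq1 r hf', form_Tr r hf hf', Finset.sum_smul]
    refine Finset.sum_congr rfl fun j' _ => ?_
    rw [QrCoeff_eq hh hh0, QrCoeff_eq hh hh0]
    rfl
  simp only [h1]
  have h2 : ∀ j' : ZMod p, ∑ b : Idx p, ∑ b' : Idx p, H j' b.1 b.2.1 b.2.2 b'.1 b'.2.1 b'.2.2 =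
      formWeight p q h r f f' g.2.2 j' 0 0 := by
    intro j'
    calc ∑ b : Idx p, ∑ b' : Idx p, H j' b.1 b.2.1 b.2.2 b'.1 b'.2.1 b'.2.2
        = ∑ n ∈ Finset.range p, ∑ m ∈ Finset.range p, ∑ k : ZMod p,
          ∑ n' ∈ Finset.range p, ∑ m' ∈ Finset.range p, ∑ k' : ZMod p, H j' n m k n' m' k' := by
          rw [sum_Idx (fun n m k => ∑ b' : Idx p, H j' n m k b'.1 b'.2.1 b'.2.2)]
          exact Finset.sum_congr rfl fun n _ => Finset.sum_congr rfl fun m _ =>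
            Finset.sum_congr rfl fun k _ => sum_Idx fun n' m' k' => H j' n m k n' m' k'
      _ = ∑ n ∈ Finset.range p, ∑ m ∈ Finset.range p,
          ∑ n' ∈ Finset.range p, ∑ m' ∈ Finset.range p,
            ∑ k : ZMod p, ∑ k' : ZMod p, H j' n m k n' m' k' := by
          refine Finset.sum_congr rfl fun n _ => Finset.sum_congr rfl fun m _ => ?_
          rw [Finset.sum_comm]
          exact Finset.sum_congr rfl fun n' _ => Finset.sum_comm
      _ = ∑ n ∈ Finset.range p, ∑ n' ∈ Finset.range p,
          ((-1) ^ n' * qPow p q (n * (n + n' - 1)) * ((qFact q n)⁻¹ * (qFact q n')⁻¹)) •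
          ∑ m ∈ Finset.range p, ∑ m' ∈ Finset.range p,
          ((-1) ^ m' * qPow p q⁻¹ (m * (m + m' - 1)) * ((qFact q m)⁻¹ * (qFact q m')⁻¹)) •
          formWeight p q h r f f' g.2.2 j' (n + n') (m + m') := by
          refine Finset.sum_congr rfl fun n _ => ?_
          rw [Finset.sum_comm]
          refine Finset.sum_congr rfl fun n' _ => ?_
          rw [Finset.smul_sum]
          refine Finset.sum_congr rfl fun m _ => ?_
          rw [Finset.smul_sum]
          exact Finset.sum_congr rfl fun m' _ =>
            sum_form_spectral hq hh hhp r f f' g.2.2 j' n m n' m'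
      _ = formWeight p q h r f f' g.2.2 j' 0 0 := by
          have h3 : ∀ N, ∑ m ∈ Finset.range p, ∑ m' ∈ Finset.range p,
              ((-1) ^ m' * qPow p q⁻¹ (m * (m + m' - 1)) * ((qFact q m)⁻¹ * (qFact q m')⁻¹)) •
              formWeight p q h r f f' g.2.2 j' N (m + m') =
              formWeight p q h r f f' g.2.2 j' N 0 := by
            intro N
            have := sum_alternating_weight hp hq.inv (formWeight p q h r f f' g.2.2 j' N) ?_
            · simpa only [qFact_inv] using this
            · intro M hM
              rw [formWeight, pow_eq_zero_of_le hM (etaM_pow_self p q), mul_zero, zero_mul,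
                smul_zero]
          simp only [h3]
          exact sum_alternating_weight hp hq (fun N => formWeight p q h r f f' g.2.2 j' N 0)
            fun N hN => by
              rw [formWeight, pow_eq_zero_of_le hN (etaP_pow_self p q), zero_mul, zero_mul,
                smul_zero]
  have h4 : ∀ b : Idx p, ∑ b' : Idx p, ∑ j' : ZMod p, H j' b.1 b.2.1 b.2.2 b'.1 b'.2.1 b'.2.2 =
      ∑ j' : ZMod p, ∑ b' : Idx p, H j' b.1 b.2.1 b.2.2 b'.1 b'.2.1 b'.2.2 :=
    fun b => Finset.sum_comm
  simp only [h4]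
  rw [Finset.sum_comm, Finset.sum_congr rfl fun j' _ => h2 j', form_fourier hf hf',
    Finset.sum_smul, ← Equiv.sum_comp (Equiv.neg (ZMod p))]
  refine Finset.sum_congr rfl fun j _ => ?_
  -- In bidegree $(0,0)$ only the translation by $\lambda$ is left, and Lebesgue measure is
  -- invariant under it.
  have h5 : formInt p f f' g.2.2 j (-j) 0 = ∫ x, f j x * starRingEnd ℂ (f' (-j) x) := by
    rw [formInt, ← integral_sub_right_eq_self (fun x => f j x * starRingEnd ℂ (f' (-j) x)) g.2.2]
    simp
  simp [formWeight, deltaPow_zero, h5]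

end

end

section

/-! ### Oscillatory integrals -/

/-- The function `e^{-(z e^x + z' e^{-x}) + wx}`. -/
def osc (z z' w : ℂ) (x : ℝ) : ℂ :=
  Complex.exp (-(z * Real.exp x + z' * Real.exp (-x)) + w * x)

/-- The purely imaginary number `-ic`. -/
def negI (c : ℝ) : ℂ := -(Complex.I * c)

lemma negI_re (c : ℝ) : (negI c).re = 0 := by simp [negI]

lemma negI_ne_zero {c : ℝ} (hc : c ≠ 0) : negI c ≠ 0 := by simp [negI, hc]

lemma KIntegrand_eq_osc (p : ℕ) (r : ℝ) (s : ℤ) (ν μ : ℂ) (g : Pt) :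
    KIntegrand p r s ν μ g = osc (negI (r * g.1)) (negI (r * g.2.1)) (ν - μ + s / p) := by
  funext x
  rw [KIntegrand, osc, negI, negI]
  congr 1
  push_cast
  ring

lemma norm_osc (z z' w : ℂ) (x : ℝ) :
    ‖osc z z' w x‖ = Real.exp (-(z.re * Real.exp x + z'.re * Real.exp (-x)) + w.re * x) := by
  rw [osc, Complex.norm_exp, Complex.add_re, Complex.neg_re, Complex.add_re, Complex.re_mul_ofReal,
    Complex.re_mul_ofReal, Complex.re_mul_ofReal]

lemma norm_osc_le {z z' : ℂ} (hz : 0 ≤ z.re) (hz' : 0 ≤ z'.re) (w : ℂ) (x : ℝ) :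
    ‖osc z z' w x‖ ≤ Real.exp (w.re * x) := by
  rw [norm_osc, Real.exp_le_exp]
  have : 0 ≤ z.re * Real.exp x + z'.re * Real.exp (-x) := by positivity
  linarith

lemma continuous_osc (z z' w : ℂ) : Continuous (osc z z' w) := by
  unfold osc
  fun_prop

lemma osc_neg (z z' w : ℂ) (x : ℝ) : osc z z' w (-x) = osc z' z (-w) x := by
  rw [osc, osc]
  congr 1
  push_cast
  rw [neg_neg]
  ring

/-- The remainder after one integration by parts of `osc`. -/
def oscRem (z z' w : ℂ) (x : ℝ) : ℂ :=
  -(osc z z' (w - 1) x * ((w - 1 + z' * Real.exp (-x)) / z))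

lemma continuous_oscRem (z z' w : ℂ) : Continuous (oscRem z z' w) := by
  have := continuous_osc z z' (w - 1)
  unfold oscRem
  fun_prop

lemma hasDerivAt_osc (z z' w : ℂ) (x : ℝ) : HasDerivAt (osc z z' w)
    (osc z z' w x * (-(z * Real.exp x - z' * Real.exp (-x)) + w)) x := by
  have h1 : HasDerivAt (fun x : ℝ => (Real.exp x : ℂ)) (Real.exp x : ℂ) x :=
    (Real.hasDerivAt_exp x).ofReal_comp
  have h2 : HasDerivAt (fun x : ℝ => (Real.exp (-x) : ℂ)) (-Real.exp (-x) : ℂ) x := by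
    have := ((Real.hasDerivAt_exp (-x)).comp x (hasDerivAt_neg x)).ofReal_comp
    simpa using this
  have h3 : HasDerivAt (fun x : ℝ => (x : ℂ)) 1 x := Complex.ofRealCLM.hasDerivAt
  have h4 := ((((h1.const_mul z).add (h2.const_mul z')).neg).add (h3.const_mul w)).cexp
  refine HasDerivAt.congr_deriv h4 ?_
  change osc z z' w x * _ = _
  ring

/-- Since `osc z z' w` is $e^x$ times the same function with $w-1$, it is the dominant part of the
derivative of the latter divided by $-z$. The error `oscRem` has lost the factor $e^x$. -/
lemma hasDerivAt_osc_div {z : ℂ} (hz : z ≠ 0) (z' w : ℂ) (x : ℝ) :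
    HasDerivAt (fun x : ℝ => -(osc z z' (w - 1) x / z)) (osc z z' w x + oscRem z z' w x) x := by
  have h6 : osc z z' w x = osc z z' (w - 1) x * Real.exp x := by
    rw [osc, osc, Complex.ofReal_exp x, ← Complex.exp_add]
    congr 1
    ring
  refine HasDerivAt.congr_deriv ((hasDerivAt_osc z z' (w - 1) x).div_const z).neg ?_
  rw [h6, oscRem]
  field_simp
  ring

lemma intervalIntegral_osc {z : ℂ} (hz : z ≠ 0) (z' w : ℂ) (B : ℝ) :
    ∫ x in (0 : ℝ)..B, osc z z' w x = osc z z' (w - 1) 0 / z -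
      osc z z' (w - 1) B / z - ∫ x in (0 : ℝ)..B, oscRem z z' w x := by
  have h := intervalIntegral.integral_eq_sub_of_hasDerivAt (a := 0) (b := B)
    (fun x _ => hasDerivAt_osc_div hz z' w x)
    (((continuous_osc z z' w).add (continuous_oscRem z z' w)).intervalIntegrable 0 B)
  rw [intervalIntegral.integral_add ((continuous_osc z z' w).intervalIntegrable 0 B)
    ((continuous_oscRem z z' w).intervalIntegrable 0 B)] at h
  linear_combination h

/-- For $\mathrm{Re}\,w<1$ the remainder decays exponentially without using oscillation. This is why
the improper integrals exist even for purely imaginary $z$. -/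
lemma norm_oscRem_le {z z' : ℂ} (hz : 0 ≤ z.re) (hz' : 0 ≤ z'.re) (w : ℂ) {x : ℝ} (hx : 0 ≤ x) :
    ‖oscRem z z' w x‖ ≤ (‖w - 1‖ + ‖z'‖) / ‖z‖ * Real.exp (-(1 - w.re) * x) := by
  rw [oscRem, norm_neg, norm_mul, norm_div, mul_comm]
  have h1 := norm_osc_le hz hz' (w - 1) x
  rw [show (w - 1).re = -(1 - w.re) by simp] at h1
  gcongr
  refine (norm_add_le _ _).trans ?_
  gcongr
  rw [norm_mul, Complex.norm_real, Real.norm_eq_abs, Real.abs_exp]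
  exact mul_le_of_le_one_right (norm_nonneg z') (Real.exp_le_one_iff.2 (by linarith))

lemma integrableOn_oscRem {z z' : ℂ} (hz : 0 ≤ z.re) (hz' : 0 ≤ z'.re) {w : ℂ} (hw : w.re < 1) :
    IntegrableOn (oscRem z z' w) (Set.Ioi 0) := by
  refine Integrable.mono' ((integrableOn_exp_mul_Ioi (a := -(1 - w.re)) (by linarith) 0).const_mul
    ((‖w - 1‖ + ‖z'‖) / ‖z‖)) (continuous_oscRem z z' w).aestronglyMeasurable ?_
  filter_upwards [ae_restrict_mem measurableSet_Ioi] with x hx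
  exact norm_oscRem_le hz hz' w (le_of_lt hx)

/-- The improper integral of `osc` over the positive half-line. -/
def oscHalf (z z' w : ℂ) : ℂ :=
  osc z z' (w - 1) 0 / z - ∫ x in Set.Ioi (0 : ℝ), oscRem z z' w x

lemma tendsto_oscHalf {z z' : ℂ} (hz0 : z ≠ 0) (hz : 0 ≤ z.re) (hz' : 0 ≤ z'.re) {w : ℂ}
    (hw : w.re < 1) :
    Tendsto (fun B : ℝ => ∫ x in (0 : ℝ)..B, osc z z' w x) atTop (𝓝 (oscHalf z z' w)) := by
  have h1 := intervalIntegral_tendsto_integral_Ioi 0 (integrableOn_oscRem hz hz' hw) tendsto_id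
  have h2 : Tendsto (fun B : ℝ => osc z z' (w - 1) B / z) atTop (𝓝 0) := by
    rw [← zero_div z]
    refine Tendsto.div_const ?_ _
    refine squeeze_zero_norm (norm_osc_le hz hz' (w - 1)) ?_
    refine Real.tendsto_exp_atBot.comp (Tendsto.const_mul_atTop_of_neg ?_ tendsto_id)
    simpa using hw
  have h3 := (h2.const_sub (osc z z' (w - 1) 0 / z)).sub h1
  rw [sub_zero] at h3
  exact h3.congr fun B => (intervalIntegral_osc hz0 z' w B).symm

/-- The bound is uniform in the cut-off and linear in $|w|$, as dominated convergence along a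
vertical line requires. -/
lemma norm_integral_osc_le {z z' : ℂ} (hz0 : z ≠ 0) (hz : 0 ≤ z.re) (hz' : 0 ≤ z'.re) {w : ℂ}
    (hw : w.re < 1) {B : ℝ} (hB : 0 ≤ B) : ‖∫ x in (0 : ℝ)..B, osc z z' w x‖ ≤
      (2 + (‖w‖ + 1 + ‖z'‖) / (1 - w.re)) / ‖z‖ := by
  have hc' : 0 < ‖z‖ := norm_pos_iff.2 hz0
  have hw' : 0 < 1 - w.re := by linarith
  rw [intervalIntegral_osc hz0]
  have h1 : ∀ x, 0 ≤ x → ‖osc z z' (w - 1) x / z‖ ≤ 1 / ‖z‖ := by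
    intro x hx
    rw [norm_div]
    gcongr
    refine (norm_osc_le hz hz' _ _).trans ?_
    rw [Real.exp_le_one_iff]
    have : (w - 1).re ≤ 0 := by simpa using hw.le
    exact mul_nonpos_of_nonpos_of_nonneg this hx
  have h2 : ‖∫ x in (0 : ℝ)..B, oscRem z z' w x‖ ≤ (‖w - 1‖ + ‖z'‖) / ‖z‖ * (1 - w.re)⁻¹ := by
    have h3 := integrableOn_exp_mul_Ioi (a := -(1 - w.re)) (by linarith) 0
    have h4 : ∫ x in Set.Ioi (0 : ℝ), Real.exp (-(1 - w.re) * x) = (1 - w.re)⁻¹ := by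
      rw [integral_exp_mul_Ioi (by linarith)]
      simp only [mul_zero, Real.exp_zero]
      rw [div_neg, neg_div, neg_neg, one_div]
    rw [← h4, ← integral_const_mul, intervalIntegral.integral_of_le hB]
    have h5 : IntegrableOn (fun x => (‖w - 1‖ + ‖z'‖) / ‖z‖ * Real.exp (-(1 - w.re) * x))
      (Set.Ioi 0) := h3.const_mul _
    refine (norm_integral_le_of_norm_le (h5.mono_set Set.Ioc_subset_Ioi_self) ?_).trans
      (setIntegral_mono_set h5 ?_ Set.Ioc_subset_Ioi_self.eventuallyLE)
    · filter_upwards [ae_restrict_mem measurableSet_Ioc] with x hx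
      exact norm_oscRem_le hz hz' w hx.1.le
    · exact Eventually.of_forall fun x => by positivity
  refine (norm_sub_le _ _).trans ((add_le_add ((norm_sub_le _ _).trans
    (add_le_add (h1 0 le_rfl) (h1 B hB))) h2).trans ?_)
  have h5 : ‖w - 1‖ ≤ ‖w‖ + 1 := (norm_sub_le _ _).trans (by simp)
  calc _ ≤ 1 / ‖z‖ + 1 / ‖z‖ + (‖w‖ + 1 + ‖z'‖) / ‖z‖ * (1 - w.re)⁻¹ := by gcongr
    _ = _ := by field_simp; ring

/-- The improper integral of `osc` over the real line. -/
def oscInt (z z' w : ℂ) : ℂ := oscHalf z z' w + oscHalf z' z (-w)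

lemma intervalIntegral_osc_eq (z z' w : ℂ) (a b : ℝ) :
    ∫ x in a..b, osc z z' w x =
      (∫ x in (0 : ℝ)..b, osc z z' w x) + ∫ x in (0 : ℝ)..(-a), osc z' z (-w) x := by
  have h1 : ∫ x in (0 : ℝ)..(-a), osc z' z (-w) x = ∫ x in a..0, osc z z' w x := by
    simp only [← osc_neg]
    rw [intervalIntegral.integral_comp_neg (fun x => osc z z' w x)]
    simp
  rw [h1, add_comm]
  exact (intervalIntegral.integral_add_adjacent_intervals
    ((continuous_osc z z' w).intervalIntegrable _ _)
    ((continuous_osc z z' w).intervalIntegrable _ _)).symm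

/-- Reflection $x\mapsto-x$ exchanges $z,z'$ and negates $w$, so the negative half-line is another
positive one. The two half-lines impose $\mathrm{Re}\,w<1$ and $-\mathrm{Re}\,w<1$. -/
lemma hasImproperIntegral_osc {z z' : ℂ} (hz0 : z ≠ 0) (hz0' : z' ≠ 0) (hz : 0 ≤ z.re)
    (hz' : 0 ≤ z'.re) {w : ℂ} (hw : -1 < w.re) (hw' : w.re < 1) : HasImproperIntegral (osc z z' w) (oscInt z z' w) := by
  rw [HasImproperIntegral]
  rw [funext fun ab : ℝ × ℝ => intervalIntegral_osc_eq z z' w ab.1 ab.2]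
  refine Tendsto.add ((tendsto_oscHalf hz0 hz hz' hw').comp tendsto_snd) ?_
  exact (tendsto_oscHalf hz0' hz' hz (w := -w) (by simpa using by linarith)).comp
    (tendsto_neg_atBot_atTop.comp tendsto_fst)

lemma improperIntegral_eq {f : ℝ → ℂ} {L : ℂ} (h : HasImproperIntegral f L) :
    improperIntegral f = L := h.limUnder_eq

lemma improperIntegral_KIntegrand (p : ℕ) {r : ℝ} (hr : r ≠ 0) {g : Pt} (hg : g.1 ≠ 0)
    (hg' : g.2.1 ≠ 0) (s : ℤ) (ν μ : ℂ) (h : -1 < (ν - μ + s / p).re)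
    (h' : (ν - μ + s / p).re < 1) :
    improperIntegral (KIntegrand p r s ν μ g) = oscInt (negI (r * g.1)) (negI (r * g.2.1)) (ν - μ + s / p) := by
  rw [KIntegrand_eq_osc]
  exact improperIntegral_eq (hasImproperIntegral_osc (negI_ne_zero (mul_ne_zero hr hg))
    (negI_ne_zero (mul_ne_zero hr hg')) (negI_re _).ge (negI_re _).ge h h')

lemma hasImproperIntegral_KIntegrand (p : ℕ) {r : ℝ} (hr : r ≠ 0) {g : Pt} (hg : g.1 ≠ 0)
    (hg' : g.2.1 ≠ 0) (s : ℤ) (ν μ : ℂ) (h : -1 < (ν - μ + s / p).re)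
    (h' : (ν - μ + s / p).re < 1) :
    HasImproperIntegral (KIntegrand p r s ν μ g) (improperIntegral (KIntegrand p r s ν μ g)) := by
  rw [improperIntegral_KIntegrand p hr hg hg' s ν μ h h', KIntegrand_eq_osc]
  exact hasImproperIntegral_osc (negI_ne_zero (mul_ne_zero hr hg))
    (negI_ne_zero (mul_ne_zero hr hg')) (negI_re _).ge (negI_re _).ge h h'

lemma tendsto_intervalIntegral_osc {z z' : ℂ} (hz0 : z ≠ 0) (hz0' : z' ≠ 0) (hz : 0 ≤ z.re)
    (hz' : 0 ≤ z'.re) {w : ℂ} (hw : -1 < w.re) (hw' : w.re < 1) :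
    Tendsto (fun n : ℕ => ∫ x in (-n : ℝ)..n, osc z z' w x) atTop (𝓝 (oscInt z z' w)) :=
  (hasImproperIntegral_osc hz0 hz0' hz hz' hw hw').comp
    ((tendsto_neg_atTop_atBot.comp tendsto_natCast_atTop_atTop).prodMk tendsto_natCast_atTop_atTop)

/-- The truncated integrals grow at most linearly in `Im w`. -/
lemma exists_norm_integral_osc_le {z z' : ℂ} (hz0 : z ≠ 0) (hz0' : z' ≠ 0) (hz : 0 ≤ z.re)
    (hz' : 0 ≤ z'.re) {σ : ℝ} (hσ : -1 < σ)
    (hσ' : σ < 1) : ∃ C, ∀ w : ℂ, w.re = σ → ∀ n : ℕ,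
      ‖∫ x in (-n : ℝ)..n, osc z z' w x‖ ≤ C * (1 + ‖w‖) := by
  refine ⟨(2 + (1 + ‖z'‖) / (1 - σ)) / ‖z‖ + (2 + (1 + ‖z‖) / (1 + σ)) / ‖z'‖, ?_⟩
  rintro w rfl n
  have h1 : 0 < 1 - w.re := by linarith
  have h2 : 0 < 1 + w.re := by linarith
  have key : ∀ (a : ℝ) (b : ℂ), 0 < a →
      (2 + (‖w‖ + 1 + ‖b‖) / a) ≤ (2 + (1 + ‖b‖) / a) * (1 + ‖w‖) := by
    intro a b ha
    rw [div_eq_mul_inv, div_eq_mul_inv]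
    have h3 : 0 ≤ ‖w‖ * ‖b‖ * a⁻¹ := by positivity
    have h4 : 0 ≤ ‖w‖ := norm_nonneg w
    nlinarith
  rw [intervalIntegral_osc_eq]
  refine (norm_add_le _ _).trans ?_
  rw [add_mul]
  refine add_le_add ((norm_integral_osc_le hz0 hz hz' hσ' n.cast_nonneg).trans ?_) ?_
  · rw [div_mul_eq_mul_div]
    gcongr
    exact key _ _ h1
  · rw [neg_neg]
    refine (norm_integral_osc_le hz0' hz' hz (w := -w) (by simpa using by linarith) n.cast_nonneg).trans ?_
    rw [div_mul_eq_mul_div, norm_neg, Complex.neg_re, sub_neg_eq_add]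
    gcongr
    exact key _ _ h2

end

section

/-! ### The integral kernel -/

lemma continuous_osc_uncurry (z z' : ℂ) {w : ℝ → ℂ} (hw : Continuous w) :
    Continuous (fun y : ℝ × ℝ => osc z z' (w y.1) y.2) := by
  unfold osc
  fun_prop

lemma two_pi_mul_inv_two_pi_I_mul (X : ℂ) :
    2 * Real.pi * (1 / (2 * Real.pi * Complex.I) * (Complex.I * X)) = X := by
  have h1 : (Real.pi : ℂ) ≠ 0 := by exact_mod_cast Real.pi_ne_zero
  field_simp [Complex.I_ne_zero]

lemma integral_vertical_fourier {f : ℝ → ℂ} (hf : IsTest f) (c x : ℝ) :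
    ∫ τ : ℝ, fourier f (c + τ * Complex.I) * Complex.exp (-(c + τ * Complex.I) * x) =
      2 * Real.pi * f x := by
  have h := fourier_inversion hf c x
  rw [verticalIntegral] at h
  rw [← h, two_pi_mul_inv_two_pi_I_mul]

/-- Fubini for the truncated integrals. -/
lemma integral_truncated (p : ℕ) (r : ℝ) {f : ℝ → ℂ} (hf : IsTest f) (g : Pt) (s : ℤ) (ν : ℂ)
    (c : ℝ) (n : ℕ) :
    ∫ τ : ℝ, (∫ x in (-n : ℝ)..n, osc (negI (r * g.1)) (negI (r * g.2.1)) (ν - (c + τ * Complex.I) + s / p) x) *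
      (Complex.exp ((c + τ * Complex.I) * g.2.2) * fourier f (c + τ * Complex.I)) =
    2 * Real.pi * ∫ x in (-n : ℝ)..n,
      phase r g x * Complex.exp (s / p * x) * f (x - g.2.2) * Complex.exp (ν * x) := by
  set E : ℝ → ℂ := fun τ => Complex.exp ((c + τ * Complex.I) * g.2.2) *
    fourier f (c + τ * Complex.I) with hE
  have hEc : Continuous E := by
    have := continuous_fourier_vertical hf c
    rw [hE]
    fun_prop
  have hEi : Integrable E := by
    refine ((integrable_fourier_vertical hf c).norm.const_mul (Real.exp (c * g.2.2))).mono'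
      hEc.aestronglyMeasurable (Eventually.of_forall fun τ => ?_)
    rw [hE]
    beta_reduce
    rw [norm_mul, Complex.norm_exp]
    simp
  set w : ℝ → ℂ := fun τ => ν - (c + τ * Complex.I) + s / p with hw
  have hwc : Continuous w := by rw [hw]; fun_prop
  have hwre : ∀ τ, (w τ).re = ν.re - c + ((s : ℂ) / p).re := by intro τ; simp [hw]
  set σ := ν.re - c + ((s : ℂ) / p).re
  have hcont : Continuous (fun z : ℝ × ℝ => osc (negI (r * g.1)) (negI (r * g.2.1)) (w z.2) z.1 * E z.2) :=
    ((continuous_osc_uncurry _ _ hwc).comp continuous_swap).mul (hEc.comp continuous_snd)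
  have hswap := intervalIntegral_integral_swap (a := -n) (b := n) (μ := volume)
    (f := fun x τ => osc (negI (r * g.1)) (negI (r * g.2.1)) (w τ) x * E τ) ?_
  · simp only [intervalIntegral.integral_mul_const] at hswap
    rw [← hswap, ← intervalIntegral.integral_const_mul]
    refine intervalIntegral.integral_congr fun x _ => ?_
    have h1 : ∀ τ : ℝ, osc (negI (r * g.1)) (negI (r * g.2.1)) (w τ) x * E τ =
        phase r g x * Complex.exp (s / p * x) * Complex.exp (ν * x) *
        (fourier f (c + τ * Complex.I) *
          Complex.exp (-(c + τ * Complex.I) * (x - g.2.2 : ℝ))) := by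
      intro τ
      have h2 : osc (negI (r * g.1)) (negI (r * g.2.1)) (w τ) x * Complex.exp ((c + τ * Complex.I) * g.2.2) =
          phase r g x * Complex.exp (s / p * x) * Complex.exp (ν * x) *
          Complex.exp (-(c + τ * Complex.I) * (x - g.2.2 : ℝ)) := by
        rw [osc, negI, negI, phase, ← Complex.exp_add, ← Complex.exp_add, ← Complex.exp_add, ← Complex.exp_add]
        congr 1
        rw [hw]
        push_cast
        ring
      rw [hE]
      linear_combination fourier f (c + τ * Complex.I) * h2
    simp only [h1]
    rw [integral_const_mul, integral_vertical_fourier hf]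
    ring
  · have hfin : IsFiniteMeasure (volume.restrict (Set.uIoc (-n : ℝ) n)) := by
      rw [Set.uIoc_of_le (by simp)]
      infer_instance
    -- On $|x|\le n$ the oscillating factor is at most $e^{|\sigma|n}$, where $\sigma$ is the
    -- constant real part of $w$; the rest is integrable in $\tau$.
    have h3 : Integrable (fun z : ℝ × ℝ => Real.exp (|σ| * n) * ‖E z.2‖)
        ((volume.restrict (Set.uIoc (-n : ℝ) n)).prod volume) :=
      (integrable_const (μ := volume.restrict (Set.uIoc (-n : ℝ) n))
        (Real.exp (|σ| * n))).mul_prod hEi.norm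
    refine h3.mono' hcont.aestronglyMeasurable ?_
    have h4 : ∀ᵐ z : ℝ × ℝ ∂(volume.restrict (Set.uIoc (-n : ℝ) n)).prod volume,
        z.1 ∈ Set.uIoc (-n : ℝ) n :=
      Measure.quasiMeasurePreserving_fst.ae (ae_restrict_mem measurableSet_uIoc)
    filter_upwards [h4] with z hz
    rw [Function.uncurry, norm_mul]
    refine mul_le_mul_of_nonneg_right ((norm_osc_le (negI_re _).ge (negI_re _).ge _ _).trans
      (Real.exp_le_exp.2 ?_)) (norm_nonneg _)
    rw [hwre]
    refine (le_abs_self _).trans ?_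
    rw [abs_mul]
    gcongr
    rw [Set.uIoc_of_le (by simp)] at hz
    exact abs_le.2 ⟨hz.1.le, hz.2⟩

/-- For imaginary $z,z'$ the modulus of the $x$-integrand is only $e^{\sigma x}$, so Fubini fails on
the whole line. It is applied on $[-n,n]$. The $\tau$-side converges dominatedly, by linear growth
against rapid decay, and the $x$-side because $f$ is integrable against all factors. -/
lemma QrInt_eq_verticalIntegral (p : ℕ) {r : ℝ} (hr : r ≠ 0) {f : ℝ → ℂ} (hf : IsTest f) {g : Pt}
    (hg : g.1 ≠ 0) (hg' : g.2.1 ≠ 0) {s : ℤ} {ν : ℂ} {c : ℝ}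
    (h1 : -1 < ν.re - c + s / p) (h2 : ν.re - c + s / p < 1) :
    Integrable (fun τ : ℝ => Kfun p r s ν (c + τ * Complex.I) g * fourier f (c + τ * Complex.I)) ∧
    QrInt p r f ν g s = verticalIntegral c (fun μ => Kfun p r s ν μ g * fourier f μ) := by
  set w : ℝ → ℂ := fun τ => ν - (c + τ * Complex.I) + s / p with hw
  have hwc : Continuous w := by rw [hw]; fun_prop
  have hsp : ((s : ℂ) / p).re = s / p := by
    rw [show (s : ℂ) / p = ((s / p : ℝ) : ℂ) by push_cast; rfl, Complex.ofReal_re]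
  have hwre : ∀ τ, (w τ).re = ν.re - c + s / p := by intro τ; rw [← hsp]; simp [hw]
  set σ : ℝ := ν.re - c + s / p
  have hC := negI_ne_zero (mul_ne_zero hr hg)
  have hD := negI_ne_zero (mul_ne_zero hr hg')
  obtain ⟨C, hCb⟩ := exists_norm_integral_osc_le hC hD (negI_re _).ge (negI_re _).ge h1 h2
  set A : ℕ → ℝ → ℂ := fun n τ => ∫ x in (-n : ℝ)..n, osc (negI (r * g.1)) (negI (r * g.2.1)) (w τ) x with hA
  set E : ℝ → ℂ := fun τ => Complex.exp ((c + τ * Complex.I) * g.2.2) *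
    fourier f (c + τ * Complex.I) with hE
  have hEc : Continuous E := by
    have := continuous_fourier_vertical hf c
    rw [hE]
    fun_prop
  have hEn : ∀ τ, ‖E τ‖ = Real.exp (c * g.2.2) * ‖fourier f (c + τ * Complex.I)‖ := by
    intro τ
    rw [hE]
    beta_reduce
    rw [norm_mul, Complex.norm_exp]
    simp
  have hAc : ∀ n, Continuous (A n) := fun n =>
    intervalIntegral.continuous_parametric_intervalIntegral_of_continuous'
      (continuous_osc_uncurry _ _ hwc) _ _
  have hlim : ∀ τ, Tendsto (fun n => A n τ * E τ) atTop
      (𝓝 (oscInt (negI (r * g.1)) (negI (r * g.2.1)) (w τ) * E τ)) := fun τ =>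
    (tendsto_intervalIntegral_osc hC hD (negI_re _).ge (negI_re _).ge (by rwa [hwre]) (by rwa [hwre])).mul_const _
  set bound : ℝ → ℝ := fun τ => |C| * Real.exp (c * g.2.2) *
    ((1 + ‖ν - c + s / p‖) * (|τ| ^ 0 * ‖fourier f (c + τ * Complex.I)‖) +
      |τ| ^ 1 * ‖fourier f (c + τ * Complex.I)‖) with hbound
  have hbi : Integrable bound :=
    (((integrable_pow_mul_fourier_vertical hf c 0).const_mul _).add
      (integrable_pow_mul_fourier_vertical hf c 1)).const_mul _
  have hb : ∀ n τ, ‖A n τ * E τ‖ ≤ bound τ := by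
    intro n τ
    have h3 : ‖w τ‖ ≤ ‖ν - c + s / p‖ + |τ| := by
      rw [show w τ = (ν - c + s / p) - τ * Complex.I by rw [hw]; ring]
      refine (norm_sub_le _ _).trans ?_
      simp
    rw [norm_mul, hEn]
    calc _ ≤ (|C| * (1 + (‖ν - c + s / p‖ + |τ|))) *
        (Real.exp (c * g.2.2) * ‖fourier f (c + τ * Complex.I)‖) := by
          gcongr
          refine (hCb (w τ) (hwre τ) n).trans ?_
          gcongr
          exact le_abs_self C
      _ = bound τ := by rw [hbound]; ring
  have hconv := tendsto_integral_of_dominated_convergence bound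
    (fun n => ((hAc n).mul hEc).aestronglyMeasurable) hbi
    (fun n => Eventually.of_forall (hb n)) (Eventually.of_forall hlim)
  have hint : Integrable (fun τ => oscInt (negI (r * g.1)) (negI (r * g.2.1)) (w τ) * E τ) :=
    hbi.mono' (aestronglyMeasurable_of_tendsto_ae atTop
      (fun n => ((hAc n).mul hEc).aestronglyMeasurable) (Eventually.of_forall hlim))
      (Eventually.of_forall fun τ => le_of_tendsto (hlim τ).norm
        (Eventually.of_forall fun n => hb n τ))
  have hK : (fun τ : ℝ => Kfun p r s ν (c + τ * Complex.I) g * fourier f (c + τ * Complex.I)) =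
      fun τ => 1 / (2 * Real.pi * Complex.I) * (oscInt (negI (r * g.1)) (negI (r * g.2.1)) (w τ) * E τ) := by
    funext τ
    rw [Kfun, improperIntegral_KIntegrand p hr hg hg' s ν _ (by rw [hwre τ]; exact h1)
      (by rw [hwre τ]; exact h2)]
    ring
  refine ⟨?_, ?_⟩
  · rw [hK]
    exact hint.const_mul _
  · have hsupp : Integrable fun x =>
        phase r g x * Complex.exp (s / p * x) * f (x - g.2.2) * Complex.exp (ν * x) :=
      (((hf.comp_sub g.2.2).mul_left ((contDiff_phase r g).mul
        (contDiff_cexp_mul _))).mul_right (contDiff_cexp_mul ν)).integrable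
    have h5 := (intervalIntegral_tendsto_integral hsupp
      (tendsto_neg_atTop_atBot.comp tendsto_natCast_atTop_atTop)
      (tendsto_natCast_atTop_atTop (R := ℝ))).const_mul (2 * Real.pi : ℂ)
    have h6 := hconv.congr fun n => integral_truncated p r hf g s ν c n
    have h7 := tendsto_nhds_unique h6 h5
    rw [verticalIntegral, hK, integral_const_mul, h7, ← QrInt]
    nth_rewrite 1 [← two_pi_mul_inv_two_pi_I_mul (QrInt p r f ν g s)]
    ring

end

section

/-! ### The kernel in terms of monomials -/

section

variable {p : ℕ} [NeZero p] {q h : ℂ}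

/-- The monomial of bidegree `(n, m)` occurring in `Q_r(f t^k)`. -/
def kernelMono (p : ℕ) (q h : ℂ) (r : ℝ) (k : ZMod p) (n m : ℕ) : QAlg p q :=
  (etaCoeff p q h r n m * qPow p q (-(n + m) * k)) •
    (etaP p q ^ n * etaM p q ^ m * deltaPow p q k)

lemma xi_pow (m : ℕ) : xi p q ^ m = q ^ (m ^ 2) • (etaP p q ^ m * etaM p q ^ m) := by
  induction m with
  | zero => simp
  | succ m ih =>
    have e : etaP p q ^ m * etaM p q ^ m * (etaP p q * etaM p q) =
        q ^ (2 * m) • (etaP p q ^ (m + 1) * etaM p q ^ (m + 1)) := by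
      have := etaM_pow_mul_etaP_pow (p := p) (q := q) m 1
      rw [pow_one, one_mul] at this
      rw [mul_assoc, ← mul_assoc (etaM p q ^ m), this, smul_mul_assoc, mul_smul_comm, pow_succ,
        pow_succ]
      simp only [mul_assoc]
    rw [pow_succ, ih, xi, smul_mul_assoc, mul_smul_comm, smul_smul, e, smul_smul]
    congr 1
    ring

/-- The exponent $(p+1)/2$ is the inverse of $2$ modulo $p$. Moving the left factor through the
monomial therefore costs $q^{-(n+m)k}$ instead of $q^{-2(n+m)k}$, and the two halves merge into
$\delta^k$. -/
lemma deltaHalfPow_mul_mul (hp : Odd p) (hq : q ^ p = 1) (k : ZMod p) (n m : ℕ) :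
    deltaHalfPow p q k.val * (etaP p q ^ n * etaM p q ^ m) * deltaHalfPow p q k.val =
      qPow p q (-(n + m) * k) • (etaP p q ^ n * etaM p q ^ m * deltaPow p q k) := by
  obtain ⟨a, ha⟩ := hp
  have hc : ((((p + 1) / 2 : ℕ) : ZMod p)) * 2 = 1 := by
    have h1 : (p + 1) / 2 * 2 = p + 1 := by omega
    have h2 : (((p + 1) / 2 * 2 : ℕ) : ZMod p) = ((p + 1 : ℕ) : ZMod p) := by rw [h1]
    push_cast at h2
    rw [h2, ZMod.natCast_self, zero_add]
  set c : ZMod p := (((p + 1) / 2 : ℕ) : ZMod p)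
  have h1 : deltaHalfPow p q k.val = deltaPow p q (c * k) := by
    rw [deltaHalfPow, ← deltaPow_natCast]
    push_cast
    rw [ZMod.natCast_zmod_val]
  rw [h1, ← mul_assoc, deltaPow_mul_etaP_pow hq, smul_mul_assoc, mul_assoc (etaP p q ^ n),
    deltaPow_mul_etaM_pow hq, mul_smul_comm, smul_smul, smul_mul_assoc,
    ← mul_assoc (etaP p q ^ n), mul_assoc _ (deltaPow p q (c * k)), ← deltaPow_add, ← qPow_add hq]
  congr 2
  · linear_combination (-(n + m) * k) * hc
  · congr 1
    linear_combination k * hc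

lemma kernel_etaP (hp : Odd p) (hq : q ^ p = 1) (r : ℝ) (k : ZMod p) (s : ℕ) :
    deltaHalfPow p q k.val * ((h⁻¹ • etaP p q) ^ s * omega p q r s (xi p q)) *
      deltaHalfPow p q k.val = ∑ m ∈ Finset.range (p - s), kernelMono p q h r k (m + s) m := by
  rw [omega, Finset.mul_sum, Finset.mul_sum, Finset.sum_mul]
  refine Finset.sum_congr rfl fun m _ => ?_
  rw [smul_pow, smul_pow, xi_pow]
  simp only [smul_mul_assoc, mul_smul_comm, smul_smul]
  rw [← mul_assoc (etaP p q ^ s), ← pow_add, add_comm s m, deltaHalfPow_mul_mul hp hq, smul_smul,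
    kernelMono, etaCoeff]
  congr 1
  rw [show ((m : ℤ) - ((m + s : ℕ) : ℤ)) = -(s : ℤ) by push_cast; ring, zpow_neg, zpow_natCast,
    inv_pow, div_eq_mul_inv, mul_inv]
  push_cast
  ring

lemma kernel_etaM (hp : Odd p) (hq : q ^ p = 1) (r : ℝ) (k : ZMod p) (s : ℕ) :
    deltaHalfPow p q k.val * (omega p q r s (xi p q) * (h • etaM p q) ^ s) *
      deltaHalfPow p q k.val = ∑ m ∈ Finset.range (p - s), kernelMono p q h r k m (m + s) := by
  rw [omega, Finset.sum_mul, Finset.mul_sum, Finset.sum_mul]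
  refine Finset.sum_congr rfl fun m _ => ?_
  rw [smul_pow, smul_pow, xi_pow]
  simp only [smul_mul_assoc, mul_smul_comm, smul_smul]
  rw [mul_assoc (etaP p q ^ m), ← pow_add, deltaHalfPow_mul_mul hp hq, smul_smul,
    kernelMono, etaCoeff]
  congr 1
  rw [show (((m + s : ℕ) : ℤ) - (m : ℤ)) = (s : ℤ) by push_cast; ring, zpow_natCast,
    div_eq_mul_inv, mul_inv]
  push_cast
  ring

/-- In terms of the residue of $l-k$ in $[0,p)$ the cases $k\le l$ and $k>l$ become a single
formula. -/
lemma kernel_eq (hp : Odd p) (hq : q ^ p = 1) (r : ℝ) (k l : ZMod p) (ν μ : ℂ) (g : Pt) :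
    kernel p q h r k.val l.val ν μ g =
      Kfun p r (l - k).val ν μ g •
        ∑ m ∈ Finset.range (p - (l - k).val), kernelMono p q h r k (m + (l - k).val) m +
      Kfun p r ((l - k).val - p) ν μ g •
        ∑ m ∈ Finset.range (l - k).val, kernelMono p q h r k m (m + (p - (l - k).val)) := by
  have hk := k.val_lt
  have hl := l.val_lt
  rw [kernel]
  split_ifs with hkl
  · have h1 : (l - k).val = l.val - k.val := ZMod.val_sub hkl
    rw [kernel_etaP hp hq, kernel_etaM hp hq, h1, Nat.cast_sub hkl,
      show p + k.val - l.val = p - (l.val - k.val) by omega,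
      show p - (p - (l.val - k.val)) = l.val - k.val by omega]
  · have h1 : (l - k).val = p + l.val - k.val := by
      have h2 : (l - k) = ((p + l.val - k.val : ℕ) : ZMod p) := by
        rw [Nat.cast_sub (by omega)]
        simp
      rw [h2, ZMod.val_natCast, Nat.mod_eq_of_lt (by omega)]
    rw [kernel_etaP hp hq, kernel_etaM hp hq, h1, Nat.cast_sub (by omega),
      show p - (p + l.val - k.val) = k.val - l.val by omega,
      show p - (k.val - l.val) = p + l.val - k.val by omega]
    push_cast
    rw [show (p : ℤ) + l.val - k.val - p = l.val - k.val by ring]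

/-- For each $m$ there is exactly one admissible $n$, namely $m+x$ reduced modulo $p$; the second
sum collects the $m$ for which the reduction wraps around. -/
lemma sum_range_congruent {M : Type*} [AddCommMonoid M] (G : ℕ → ℕ → M) (x : ZMod p) :
    ∑ n ∈ Finset.range p, ∑ m ∈ Finset.range p, (if (n : ZMod p) = m + x then G n m else 0) =
      ∑ m ∈ Finset.range (p - x.val), G (m + x.val) m +
      ∑ m ∈ Finset.range x.val, G m (m + (p - x.val)) := by
  have hx := x.val_lt
  have hpos := Nat.pos_of_ne_zero (NeZero.ne p)
  rw [Finset.sum_comm]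
  have h1 : ∀ m : ℕ, ∑ n ∈ Finset.range p, (if (n : ZMod p) = m + x then G n m else 0) =
      G ((m + x.val) % p) m := by
    intro m
    rw [Finset.sum_eq_single ((m + x.val) % p)]
    · rw [if_pos]
      simp
    · intro n hn hne
      rw [if_neg]
      intro heq
      apply hne
      have h2 : (n : ZMod p) = ((m + x.val : ℕ) : ZMod p) := by rw [heq]; simp
      rw [ZMod.natCast_eq_natCast_iff'] at h2
      rwa [Nat.mod_eq_of_lt (Finset.mem_range.1 hn)] at h2
    · intro hn
      exact absurd (Finset.mem_range.2 (Nat.mod_lt _ hpos)) hn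
  simp only [h1]
  rw [show Finset.range p = Finset.range ((p - x.val) + x.val) by rw [Nat.sub_add_cancel hx.le],
    Finset.sum_range_add]
  congr 1
  · refine Finset.sum_congr rfl fun m hm => ?_
    rw [Nat.mod_eq_of_lt]
    have := Finset.mem_range.1 hm
    omega
  · refine Finset.sum_congr rfl fun m hm => ?_
    have := Finset.mem_range.1 hm
    rw [show p - x.val + m + x.val = m + p by omega, Nat.add_mod_right,
      Nat.mod_eq_of_lt (by omega), add_comm (p - x.val)]

/-- The term with $\eta_+^n\eta_-^m$ sends $t^k$ to $t^{k+n-m}$, so the coefficient of $t^l$ sees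
only $n-m\equiv l-k$. As $|n-m|<p$, this leaves two values of $n-m$. -/
lemma sum_Qr_single (hq : IsPrimitiveRoot q p) (hh : h ^ 2 = q) (hhp : h ^ p = -1) (r : ℝ)
    {f : ℝ → ℂ} (hf : IsTest f) (g : Pt) (k l : ZMod p) (ν : ℂ) :
    ∑ b : Idx p, Qr p q h r (Pi.single k (fourier f)) g b l ν • basisElt p q b =
      QrInt p r f ν g (l - k).val •
        ∑ m ∈ Finset.range (p - (l - k).val), kernelMono p q h r k (m + (l - k).val) m +
      QrInt p r f ν g ((l - k).val - p) •
        ∑ m ∈ Finset.range (l - k).val, kernelMono p q h r k m (m + (p - (l - k).val)) := by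
  have hq1 := hq.pow_eq_one
  have hh0 : h ≠ 0 := by rintro rfl; simp [NeZero.ne p] at hhp
  have hx := (l - k).val_lt
  have hsingle : (Pi.single k (fourier f) : ZMod p → ℂ → ℂ) =
      fun j => fourier ((Pi.single k f : Vec p) j) := by
    funext j
    rcases eq_or_ne j k with rfl | hj
    · simp
    · rw [Pi.single_eq_of_ne hj, Pi.single_eq_of_ne hj]
      funext ν
      simp [fourier]
  have htest : ∀ j, IsTest ((Pi.single k f : Vec p) j) := by
    intro j
    rcases eq_or_ne j k with rfl | hj
    · simpa using hf
    · rw [Pi.single_eq_of_ne hj]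
      exact isTest_zero
  have h0 : ∀ s, QrInt p r (0 : ℝ → ℂ) ν g s = 0 := by intro s; simp [QrInt]
  have h1 : ∀ b : Idx p, Qr p q h r (Pi.single k (fourier f)) g b l ν • basisElt p q b =
      if ((b.1 : ℕ) : ZMod p) = (b.2.1 : ℕ) + (l - k) then
        (QrInt p r f ν g (((b.1 : ℕ) : ℤ) - (b.2.1 : ℕ)) * (etaCoeff p q h r b.1 b.2.1 *
          qPow p q (-((b.1 : ℕ) + (b.2.1 : ℕ)) * k))) •
        (etaP p q ^ (b.1 : ℕ) * etaM p q ^ (b.2.1 : ℕ) * (qPow p q (b.2.2 * k) • zeta p q b.2.2))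
      else 0 := by
    intro b
    rw [hsingle, Qr_fourier hq1 r htest]
    beta_reduce
    rw [fourier_Tr_eq]
    split_ifs with hb
    · have h2 : l - ((b.1 : ℕ) : ZMod p) + ((b.2.1 : ℕ) : ZMod p) = k := by rw [hb]; ring
      rw [h2, Pi.single_eq_same, QrCoeff_eq hh hh0, basisElt, mul_smul_comm, smul_smul,
        show (b.2.2 - ((b.1 : ℕ) : ZMod p) - ((b.2.1 : ℕ) : ZMod p)) * k =
          -((b.1 : ℕ) + (b.2.1 : ℕ)) * k + b.2.2 * k by ring, qPow_add hq1]
      congr 1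
      ring
    · have h2 : l - ((b.1 : ℕ) : ZMod p) + ((b.2.1 : ℕ) : ZMod p) ≠ k := by
        intro h3
        apply hb
        rw [← h3]
        ring
      rw [Pi.single_eq_of_ne h2, h0, mul_zero, zero_smul]
  simp only [h1]
  rw [sum_Idx (G := fun n m κ => if (n : ZMod p) = m + (l - k) then
        (QrInt p r f ν g ((n : ℤ) - m) * (etaCoeff p q h r n m *
          qPow p q (-(n + m) * k))) •
        (etaP p q ^ n * etaM p q ^ m * (qPow p q (κ * k) • zeta p q κ))
      else 0)]
  have h4 : ∀ n m : ℕ, ∑ κ : ZMod p, (if (n : ZMod p) = m + (l - k) then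
        (QrInt p r f ν g ((n : ℤ) - m) * (etaCoeff p q h r n m *
          qPow p q (-(n + m) * k))) •
        (etaP p q ^ n * etaM p q ^ m * (qPow p q (κ * k) • zeta p q κ))
      else 0) = if (n : ZMod p) = m + (l - k) then
        QrInt p r f ν g ((n : ℤ) - m) • kernelMono p q h r k n m else 0 := by
    intro n m
    split_ifs
    · rw [← Finset.smul_sum, ← Finset.mul_sum, sum_qPow_smul_zeta hq, kernelMono, smul_smul]
    · simp
  simp only [h4]
  rw [sum_range_congruent (fun n m => QrInt p r f ν g ((n : ℤ) - m) • kernelMono p q h r k n m),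
    Finset.smul_sum, Finset.smul_sum]
  congr 1
  · refine Finset.sum_congr rfl fun m _ => ?_
    congr 2
    push_cast
    ring
  · refine Finset.sum_congr rfl fun m _ => ?_
    congr 2
    rw [Nat.cast_add, Nat.cast_sub hx.le]
    ring

/-- `Q_r` is the integral operator with the given kernel. -/
lemma Qr_eq_kernel (hp : Odd p) (hq : IsPrimitiveRoot q p) (hh : h ^ 2 = q) (hhp : h ^ p = -1)
    {r : ℝ} (hr : r ≠ 0) {g : Pt} (hg : g.1 ≠ 0) (hg' : g.2.1 ≠ 0) {F : ℂ → ℂ} (hF : F ∈ PW)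
    (k l : ZMod p) (ν : ℂ) (c : ℝ) (hc : |ν.re - c| < 1 / p) (χ : QAlg p q →ₗ[ℂ] ℂ) :
    Integrable (fun τ : ℝ =>
        χ (kernel p q h r k.val l.val ν (c + τ * Complex.I) g) * F (c + τ * Complex.I)) ∧
      χ (∑ b : Idx p, Qr p q h r (Pi.single k F) g b l ν • basisElt p q b) =
        verticalIntegral c (fun μ => χ (kernel p q h r k.val l.val ν μ g) * F μ) := by
  obtain ⟨f, hf, rfl⟩ := mem_PW_iff.1 hF
  have hx := (l - k).val_lt
  set s := (l - k).val with hs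
  have hppos : (0 : ℝ) < p := by exact_mod_cast Nat.pos_of_ne_zero (NeZero.ne p)
  have hsp : (s : ℝ) ≤ p - 1 := by
    have : s + 1 ≤ p := hx
    have : ((s + 1 : ℕ) : ℝ) ≤ p := by exact_mod_cast this
    push_cast at this
    linarith
  have hc' := abs_lt.1 hc
  have hinv : (1 : ℝ) / p * p = 1 := by field_simp
  -- An index of modulus at most $p-1$ contributes at most $1-1/p$ to the real part, and
  -- $|\mathrm{Re}\,\nu-c|<1/p$ fills the rest of the strip.
  have bound : ∀ t : ℤ, -(p : ℝ) + 1 ≤ t → (t : ℝ) ≤ p - 1 →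
      -1 < ν.re - c + t / p ∧ ν.re - c + t / p < 1 := by
    intro t h1 h2
    have h3 : -1 + 1 / (p : ℝ) ≤ t / p := by
      rw [le_div_iff₀ hppos]; linarith
    have h4 : (t : ℝ) / p ≤ 1 - 1 / p := by
      rw [div_le_iff₀ hppos]; linarith
    constructor <;> linarith [hc'.1, hc'.2]
  set A := ∑ m ∈ Finset.range (p - s), kernelMono p q h r k (m + s) m
  set B := ∑ m ∈ Finset.range s, kernelMono p q h r k m (m + (p - s)) with hB
  obtain ⟨hA1, hA2⟩ : _ := QrInt_eq_verticalIntegral p hr hf hg hg' (s := (s : ℤ))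
    (bound s (by push_cast; linarith [(Nat.cast_nonneg s : (0 : ℝ) ≤ s)]) (by exact_mod_cast hsp)).1
    (bound s (by push_cast; linarith [(Nat.cast_nonneg s : (0 : ℝ) ≤ s)]) (by exact_mod_cast hsp)).2
  have hBB : Integrable (fun τ : ℝ => Kfun p r (s - p) ν (c + τ * Complex.I) g *
        fourier f (c + τ * Complex.I) * χ B) ∧
      QrInt p r f ν g (s - p) * χ B =
        verticalIntegral c (fun μ => Kfun p r (s - p) ν μ g * fourier f μ * χ B) := by
    -- For $k=l$ the second index is $-p$, outside the range of `bound`; its monomial sum is empty,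
    -- so nothing has to converge.
    rcases Nat.eq_zero_or_pos s with h0 | h0
    · have : B = 0 := by rw [hB, h0]; simp
      simp [this, verticalIntegral]
    · have h1 : (1 : ℝ) ≤ s := by exact_mod_cast h0
      have h2 := bound (s - p) (by push_cast; linarith) (by push_cast; linarith)
      obtain ⟨h3, h4⟩ := QrInt_eq_verticalIntegral p hr hf hg hg' h2.1 h2.2
      refine ⟨h3.mul_const _, ?_⟩
      rw [h4, verticalIntegral, verticalIntegral, integral_mul_const, mul_assoc]
  have hker : ∀ μ, χ (kernel p q h r k.val l.val ν μ g) * fourier f μ =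
      Kfun p r s ν μ g * fourier f μ * χ A + Kfun p r (s - p) ν μ g * fourier f μ * χ B := by
    intro μ
    rw [kernel_eq hp hq.pow_eq_one, map_add, map_smul, map_smul, smul_eq_mul, smul_eq_mul]
    ring
  simp only [hker]
  refine ⟨(hA1.mul_const _).add hBB.1, ?_⟩
  rw [sum_Qr_single hq hh hhp r hf, map_add, map_smul, map_smul, smul_eq_mul, smul_eq_mul, hBB.2,
    hA2, verticalIntegral, verticalIntegral, verticalIntegral,
    integral_add (hA1.mul_const _) hBB.1, integral_mul_const (χ A), mul_add, mul_assoc]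

end

end

section

/-! ### Incomplete gamma integrals -/

/-- For $x\ge0$ the term $\mathrm{Re}(z)\,e^x\ge\mathrm{Re}(z)\,x^2/2$ beats any linear exponent;
completing the square gives the constant. -/
lemma norm_osc_le_exp_neg {z z' : ℂ} (hz : 0 < z.re) (hz' : 0 ≤ z'.re) (w : ℂ) {x : ℝ}
    (hx : 0 ≤ x) :
    ‖osc z z' w x‖ ≤ Real.exp ((w.re + 1) ^ 2 / (2 * z.re)) * Real.exp (-1 * x) := by
  rw [norm_osc, ← Real.exp_add, Real.exp_le_exp]
  have h1 := Real.quadratic_le_exp_of_nonneg hx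
  have h2 : 0 ≤ z'.re * Real.exp (-x) := by positivity
  have h3 : z.re * (x ^ 2 / 2) ≤ z.re * Real.exp x := by
    gcongr
    linarith
  have h4 : (w.re + 1) * x ≤ z.re * (x ^ 2 / 2) + (w.re + 1) ^ 2 / (2 * z.re) := by
    have h5 : z.re * (x ^ 2 / 2) + (w.re + 1) ^ 2 / (2 * z.re) - (w.re + 1) * x =
        (z.re * x - (w.re + 1)) ^ 2 / (2 * z.re) := by
      field_simp
      ring
    have h6 : 0 ≤ (z.re * x - (w.re + 1)) ^ 2 / (2 * z.re) := by positivity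
    linarith
  linarith

lemma integrableOn_osc {z z' : ℂ} (hz : 0 < z.re) (hz' : 0 ≤ z'.re) (w : ℂ) :
    IntegrableOn (osc z z' w) (Set.Ioi 0) := by
  refine Integrable.mono' ((integrableOn_exp_mul_Ioi (a := -1) (by norm_num) 0).const_mul
    (Real.exp ((w.re + 1) ^ 2 / (2 * z.re)))) (continuous_osc z z' w).aestronglyMeasurable ?_
  filter_upwards [ae_restrict_mem measurableSet_Ioi] with x hx
  exact norm_osc_le_exp_neg hz hz' w (le_of_lt hx)

lemma tendsto_osc_atTop {z z' : ℂ} (hz : 0 < z.re) (hz' : 0 ≤ z'.re) (w : ℂ) :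
    Tendsto (osc z z' w) atTop (𝓝 0) := by
  have h1 : Tendsto (fun x : ℝ => Real.exp ((w.re + 1) ^ 2 / (2 * z.re)) * Real.exp (-1 * x))
      atTop (𝓝 0) := by
    rw [← mul_zero (Real.exp ((w.re + 1) ^ 2 / (2 * z.re)))]
    exact (Real.tendsto_exp_atBot.comp
      (Tendsto.const_mul_atTop_of_neg (by norm_num) tendsto_id)).const_mul _
  refine squeeze_zero_norm' ?_ h1
  filter_upwards [eventually_ge_atTop 0] with x hx
  exact norm_osc_le_exp_neg hz hz' w hx

lemma oscHalf_eq_integral {z z' : ℂ} (hz : 0 < z.re) (hz' : 0 ≤ z'.re) {w : ℂ} (hw : w.re < 1) :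
    oscHalf z z' w = ∫ x in Set.Ioi (0 : ℝ), osc z z' w x := by
  have hz0 : z ≠ 0 := by rintro rfl; simp at hz
  exact tendsto_nhds_unique (tendsto_oscHalf hz0 hz.le hz' hw)
    (intervalIntegral_tendsto_integral_Ioi 0 (integrableOn_osc hz hz' w) tendsto_id)

lemma integrable_osc_zero {z s : ℂ} (hz : 0 < z.re) (hs : 0 < s.re) : Integrable (osc z 0 s) := by
  rw [← integrableOn_univ, ← Set.Iic_union_Ioi (a := (0 : ℝ))]
  refine IntegrableOn.union ?_ (integrableOn_osc hz (by simp) s)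
  refine Integrable.mono' (integrableOn_exp_mul_Iic hs 0)
    (continuous_osc z 0 s).aestronglyMeasurable (Eventually.of_forall fun x => ?_)
  exact norm_osc_le hz.le (by simp) s x

lemma mul_integral_osc_zero {z s : ℂ} (hz : 0 < z.re) (hs : 0 < s.re) :
    z * ∫ x, osc z 0 (s + 1) x = s * ∫ x, osc z 0 s x := by
  have hs' : 0 < (s + 1).re := by simp; linarith
  have e : ∀ x, osc z 0 s x * (-(z * Real.exp x - 0 * Real.exp (-x)) + s) =
      s * osc z 0 s x - z * osc z 0 (s + 1) x := by
    intro x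
    have : osc z 0 (s + 1) x = osc z 0 s x * Real.exp x := by
      rw [osc, osc, Complex.ofReal_exp x, ← Complex.exp_add]
      congr 1
      ring
    rw [this]
    ring
  have h1 := integral_of_hasDerivAt_of_tendsto (fun x => hasDerivAt_osc z 0 s x) ?_ (m := 0) (n := 0) ?_
    (tendsto_osc_atTop hz (by simp) s)
  · simp only [e] at h1
    rw [integral_sub ((integrable_osc_zero hz hs).const_mul _)
      ((integrable_osc_zero hz hs').const_mul _), integral_const_mul, integral_const_mul,
      sub_zero, sub_eq_zero] at h1
    exact h1.symm
  · simp only [e]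
    exact ((integrable_osc_zero hz hs).const_mul _).sub ((integrable_osc_zero hz hs').const_mul _)
  · refine squeeze_zero_norm (norm_osc_le hz.le (by simp) s) ?_
    exact Real.tendsto_exp_atBot.comp (tendsto_id.const_mul_atBot hs)

lemma hasDerivAt_integral_osc_zero {z s : ℂ} (hz : 0 < z.re) (hs : 0 < s.re) :
    HasDerivAt (fun z => ∫ x, osc z 0 s x) (-∫ x, osc z 0 (s + 1) x) z := by
  have hs' : 0 < (s + 1).re := by simp; linarith
  have hz2 : 0 < (((z.re / 2 : ℝ) : ℂ)).re := by simpa using hz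
  rw [← integral_neg]
  refine (hasDerivAt_integral_of_dominated_loc_of_deriv_le (μ := volume)
    (F := fun z x => osc z 0 s x) (F' := fun z x => -osc z 0 (s + 1) x)
    (bound := fun x => ‖osc ((z.re / 2 : ℝ) : ℂ) 0 (s + 1) x‖)
    (Metric.ball_mem_nhds z (half_pos hz)) ?_ ?_ ?_ ?_ ?_ ?_).2
  · exact Eventually.of_forall fun w => (continuous_osc w 0 s).aestronglyMeasurable
  · exact integrable_osc_zero hz hs
  · exact (continuous_osc z 0 (s + 1)).neg.aestronglyMeasurable
  · refine Eventually.of_forall fun x w hw => ?_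
    rw [norm_neg, norm_osc, norm_osc, Real.exp_le_exp, Complex.ofReal_re]
    have h1 : z.re / 2 ≤ w.re := by
      have h2 := Complex.abs_re_le_norm (w - z)
      rw [Metric.mem_ball, Complex.dist_eq] at hw
      rw [Complex.sub_re] at h2
      have := (abs_le.1 (h2.trans hw.le)).1
      linarith
    gcongr
  · exact (integrable_osc_zero hz2 hs').norm
  · refine Eventually.of_forall fun x w _ => ?_
    have h1 : HasDerivAt (fun w : ℂ => -(w * Real.exp x + 0 * Real.exp (-x)) + s * x)
        (-(1 * Real.exp x)) w :=
      ((((hasDerivAt_id w).mul_const _).add_const _).neg).add_const _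
    refine HasDerivAt.congr_deriv h1.cexp ?_
    rw [one_mul, mul_neg, osc, Complex.ofReal_exp x, ← Complex.exp_add]
    congr 2
    rw [← Complex.ofReal_exp]
    ring

lemma integral_osc_one_zero {s : ℂ} (hs : 0 < s.re) : ∫ x, osc 1 0 s x = Complex.Gamma s := by
  have h1 := integral_image_eq_integral_abs_deriv_smul (s := Set.univ) (f := Real.exp)
    (f' := Real.exp) MeasurableSet.univ (fun x _ => (Real.hasDerivAt_exp x).hasDerivWithinAt)
    Real.exp_injective.injOn (fun t : ℝ => (Real.exp (-t) : ℂ) * (t : ℂ) ^ (s - 1))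
  rw [Set.image_univ, Real.range_exp, setIntegral_univ] at h1
  rw [Complex.Gamma_eq_integral hs, Complex.GammaIntegral, h1]
  congr 1 with x
  rw [Real.abs_exp, Complex.real_smul, Complex.cpow_def_of_ne_zero (by simp [Complex.exp_ne_zero]),
    ← Complex.ofReal_log (Real.exp_pos x).le, Real.log_exp, Complex.ofReal_exp (-Real.exp x),
    osc]
  nth_rewrite 3 [Complex.ofReal_exp]
  rw [← Complex.exp_add, ← Complex.exp_add]
  congr 1
  push_cast
  ring

/-- $z^s$ times the integral has zero derivative in the right half-plane, by the functional equation
`mul_integral_osc_zero`. At $z=1$ the substitution $t=e^x$ gives Euler's integral. -/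
lemma integral_osc_zero {z s : ℂ} (hz : 0 < z.re) (hs : 0 < s.re) :
    ∫ x, osc z 0 s x = z ^ (-s) * Complex.Gamma s := by
  have hconv : Convex ℝ {z : ℂ | 0 < z.re} := convex_halfSpace_re_gt 0
  have hopen : IsOpen {z : ℂ | 0 < z.re} := Complex.isOpen_re_gt 0
  have hd : ∀ w ∈ {z : ℂ | 0 < z.re}, HasDerivAt (fun w => w ^ s * ∫ x, osc w 0 s x) 0 w := by
    intro w hw
    have hw0 : w ≠ 0 := by rintro rfl; simp at hw
    have h1 := ((hasDerivAt_id w).cpow_const (c := s) (Or.inl hw)).mul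
      (hasDerivAt_integral_osc_zero hw hs)
    refine HasDerivAt.congr_deriv h1 ?_
    have h2 := mul_integral_osc_zero hw hs
    simp only [id]
    rw [Complex.cpow_sub _ _ hw0, Complex.cpow_one]
    field_simp
    linear_combination (-w ^ s) * h2
  have h1 := hopen.is_const_of_deriv_eq_zero hconv.isPreconnected
    (fun w hw => (hd w hw).differentiableAt.differentiableWithinAt)
    (fun w hw => (hd w hw).deriv) (x := z) (y := 1) hz (by simp)
  have hz0 : z ≠ 0 := by rintro rfl; simp at hz
  simp only [Complex.one_cpow, one_mul, integral_osc_one_zero hs] at h1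
  rw [← h1, ← mul_assoc, ← Complex.cpow_add _ _ hz0, neg_add_cancel, Complex.cpow_zero, one_mul]

/-- The power series of the lower incomplete gamma function, divided by `z^s`. -/
def lowerGamma (s z : ℂ) : ℂ := ∑' k : ℕ, (-z) ^ k / (k.factorial : ℂ) / (s + k)

lemma summable_norm_cexp (z : ℂ) : Summable fun k : ℕ => ‖(-z) ^ k / (k.factorial : ℂ)‖ :=
  summable_norm_iff.2 (hasSum_cexp (-z)).summable

/-- The distance $\delta$ from $-s$ to the integers is unchanged by integer shifts of $s$, so one
constant serves for $s+1$ in the recursion and for all $s-m$ later. -/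
lemma hasSum_lowerGamma {δ : ℝ} (hδ : 0 < δ) {s : ℂ} (hs : ∀ n : ℤ, δ ≤ ‖s + n‖) (z : ℂ) :
    HasSum (fun k : ℕ => (-z) ^ k / (k.factorial : ℂ) / (s + k)) (lowerGamma s z) := by
  refine Summable.hasSum (Summable.of_norm_bounded ((summable_norm_cexp z).mul_right δ⁻¹) ?_)
  intro k
  rw [norm_div, div_eq_mul_inv]
  gcongr
  exact_mod_cast hs k

lemma mul_lowerGamma {δ : ℝ} (hδ : 0 < δ) {s : ℂ} (hs : ∀ n : ℤ, δ ≤ ‖s + n‖) (z : ℂ) :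
    s * lowerGamma s z - z * lowerGamma (s + 1) z = Complex.exp (-z) := by
  have hs1 : ∀ n : ℤ, δ ≤ ‖s + 1 + n‖ := by
    intro n
    have := hs (n + 1)
    push_cast at this
    rwa [add_assoc, add_comm (1 : ℂ)]
  have h1 := (hasSum_lowerGamma hδ hs z).mul_left s
  have h2 := (hasSum_lowerGamma hδ hs1 z).mul_left (-z)
  have h3 : HasSum (fun k : ℕ => (-z) ^ k / (k.factorial : ℂ) / (s + k) * k)
      (-z * lowerGamma (s + 1) z) := by
    rw [← hasSum_nat_add_iff' 1]
    simp only [Finset.range_one, Finset.sum_singleton, Nat.cast_zero, mul_zero, sub_zero]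
    convert! h2 using 1
    funext k
    have hk : (k : ℂ) + 1 ≠ 0 := Nat.cast_add_one_ne_zero k
    have hk' : (k.factorial : ℂ) ≠ 0 := by exact_mod_cast k.factorial_ne_zero
    have hsk : s + 1 + k ≠ 0 := by
      have := hs1 k
      intro h0
      rw [Int.cast_natCast, h0, norm_zero] at this
      linarith
    rw [Nat.factorial_succ]
    push_cast
    rw [show s + ((k : ℂ) + 1) = s + 1 + k by ring]
    field_simp
    ring
  have h4 := (h1.add h3).unique (a₂ := Complex.exp (-z)) (by
    convert! hasSum_cexp (-z) using 1
    funext k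
    have hsk : s + k ≠ 0 := by
      have := hs k
      intro h0
      rw [Int.cast_natCast, h0, norm_zero] at this
      linarith
    field_simp)
  linear_combination h4

lemma mul_upperGamma {z s : ℂ} (hz : 0 < z.re) :
    s * (∫ x in Set.Ioi (0 : ℝ), osc z 0 s x) - z * ∫ x in Set.Ioi (0 : ℝ), osc z 0 (s + 1) x =
      -Complex.exp (-z) := by
  have e : ∀ x, osc z 0 s x * (-(z * Real.exp x - 0 * Real.exp (-x)) + s) =
      s * osc z 0 s x - z * osc z 0 (s + 1) x := by
    intro x
    have : osc z 0 (s + 1) x = osc z 0 s x * Real.exp x := by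
      rw [osc, osc, Complex.ofReal_exp x, ← Complex.exp_add]
      congr 1
      ring
    rw [this]
    ring
  have i1 : ∀ s, Integrable (osc z 0 s) (volume.restrict (Set.Ioi 0)) :=
    fun s => integrableOn_osc hz (by simp) s
  have h1 := integral_Ioi_of_hasDerivAt_of_tendsto' (a := 0) (fun x _ => hasDerivAt_osc z 0 s x)
    (by simp only [e]; exact ((i1 s).const_mul _).sub ((i1 (s + 1)).const_mul _))
    (tendsto_osc_atTop hz (by simp) s)
  simp only [e] at h1
  rw [integral_sub ((i1 s).const_mul _) ((i1 (s + 1)).const_mul _), integral_const_mul,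
    integral_const_mul] at h1
  rw [h1]
  simp [osc]

/-- `Γ(s) = Γ(s, z) + γ(s, z)`. -/
lemma upperGamma_add_lowerGamma {δ : ℝ} (hδ : 0 < δ) {s z : ℂ} (hs : ∀ n : ℤ, δ ≤ ‖s + n‖)
    (hz : 0 < z.re) :
    (∫ x in Set.Ioi (0 : ℝ), osc z 0 s x) + lowerGamma s z = z ^ (-s) * Complex.Gamma s := by
  have hz0 : z ≠ 0 := by rintro rfl; simp at hz
  -- For $\mathrm{Re}\,s>0$ the lower incomplete gamma function is the convergent integral over
  -- $x\le0$, expanded termwise.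
  have pos : ∀ s : ℂ, (∀ n : ℤ, δ ≤ ‖s + n‖) → 0 < s.re →
      (∫ x in Set.Ioi (0 : ℝ), osc z 0 s x) + lowerGamma s z = z ^ (-s) * Complex.Gamma s := by
    intro s hs hre
    have hi := integrable_osc_zero hz hre
    rw [← integral_osc_zero hz hre, ← intervalIntegral.integral_Iic_add_Ioi (b := 0)
      hi.integrableOn hi.integrableOn, add_comm]
    congr 1
    refine (hasSum_lowerGamma hδ hs z).unique ?_
    have h1 := hasSum_integral_of_dominated_convergence (μ := volume.restrict (Set.Iic (0 : ℝ)))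
      (F := fun (k : ℕ) (x : ℝ) => (-z) ^ k / (k.factorial : ℂ) * Complex.exp ((s + k) * x))
      (f := osc z 0 s)
      (fun k x => ‖(-z) ^ k / (k.factorial : ℂ)‖ * Real.exp (s.re * x)) ?_ ?_ ?_ ?_ ?_
    · convert! h1 using 1
      funext k
      rw [integral_const_mul, integral_exp_mul_complex_Iic (by simp; positivity)]
      simp [div_eq_mul_inv]
    · intro k
      exact (by fun_prop : Continuous fun x : ℝ => (-z) ^ k / (k.factorial : ℂ) *
        Complex.exp ((s + k) * x)).aestronglyMeasurable
    · intro k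
      filter_upwards [ae_restrict_mem measurableSet_Iic] with x hx
      rw [norm_mul, Complex.norm_exp]
      gcongr
      rw [Complex.re_mul_ofReal, Complex.add_re, Complex.natCast_re]
      have : (k : ℝ) * x ≤ 0 := mul_nonpos_of_nonneg_of_nonpos k.cast_nonneg hx
      linarith
    · exact Eventually.of_forall fun x => (summable_norm_cexp z).mul_right _
    · simp only [tsum_mul_right]
      exact (integrableOn_exp_mul_Iic hre 0).const_mul _
    · refine Eventually.of_forall fun x => ?_
      have h2 := (hasSum_cexp (-z * Real.exp x)).mul_right (Complex.exp (s * x))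
      convert! h2 using 1
      · funext k
        rw [add_mul, Complex.exp_add, mul_pow, Complex.ofReal_exp, ← Complex.exp_nat_mul]
        ring
      · rw [osc, ← Complex.exp_add]
        congr 1
        ring
  -- Continuation to the left by unit steps: both summands and $z^{-s}\Gamma(s)$ relate $s$ to
  -- $s+1$, and the terms $\pm e^{-z}$ cancel.
  have key : ∀ N : ℕ, ∀ s : ℂ, (∀ n : ℤ, δ ≤ ‖s + n‖) → 0 < s.re + N →
      (∫ x in Set.Ioi (0 : ℝ), osc z 0 s x) + lowerGamma s z = z ^ (-s) * Complex.Gamma s := by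
    intro N
    induction N with
    | zero => intro s hs hre; exact pos s hs (by simpa using hre)
    | succ N ih =>
      intro s hs hre
      have hs1 : ∀ n : ℤ, δ ≤ ‖s + 1 + n‖ := by
        intro n
        have := hs (n + 1)
        push_cast at this
        rwa [add_assoc, add_comm (1 : ℂ)]
      have hs0 : s ≠ 0 := by
        have := hs 0
        intro h0
        rw [h0] at this
        simp at this
        linarith
      have h1 := ih (s + 1) hs1 (by push_cast at hre; simp; linarith)
      have h2 := mul_lowerGamma hδ hs z
      have h3 := mul_upperGamma (s := s) hz
      rw [Complex.Gamma_add_one s hs0, neg_add, Complex.cpow_add _ _ hz0, Complex.cpow_neg_one] at h1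
      have h4 : z * (z ^ (-s) * z⁻¹ * (s * Complex.Gamma s)) = s * (z ^ (-s) * Complex.Gamma s) := by
        field_simp
      refine mul_left_cancel₀ hs0 ?_
      linear_combination h3 + h2 + z * h1 + h4
  obtain ⟨N, hN⟩ := exists_nat_gt (-s.re)
  exact key N s hs (by linarith)

end

section

/-! ### Evaluation of the integrals by cylinder functions -/

lemma exists_dist_int {a : ℂ} (ha : ¬∃ n : ℤ, a = n) : ∃ δ > 0, ∀ n : ℤ, δ ≤ ‖a + n‖ := by
  have h1 : a ∉ Set.range ((↑) : ℤ → ℂ) := by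
    rintro ⟨n, hn⟩
    exact ha ⟨n, hn.symm⟩
  refine ⟨Metric.infDist a (Set.range ((↑) : ℤ → ℂ)),
    (Complex.isClosed_range_intCast.notMem_iff_infDist_pos ⟨_, 0, rfl⟩).1 h1, fun n => ?_⟩
  have h2 := Metric.infDist_le_dist_of_mem (x := a) (Set.mem_range_self (f := ((↑) : ℤ → ℂ)) (-n))
  rwa [Complex.dist_eq, Int.cast_neg, sub_neg_eq_add] at h2

lemma not_int_neg {a : ℂ} (ha : ¬∃ n : ℤ, a = n) : ¬∃ n : ℤ, -a = n := by
  rintro ⟨n, hn⟩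
  exact ha ⟨-n, by rw [Int.cast_neg, ← hn, neg_neg]⟩

lemma sin_pi_mul_ne_zero {a : ℂ} (ha : ¬∃ n : ℤ, a = n) : Complex.sin (Real.pi * a) ≠ 0 := by
  intro h
  obtain ⟨k, hk⟩ := Complex.sin_eq_zero_iff.1 h
  have hpi : (Real.pi : ℂ) ≠ 0 := by exact_mod_cast Real.pi_ne_zero
  exact ha ⟨k, mul_left_cancel₀ hpi (by rw [hk, mul_comm])⟩

/-- The terms of the double series by which the integrals over the two half-lines differ from the
series of cylinder functions. -/
def crossTerm (s z z' : ℂ) (k : ℕ × ℕ) : ℂ :=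
  (-z') ^ k.1 / (k.1.factorial : ℂ) * ((-z) ^ k.2 / (k.2.factorial : ℂ)) / (s - k.1 + k.2)

lemma summable_crossTerm {s : ℂ} (hs : ¬∃ n : ℤ, s = n) (z z' : ℂ) :
    Summable (crossTerm s z z') := by
  obtain ⟨δ, hδ, h⟩ := exists_dist_int hs
  refine Summable.of_norm_bounded (((summable_norm_cexp z').mul_of_nonneg (summable_norm_cexp z)
    (fun _ => norm_nonneg _) fun _ => norm_nonneg _).mul_right δ⁻¹) fun k => ?_
  rw [crossTerm, norm_div, norm_mul, div_eq_mul_inv]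
  gcongr
  have := h (k.2 - k.1)
  push_cast at this
  rwa [show s - k.1 + k.2 = s + ((k.2 : ℂ) - k.1) by ring]

/-- Exchanging the summation indices only negates the denominator. Hence the corrections from the
two half-lines, which correspond to $(s,z,z')$ and $(-s,z',z)$, cancel. -/
lemma tsum_crossTerm_neg (s z z' : ℂ) :
    ∑' k, crossTerm (-s) z' z k = -∑' k, crossTerm s z z' k := by
  rw [← (Equiv.prodComm ℕ ℕ).tsum_eq, ← tsum_neg]
  congr 1 with k
  simp only [crossTerm, Equiv.prodComm_apply, Prod.fst_swap, Prod.snd_swap]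
  rw [show -s - (k.2 : ℂ) + k.1 = -(s - k.1 + k.2) by ring, div_neg]
  ring

/-- The entire function `∑ t^m / (m! Γ(a + m + 1))`. -/
def besselS (a t : ℂ) : ℂ :=
  ∑' m : ℕ, t ^ m / (m.factorial : ℂ) * (Complex.Gamma (a + m + 1))⁻¹

/-- Expanding $e^{-z'e^{-x}}$ on $x>0$ gives upper incomplete gamma functions at $s-m$, and the
cross terms supply the lower ones. The reflection formula rewrites the resulting $\Gamma(s-m)$ as a
multiple of $1/\Gamma(1-s+m)$, the coefficient of a Bessel series. -/
lemma hasSum_half {z z' s : ℂ} (hs : ¬∃ n : ℤ, s = n) (hz : 0 < z.re) :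
    HasSum (fun m : ℕ => Real.pi / Complex.sin (Real.pi * s) * z ^ (-s) *
        ((z * z') ^ m / (m.factorial : ℂ) * (Complex.Gamma (-s + m + 1))⁻¹))
      ((∫ x in Set.Ioi (0 : ℝ), osc z z' s x) + ∑' k, crossTerm s z z' k) := by
  have hz0 : z ≠ 0 := by rintro rfl; simp at hz
  obtain ⟨δ, hδ, h⟩ := exists_dist_int hs
  have hm : ∀ m : ℕ, ∀ n : ℤ, δ ≤ ‖s - m + n‖ := by
    intro m n
    have := h (n - m)
    push_cast at this
    rwa [show s - m + n = s + ((n : ℂ) - m) by ring]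
  have h1 : HasSum (fun m : ℕ => (-z') ^ m / (m.factorial : ℂ) *
      ∫ x in Set.Ioi (0 : ℝ), osc z 0 (s - m) x) (∫ x in Set.Ioi (0 : ℝ), osc z z' s x) := by
    have h2 := hasSum_integral_of_dominated_convergence (μ := volume.restrict (Set.Ioi (0 : ℝ)))
      (F := fun (m : ℕ) (x : ℝ) => (-z') ^ m / (m.factorial : ℂ) * osc z 0 (s - m) x)
      (f := osc z z' s)
      (fun m x => ‖(-z') ^ m / (m.factorial : ℂ)‖ * ‖osc z 0 s x‖) ?_ ?_ ?_ ?_ ?_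
    · simpa only [integral_const_mul] using h2
    · exact fun m => ((continuous_osc z 0 (s - m)).const_mul _).aestronglyMeasurable
    · intro m
      filter_upwards [ae_restrict_mem measurableSet_Ioi] with x hx
      rw [norm_mul, norm_osc, norm_osc]
      have hmx : 0 ≤ (m : ℝ) * x := mul_nonneg m.cast_nonneg (le_of_lt hx)
      refine mul_le_mul_of_nonneg_left (Real.exp_le_exp.2 ?_) (norm_nonneg _)
      rw [Complex.sub_re, Complex.natCast_re]
      linarith
    · exact Eventually.of_forall fun x => (summable_norm_cexp z').mul_right _
    · simp only [tsum_mul_right]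
      exact (integrableOn_osc hz (by simp) s).norm.const_mul _
    · refine Eventually.of_forall fun x => ?_
      have h2 := (hasSum_cexp (-z' * Real.exp (-x))).mul_right (osc z 0 s x)
      convert! h2 using 1
      · funext m
        rw [osc, osc, mul_pow, Complex.ofReal_exp (-x), ← Complex.exp_nat_mul, mul_div_right_comm,
          mul_assoc, ← Complex.exp_add]
        congr 2
        push_cast
        ring
      · rw [osc, osc, ← Complex.exp_add]
        congr 1
        ring
  have h3 : HasSum (fun m : ℕ => (-z') ^ m / (m.factorial : ℂ) * lowerGamma (s - m) z)
      (∑' k, crossTerm s z z' k) := by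
    refine (summable_crossTerm hs z z').hasSum.prod_fiberwise fun m => ?_
    convert! (hasSum_lowerGamma hδ (hm m) z).mul_left ((-z') ^ m / (m.factorial : ℂ)) using 1
    funext k
    rw [crossTerm, mul_div_assoc]
  convert! h1.add h3 using 1
  funext m
  rw [← mul_add, upperGamma_add_lowerGamma hδ (hm m) hz]
  have h4 := Complex.Gamma_mul_Gamma_one_sub (s - m)
  have hsin : Complex.sin (Real.pi * (s - m)) = (-1) ^ m * Complex.sin (Real.pi * s) := by
    rw [mul_sub, mul_comm (Real.pi : ℂ) m, Complex.sin_antiperiodic.sub_nat_mul_eq]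
  have hs0 := sin_pi_mul_ne_zero hs
  have hG : Complex.Gamma (-s + m + 1) ≠ 0 := by
    refine Complex.Gamma_ne_zero fun n hn => hs ⟨m + 1 + n, ?_⟩
    push_cast
    linear_combination -hn
  have hpow : z ^ (-(s - m)) = z ^ (-s) * z ^ m := by
    rw [neg_sub, sub_eq_neg_add, Complex.cpow_add _ _ hz0, Complex.cpow_natCast]
  rw [hsin, show 1 - (s - m) = -s + m + 1 by ring] at h4
  have h1m : ((-1 : ℂ) ^ m) * (-1) ^ m = 1 := by rw [← mul_pow]; simp
  have hG2 : Complex.Gamma (s - m) =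
      (-1) ^ m * (Real.pi / Complex.sin (Real.pi * s)) * (Complex.Gamma (-s + m + 1))⁻¹ := by
    rw [eq_mul_inv_iff_mul_eq₀ hG, h4, div_mul_eq_div_div_swap, eq_comm]
    rw [eq_div_iff (pow_ne_zero _ (by norm_num))]
    linear_combination (Real.pi / Complex.sin (Real.pi * s)) * h1m
  rw [hpow, hG2, neg_pow z', mul_pow]
  linear_combination (-(Real.pi / Complex.sin (Real.pi * s) * z ^ (-s) * (z ^ m * z' ^ m /
    (m.factorial : ℂ) * (Complex.Gamma (-s + m + 1))⁻¹))) * h1m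

lemma half_add_cross {z z' s : ℂ} (hs : ¬∃ n : ℤ, s = n) (hz : 0 < z.re) :
    (∫ x in Set.Ioi (0 : ℝ), osc z z' s x) + ∑' k, crossTerm s z z' k =
      Real.pi / Complex.sin (Real.pi * s) * z ^ (-s) * besselS (-s) (z * z') := by
  rw [← (hasSum_half hs hz).tsum_eq, tsum_mul_left, besselS]

/-- Obtained from `hasSum_half` at $z=R$, $z'=1$ by dividing out the nonzero prefactor, without
estimates of the gamma function. -/
lemma summable_besselS {a : ℂ} (ha : ¬∃ n : ℤ, a = n) {R : ℝ} (hR : 0 < R) :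
    Summable fun m : ℕ => (R : ℂ) ^ m / (m.factorial : ℂ) * (Complex.Gamma (a + m + 1))⁻¹ := by
  have h1 := (hasSum_half (z := R) (z' := 1) (not_int_neg ha) (by simpa using hR)).summable
  have hR0 : (R : ℂ) ≠ 0 := by exact_mod_cast hR.ne'
  have hpi : (Real.pi : ℂ) ≠ 0 := by exact_mod_cast Real.pi_ne_zero
  rw [summable_mul_left_iff] at h1
  · simpa only [neg_neg, mul_one] using h1
  · exact mul_ne_zero (div_ne_zero hpi (sin_pi_mul_ne_zero (not_int_neg ha)))
      (by simp [Complex.cpow_eq_zero_iff, hR0])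

lemma tendsto_besselS {a : ℂ} (ha : ¬∃ n : ℤ, a = n) {ι : Type*} {l : Filter ι} {t : ι → ℂ} {t₀ : ℂ}
    (ht : Tendsto t l (𝓝 t₀)) : Tendsto (fun i => besselS a (t i)) l (𝓝 (besselS a t₀)) := by
  have hR : 0 < ‖t₀‖ + 1 := by positivity
  refine tendsto_tsum_of_dominated_convergence (summable_besselS ha hR).norm ?_ ?_
  · intro m
    exact ((ht.pow m).div_const _).mul_const _
  · filter_upwards [ht.norm.eventually_le_const (lt_add_one ‖t₀‖)] with i hi m
    rw [norm_mul, norm_mul, norm_div, norm_div, norm_pow, norm_pow, Complex.norm_real,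
      Real.norm_of_nonneg hR.le]
    gcongr

lemma oscInt_eq_of_pos {z z' a : ℂ} (ha : ¬∃ n : ℤ, a = n) (hz : 0 < z.re) (hz' : 0 < z'.re)
    (ha1 : -1 < a.re) (ha2 : a.re < 1) :
    oscInt z z' (-a) = Real.pi / Complex.sin (Real.pi * a) *
      (z' ^ (-a) * besselS (-a) (z * z') - z ^ a * besselS a (z * z')) := by
  rw [oscInt, oscHalf_eq_integral hz hz'.le (by simp; linarith),
    oscHalf_eq_integral hz' hz.le (by simpa using ha2), neg_neg]
  have h1 := half_add_cross (z' := z') (not_int_neg ha) hz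
  have h2 := half_add_cross (z' := z) ha hz'
  have h3 := tsum_crossTerm_neg a z' z
  rw [neg_neg, mul_neg, Complex.sin_neg, div_neg] at h1
  rw [mul_comm z'] at h2
  linear_combination h1 + h2 - h3

/-- The form of `oscHalf` after integration by parts has a remainder dominated uniformly for
$\mathrm{Re}\,z,\mathrm{Re}\,z'\ge0$, so limits onto the imaginary axis are allowed. -/
lemma tendsto_oscHalf_param {ι : Type*} {l : Filter ι} [l.IsCountablyGenerated]
    {z z' w : ι → ℂ} {z₀ z₀' w₀ : ℂ} (hz : Tendsto z l (𝓝 z₀)) (hz' : Tendsto z' l (𝓝 z₀'))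
    (hw : Tendsto w l (𝓝 w₀)) (h0 : z₀ ≠ 0) (hw0 : w₀.re < 1) (h1 : ∀ᶠ i in l, 0 ≤ (z i).re)
    (h2 : ∀ᶠ i in l, 0 ≤ (z' i).re) :
    Tendsto (fun i => oscHalf (z i) (z' i) (w i)) l (𝓝 (oscHalf z₀ z₀' w₀)) := by
  have hosc : ∀ x : ℝ, Tendsto (fun i => osc (z i) (z' i) (w i - 1) x) l
      (𝓝 (osc z₀ z₀' (w₀ - 1) x)) := by
    intro x
    refine (Complex.continuous_exp.tendsto _).comp ?_
    exact (((hz.mul_const _).add (hz'.mul_const _)).neg).add ((hw.sub_const 1).mul_const _)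
  -- The midpoint of $\mathrm{Re}\,w_0$ and $1$ bounds $\mathrm{Re}\,w$ near the limit and still
  -- gives exponential decay.
  have hσ : w₀.re < (1 + w₀.re) / 2 := by linarith
  refine ((hosc 0).div hz h0).sub ?_
  refine tendsto_integral_filter_of_dominated_convergence
    (fun x => (‖w₀ - 1‖ + 1 + (‖z₀'‖ + 1)) / (‖z₀‖ / 2) *
      Real.exp (-(1 - (1 + w₀.re) / 2) * x)) ?_ ?_ ?_ ?_
  · exact Eventually.of_forall fun i => (continuous_oscRem _ _ _).aestronglyMeasurable
  · have hz0 : ‖z₀‖ / 2 < ‖z₀‖ := half_lt_self (norm_pos_iff.2 h0)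
    have hz0' : 0 < ‖z₀‖ / 2 := half_pos (norm_pos_iff.2 h0)
    filter_upwards [h1, h2, hz.norm.eventually_const_le hz0,
      hz'.norm.eventually_le_const (lt_add_one ‖z₀'‖),
      (hw.sub_const 1).norm.eventually_le_const (lt_add_one ‖w₀ - 1‖),
      ((Complex.continuous_re.tendsto _).comp hw).eventually_le_const hσ] with i a1 a2 a3 a4 a5 a6
    filter_upwards [ae_restrict_mem measurableSet_Ioi] with x hx
    have hx' : (0 : ℝ) < x := hx
    refine (norm_oscRem_le a1 a2 (w i) hx'.le).trans ?_
    gcongr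
    exact a6
  · exact (integrableOn_exp_mul_Ioi (by linarith) 0).const_mul _
  · refine Eventually.of_forall fun x => ?_
    exact ((hosc x).mul (((hw.sub_const 1).add (hz'.mul_const _)).div hz h0)).neg

/-- The integrals `K_s^r` for nonintegral index. -/
lemma oscInt_negI {c d : ℝ} (hc : c ≠ 0) (hd : d ≠ 0) {a : ℂ} (ha : ¬∃ n : ℤ, a = n)
    (ha1 : -1 < a.re) (ha2 : a.re < 1) :
    oscInt (negI c) (negI d) (-a) = Real.pi / Complex.sin (Real.pi * a) *
      (negI d ^ (-a) * besselS (-a) (negI c * negI d) -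
        negI c ^ a * besselS a (negI c * negI d)) := by
  -- The point $-ic$ is approached as $\varepsilon-ic$ from the right half-plane; for $c\ne0$ it
  -- lies off the branch cut, so principal powers are continuous there.
  have hlim : ∀ c : ℝ, Tendsto (fun ε : ℝ => (ε : ℂ) + negI c) (𝓝[>] 0) (𝓝 (negI c)) := by
    intro c
    have : Tendsto (fun ε : ℝ => (ε : ℂ) + negI c) (𝓝 0) (𝓝 (((0 : ℝ) : ℂ) + negI c)) :=
      (by fun_prop : Continuous fun ε : ℝ => (ε : ℂ) + negI c).tendsto 0
    rw [Complex.ofReal_zero, zero_add] at this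
    exact this.mono_left nhdsWithin_le_nhds
  have hre : ∀ c : ℝ, ∀ᶠ ε : ℝ in 𝓝[>] 0, 0 < ((ε : ℂ) + negI c).re := by
    intro c
    filter_upwards [self_mem_nhdsWithin] with ε hε
    simpa [negI_re] using hε
  have hslit : ∀ {c : ℝ}, c ≠ 0 → negI c ∈ Complex.slitPlane := by
    intro c hc
    refine Or.inr ?_
    simpa [negI] using hc
  have h1 : Tendsto (fun ε : ℝ => oscInt ((ε : ℂ) + negI c) ((ε : ℂ) + negI d) (-a)) (𝓝[>] 0)
      (𝓝 (oscInt (negI c) (negI d) (-a))) :=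
    (tendsto_oscHalf_param (hlim c) (hlim d) tendsto_const_nhds (negI_ne_zero hc)
      (by simp; linarith) ((hre c).mono fun _ h => h.le) ((hre d).mono fun _ h => h.le)).add
    (tendsto_oscHalf_param (hlim d) (hlim c) tendsto_const_nhds (negI_ne_zero hd)
      (by simpa using ha2) ((hre d).mono fun _ h => h.le) ((hre c).mono fun _ h => h.le))
  have hcpow : ∀ {c : ℝ}, c ≠ 0 → ∀ b : ℂ, Tendsto (fun ε : ℝ => ((ε : ℂ) + negI c) ^ b) (𝓝[>] 0)
      (𝓝 (negI c ^ b)) := fun hc b =>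
    (continuousAt_cpow_const (hslit hc)).tendsto.comp (hlim _)
  have hprod := (hlim c).mul (hlim d)
  have h2 := (((hcpow hd (-a)).mul (tendsto_besselS (not_int_neg ha) hprod)).sub
    ((hcpow hc a).mul (tendsto_besselS ha hprod))).const_mul
      (Real.pi / Complex.sin (Real.pi * a))
  refine tendsto_nhds_unique h1 (h2.congr' ?_)
  filter_upwards [hre c, hre d] with ε hε hε'
  exact (oscInt_eq_of_pos ha hε hε' ha1 ha2).symm

/-- Supplies the limiting values of the cylinder functions at $0$, the only integer with real part
in $(-1,1)$. -/
lemma continuousAt_oscInt {c d : ℝ} (hc : c ≠ 0) (hd : d ≠ 0) :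
    ContinuousAt (fun a : ℂ => oscInt (negI c) (negI d) (-a)) 0 := by
  have h : Tendsto (fun a : ℂ => -a) (𝓝 0) (𝓝 (-0)) := continuous_neg.tendsto 0
  refine (tendsto_oscHalf_param tendsto_const_nhds tendsto_const_nhds h (negI_ne_zero hc)
    (by simp) ?_ ?_).add (tendsto_oscHalf_param tendsto_const_nhds tendsto_const_nhds h.neg
      (negI_ne_zero hd) (by simp) ?_ ?_) <;>
  exact Eventually.of_forall fun _ => (negI_re _).ge

end

section

/-! ### The values of `K_s^r` in the four quadrants -/

lemma cpow_add_two_mul {X : ℂ} (hX : X ≠ 0) (a : ℂ) (m : ℕ) :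
    X ^ (a + 2 * m) = X ^ a * (X ^ 2) ^ m := by
  rw [Complex.cpow_add _ _ hX, ← pow_mul, ← Complex.cpow_natCast]
  push_cast
  rfl

lemma besselJ_eq {x : ℂ} (hx : x ≠ 0) (a : ℂ) :
    besselJ a x = (x / 2) ^ a * besselS a (-(x / 2) ^ 2) := by
  rw [besselJ, besselS, ← tsum_mul_left]
  congr 1 with m
  rw [cpow_add_two_mul (div_ne_zero hx two_ne_zero), neg_pow ((x / 2) ^ 2)]
  ring

lemma besselI_eq {x : ℂ} (hx : x ≠ 0) (a : ℂ) :
    besselI a x = (x / 2) ^ a * besselS a ((x / 2) ^ 2) := by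
  rw [besselI, besselS, ← tsum_mul_left]
  congr 1 with m
  rw [cpow_add_two_mul (div_ne_zero hx two_ne_zero)]
  ring

/-- A negative multiple of $i$ has principal argument $-\pi/2$, and a positive one, in the next
lemma, $+\pi/2$. All factors $e^{\pm\pi i\alpha/2}$ in the final formulas arise here. -/
lemma negI_cpow {X : ℝ} (hX : 0 < X) (β : ℝ) (a : ℂ) :
    negI (X * Real.exp β) ^ a =
      (X : ℂ) ^ a * Complex.exp (a * (β - Real.pi * Complex.I / 2)) := by
  have hX0 : (X : ℂ) ≠ 0 := by exact_mod_cast hX.ne'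
  have h : negI (X * Real.exp β) = ((X * Real.exp β : ℝ) : ℂ) * -Complex.I := by
    rw [negI]; ring
  rw [h, Complex.cpow_def_of_ne_zero (by simp [hX.ne', Complex.exp_ne_zero]),
    Complex.log_ofReal_mul (by positivity) (by simp), Complex.log_neg_I,
    Real.log_mul hX.ne' (Real.exp_pos β).ne', Real.log_exp, Complex.cpow_def_of_ne_zero hX0,
    ← Complex.exp_add, Complex.ofReal_add, Complex.ofReal_log hX.le]
  congr 1
  ring

lemma negI_neg_cpow {X : ℝ} (hX : 0 < X) (β : ℝ) (a : ℂ) :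
    negI (-(X * Real.exp β)) ^ a =
      (X : ℂ) ^ a * Complex.exp (a * (β + Real.pi * Complex.I / 2)) := by
  have hX0 : (X : ℂ) ≠ 0 := by exact_mod_cast hX.ne'
  have h : negI (-(X * Real.exp β)) = ((X * Real.exp β : ℝ) : ℂ) * Complex.I := by
    rw [negI, Complex.ofReal_neg]; ring
  rw [h, Complex.cpow_def_of_ne_zero (by simp [hX.ne', Complex.exp_ne_zero]),
    Complex.log_ofReal_mul (by positivity) (by simp), Complex.log_I,
    Real.log_mul hX.ne' (Real.exp_pos β).ne', Real.log_exp, Complex.cpow_def_of_ne_zero hX0,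
    ← Complex.exp_add, Complex.ofReal_add, Complex.ofReal_log hX.le]
  congr 1
  ring

/-- The sign of $cd$ decides the type of function: equal signs give the argument $-(x/2)^2$ and
Bessel functions $J$, opposite signs give $(x/2)^2$ and $I$. -/
lemma negI_mul_negI (c d : ℝ) : negI c * negI d = -((c * d : ℝ) : ℂ) := by
  rw [negI, negI, Complex.ofReal_mul]
  linear_combination (c * d : ℂ) * Complex.I_mul_I

lemma mul_exp_mul_exp_neg (X β : ℝ) : X * Real.exp β * (X * Real.exp (-β)) = X ^ 2 := by
  have : Real.exp β * Real.exp (-β) = 1 := by rw [← Real.exp_add, add_neg_cancel, Real.exp_zero]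
  linear_combination X ^ 2 * this

/-- A function given by an expression continuous at `0` has the expected limiting value there. -/
lemma integerLimit_eq {N G : ℂ → ℂ} (hG : ContinuousAt G 0)
    (h : ∀ a : ℂ, (¬∃ n : ℤ, a = n) → -1 < a.re → a.re < 1 → N a = G a) {a : ℂ} (h1 : -1 < a.re)
    (h2 : a.re < 1) : integerLimit N a = G a := by
  rw [integerLimit]
  split_ifs with ha
  · obtain ⟨n, rfl⟩ := ha
    have hn : n = 0 := by
      rw [Complex.intCast_re] at h1 h2
      have h3 : (-1 : ℤ) < n := by exact_mod_cast h1
      have h4 : n < (1 : ℤ) := by exact_mod_cast h2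
      omega
    subst hn
    rw [Int.cast_zero]
    refine Tendsto.limUnder_eq ((hG.tendsto.mono_left nhdsWithin_le_nhds).congr' ?_)
    have h5 : ∀ᶠ a : ℂ in 𝓝[≠] 0, ‖a‖ < 1 :=
      nhdsWithin_le_nhds (by simpa [Metric.ball, dist_zero_right] using Metric.ball_mem_nhds (0 : ℂ) one_pos)
    filter_upwards [h5, self_mem_nhdsWithin] with a ha ha0
    have h6 := abs_lt.1 ((Complex.abs_re_le_norm a).trans_lt ha)
    refine (h a ?_ h6.1 h6.2).symm
    rintro ⟨n, rfl⟩
    rw [Complex.norm_intCast] at ha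
    have h7 : |n| < 1 := by exact_mod_cast ha
    rw [Int.abs_lt_one_iff] at h7
    exact ha0 (by simp [h7])
  · exact h a ha h1 h2

/-- A continuous nowhere vanishing prefactor may be divided out before the limit, so the cylinder
function inherits the continuity of the integral at index $0$. -/
lemma integerLimit_mul {N Φ G : ℂ → ℂ} (hG : ContinuousAt G 0) (hΦ : Continuous Φ)
    (hΦ0 : ∀ a, Φ a ≠ 0)
    (h : ∀ a : ℂ, (¬∃ n : ℤ, a = n) → -1 < a.re → a.re < 1 → G a = Φ a * N a) {a : ℂ}
    (h1 : -1 < a.re) (h2 : a.re < 1) : G a = Φ a * integerLimit N a := by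
  rw [integerLimit_eq (N := N) (G := fun a => G a / Φ a) (hG.div hΦ.continuousAt (hΦ0 0)) ?_ h1 h2,
    mul_div_cancel₀ _ (hΦ0 a)]
  intro a ha h3 h4
  rw [h a ha h3 h4, mul_div_cancel_left₀ _ (hΦ0 a)]

lemma oscInt_hankel1 {x : ℝ} (hx : 0 < x) (β : ℝ) {a : ℂ} (h1 : -1 < a.re)
    (h2 : a.re < 1) :
    oscInt (negI (x / 2 * Real.exp β)) (negI (x / 2 * Real.exp (-β))) (-a) =
      Real.pi * Complex.I * Complex.exp (a * (β + Real.pi * Complex.I / 2)) * hankel1 a x := by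
  have hX : 0 < x / 2 := half_pos hx
  have hx0 : (x : ℂ) ≠ 0 := by exact_mod_cast hx.ne'
  have hpi : (Real.pi : ℂ) ≠ 0 := by exact_mod_cast Real.pi_ne_zero
  refine integerLimit_mul (G := fun a => oscInt (negI (x / 2 * Real.exp β))
    (negI (x / 2 * Real.exp (-β))) (-a))
    (Φ := fun a => Real.pi * Complex.I * Complex.exp (a * (β + Real.pi * Complex.I / 2)))
    (continuousAt_oscInt (by positivity) (by positivity)) (by fun_prop)
    (fun a => mul_ne_zero (mul_ne_zero hpi Complex.I_ne_zero) (Complex.exp_ne_zero _)) ?_ h1 h2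
  intro a ha h3 h4
  have hs := sin_pi_mul_ne_zero ha
  rw [oscInt_negI (by positivity) (by positivity) ha h3 h4, negI_cpow hX, negI_cpow hX,
    negI_mul_negI, mul_exp_mul_exp_neg, besselJ_eq hx0, besselJ_eq hx0]
  push_cast
  have e1 : Complex.exp (-a * (-(β : ℂ) - Real.pi * Complex.I / 2)) =
      Complex.exp (a * (β + Real.pi * Complex.I / 2)) := by
    congr 1; ring
  -- The quotient of the two phases is the factor $e^{-i\pi a}$ in the definition of $H^{(1)}_a$.
  have e2 : Complex.exp (a * ((β : ℂ) - Real.pi * Complex.I / 2)) =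
      Complex.exp (a * (β + Real.pi * Complex.I / 2)) *
        Complex.exp (-(Complex.I * Real.pi * a)) := by
    rw [← Complex.exp_add]
    congr 1; ring
  rw [e1, e2]
  field_simp

lemma oscInt_hankel2 {x : ℝ} (hx : 0 < x) (β : ℝ) {a : ℂ} (h1 : -1 < a.re)
    (h2 : a.re < 1) :
    oscInt (negI (-(x / 2 * Real.exp β))) (negI (-(x / 2 * Real.exp (-β)))) (-a) =
      -(Real.pi * Complex.I) * Complex.exp (a * (β - Real.pi * Complex.I / 2)) * hankel2 a x := by
  have hX : 0 < x / 2 := half_pos hx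
  have hx0 : (x : ℂ) ≠ 0 := by exact_mod_cast hx.ne'
  have hpi : (Real.pi : ℂ) ≠ 0 := by exact_mod_cast Real.pi_ne_zero
  have hn : ∀ β : ℝ, -(x / 2 * Real.exp β) ≠ 0 := fun β => neg_ne_zero.2 (by positivity)
  refine integerLimit_mul (G := fun a => oscInt (negI (-(x / 2 * Real.exp β)))
    (negI (-(x / 2 * Real.exp (-β)))) (-a))
    (Φ := fun a => -(Real.pi * Complex.I) * Complex.exp (a * (β - Real.pi * Complex.I / 2)))
    (continuousAt_oscInt (hn β) (hn (-β))) (by fun_prop)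
    (fun a => mul_ne_zero (neg_ne_zero.2 (mul_ne_zero hpi Complex.I_ne_zero))
      (Complex.exp_ne_zero _)) ?_ h1 h2
  intro a ha h3 h4
  have hs := sin_pi_mul_ne_zero ha
  rw [oscInt_negI (hn β) (hn (-β)) ha h3 h4, negI_neg_cpow hX, negI_neg_cpow hX,
    negI_mul_negI, neg_mul_neg, mul_exp_mul_exp_neg, besselJ_eq hx0, besselJ_eq hx0]
  push_cast
  have e1 : Complex.exp (-a * (-(β : ℂ) + Real.pi * Complex.I / 2)) =
      Complex.exp (a * (β - Real.pi * Complex.I / 2)) := by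
    congr 1; ring
  have e2 : Complex.exp (a * ((β : ℂ) + Real.pi * Complex.I / 2)) =
      Complex.exp (a * (β - Real.pi * Complex.I / 2)) *
        Complex.exp (Complex.I * Real.pi * a) := by
    rw [← Complex.exp_add]
    congr 1; ring
  rw [e1, e2]
  field_simp

lemma oscInt_macdonaldK_pos_neg {x : ℝ} (hx : 0 < x) (β : ℝ) {a : ℂ} (h1 : -1 < a.re)
    (h2 : a.re < 1) :
    oscInt (negI (x / 2 * Real.exp β)) (negI (-(x / 2 * Real.exp (-β)))) (-a) =
      2 * Complex.exp (a * (β - Real.pi * Complex.I / 2)) * macdonaldK a x := by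
  have hX : 0 < x / 2 := half_pos hx
  have hx0 : (x : ℂ) ≠ 0 := by exact_mod_cast hx.ne'
  have hn : ∀ β : ℝ, -(x / 2 * Real.exp β) ≠ 0 := fun β => neg_ne_zero.2 (by positivity)
  refine integerLimit_mul (G := fun a => oscInt (negI (x / 2 * Real.exp β))
    (negI (-(x / 2 * Real.exp (-β)))) (-a))
    (Φ := fun a => 2 * Complex.exp (a * (β - Real.pi * Complex.I / 2)))
    (continuousAt_oscInt (by positivity) (hn (-β))) (by fun_prop)
    (fun a => mul_ne_zero two_ne_zero (Complex.exp_ne_zero _)) ?_ h1 h2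
  intro a ha h3 h4
  have hs := sin_pi_mul_ne_zero ha
  rw [oscInt_negI (by positivity) (hn (-β)) ha h3 h4, negI_cpow hX, negI_neg_cpow hX,
    negI_mul_negI, mul_neg, mul_exp_mul_exp_neg, besselI_eq hx0, besselI_eq hx0]
  push_cast
  rw [neg_neg, show -a * (-(β : ℂ) + Real.pi * Complex.I / 2) =
    a * (β - Real.pi * Complex.I / 2) by ring]
  field_simp

lemma oscInt_macdonaldK_neg_pos {x : ℝ} (hx : 0 < x) (β : ℝ) {a : ℂ} (h1 : -1 < a.re)
    (h2 : a.re < 1) :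
    oscInt (negI (-(x / 2 * Real.exp β))) (negI (x / 2 * Real.exp (-β))) (-a) =
      2 * Complex.exp (a * (β + Real.pi * Complex.I / 2)) * macdonaldK a x := by
  have hX : 0 < x / 2 := half_pos hx
  have hx0 : (x : ℂ) ≠ 0 := by exact_mod_cast hx.ne'
  have hn : ∀ β : ℝ, -(x / 2 * Real.exp β) ≠ 0 := fun β => neg_ne_zero.2 (by positivity)
  refine integerLimit_mul (G := fun a => oscInt (negI (-(x / 2 * Real.exp β)))
    (negI (x / 2 * Real.exp (-β))) (-a))
    (Φ := fun a => 2 * Complex.exp (a * (β + Real.pi * Complex.I / 2)))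
    (continuousAt_oscInt (hn β) (by positivity)) (by fun_prop)
    (fun a => mul_ne_zero two_ne_zero (Complex.exp_ne_zero _)) ?_ h1 h2
  intro a ha h3 h4
  have hs := sin_pi_mul_ne_zero ha
  rw [oscInt_negI (hn β) (by positivity) ha h3 h4, negI_cpow hX, negI_neg_cpow hX,
    negI_mul_negI, neg_mul (x / 2 * Real.exp β), mul_exp_mul_exp_neg, besselI_eq hx0, besselI_eq hx0]
  push_cast
  rw [neg_neg, show -a * (-(β : ℂ) - Real.pi * Complex.I / 2) =
    a * (β + Real.pi * Complex.I / 2) by ring]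
  field_simp

lemma Kfun_eq_oscInt (p : ℕ) {r : ℝ} (hr : r ≠ 0) {g : Pt} (hg : g.1 ≠ 0) (hg' : g.2.1 ≠ 0) (s : ℤ)
    (ν μ : ℂ) (h : -1 < (ν - μ + s / p).re) (h' : (ν - μ + s / p).re < 1) :
    Kfun p r s ν μ g = 1 / (2 * Real.pi * Complex.I) * Complex.exp (μ * g.2.2) *
      oscInt (negI (r * g.1)) (negI (r * g.2.1)) (-(μ - ν - s / p)) := by
  rw [Kfun, improperIntegral_KIntegrand p hr hg hg' s ν μ h h']
  congr 2
  ring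

lemma Kfun_values (p : ℕ) {r : ℝ} (hr : 0 < r) (s : ℤ) (ν μ : ℂ) (ρ β lam : ℝ) (hρ : 0 < ρ)
    (h1 : -1 < (ν - μ + s / p).re) (h2 : (ν - μ + s / p).re < 1) :
    Kfun p r s ν μ (1 / 2 * ρ * Real.exp β, 1 / 2 * ρ * Real.exp (-β), lam) =
      1 / 2 * Complex.exp ((μ - ν - s / p) * (β + Real.pi * Complex.I / 2) + μ * lam) *
        hankel1 (μ - ν - s / p) (r * ρ) ∧
    Kfun p r s ν μ (1 / 2 * ρ * Real.exp β, -(1 / 2 * ρ * Real.exp (-β)), lam) =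
      1 / (Real.pi * Complex.I) *
        Complex.exp ((μ - ν - s / p) * (β - Real.pi * Complex.I / 2) + μ * lam) *
        macdonaldK (μ - ν - s / p) (r * ρ) ∧
    Kfun p r s ν μ (-(1 / 2 * ρ * Real.exp β), -(1 / 2 * ρ * Real.exp (-β)), lam) =
      -(1 / 2) * Complex.exp ((μ - ν - s / p) * (β - Real.pi * Complex.I / 2) + μ * lam) *
        hankel2 (μ - ν - s / p) (r * ρ) ∧
    Kfun p r s ν μ (-(1 / 2 * ρ * Real.exp β), 1 / 2 * ρ * Real.exp (-β), lam) =
      1 / (Real.pi * Complex.I) *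
        Complex.exp ((μ - ν - s / p) * (β + Real.pi * Complex.I / 2) + μ * lam) *
        macdonaldK (μ - ν - s / p) (r * ρ) := by
  have hx : 0 < r * ρ := mul_pos hr hρ
  have hpi : (Real.pi : ℂ) ≠ 0 := by exact_mod_cast Real.pi_ne_zero
  have hpos : ∀ β : ℝ, 1 / 2 * ρ * Real.exp β ≠ 0 := fun β => by positivity
  have hneg : ∀ β : ℝ, -(1 / 2 * ρ * Real.exp β) ≠ 0 := fun β => neg_ne_zero.2 (hpos β)
  have e1 : ∀ β : ℝ, r * (1 / 2 * ρ * Real.exp β) = r * ρ / 2 * Real.exp β := fun β => by ring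
  have e2 : ∀ β : ℝ, r * -(1 / 2 * ρ * Real.exp β) = -(r * ρ / 2 * Real.exp β) := fun β => by ring
  have ha : (μ - ν - s / p) = -(ν - μ + s / p) := by ring
  have h3 : -1 < (μ - ν - s / p).re := by rw [ha, Complex.neg_re]; linarith
  have h4 : (μ - ν - s / p).re < 1 := by rw [ha, Complex.neg_re]; linarith
  simp only [Complex.exp_add]
  refine ⟨?_, ?_, ?_, ?_⟩
  · rw [Kfun_eq_oscInt p hr.ne' (hpos β) (hpos (-β)) s ν μ h1 h2, e1, e1,
      oscInt_hankel1 hx β h3 h4, Complex.ofReal_mul]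
    field_simp
  · rw [Kfun_eq_oscInt p hr.ne' (hpos β) (hneg (-β)) s ν μ h1 h2, e1, e2,
      oscInt_macdonaldK_pos_neg hx β h3 h4, Complex.ofReal_mul]
    field_simp
  · rw [Kfun_eq_oscInt p hr.ne' (hneg β) (hneg (-β)) s ν μ h1 h2, e2, e2,
      oscInt_hankel2 hx β h3 h4, Complex.ofReal_mul]
    field_simp
  · rw [Kfun_eq_oscInt p hr.ne' (hneg β) (hpos (-β)) s ν μ h1 h2, e1, e2,
      oscInt_macdonaldK_neg_pos hx β h3 h4, Complex.ofReal_mul]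
    field_simp

end

end FracPoincare

end

open FracPoincare in
theorem mainTheorem3 (p : ℕ) [NeZero p] (hp : Odd p) (q h : ℂ) (hq : IsPrimitiveRoot q p)
    (hh : h ^ 2 = q) (hhp : h ^ p = -1) (r : ℝ) :
    -- the Fourier transform of the series `T_r` converges
    (∀ F ∈ FVec p, ∀ (g : Pt) (b : Idx p) (l : ZMod p) (ν : ℂ),
      Summable (QrTerm p q h r F g b l ν)) ∧
    -- and is a pseudo-unitary corepresentation
    IsPseudoUnitaryCorep p q (Qr p q h r) ∧
    -- the integrals `K_s^r` converge
    (r ≠ 0 → ∀ g : Pt, g.1 ≠ 0 → g.2.1 ≠ 0 → ∀ (s : ℤ) (ν μ : ℂ),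
      -1 < (ν - μ + s / p).re → (ν - μ + s / p).re < 1 →
      HasImproperIntegral (KIntegrand p r s ν μ g)
        (improperIntegral (KIntegrand p r s ν μ g))) ∧
    -- `Q_r(F(ν) t^k) = ∫_{c-i∞}^{c+i∞} dμ ∑_l Q_{kl}^r(ν, μ, g) F(μ) t^l`, as a weak integral
    (r ≠ 0 → ∀ g : Pt, g.1 ≠ 0 → g.2.1 ≠ 0 → ∀ F ∈ PW, ∀ (k l : ZMod p) (ν : ℂ) (c : ℝ),
      |ν.re - c| < 1 / p → ∀ χ : QAlg p q →ₗ[ℂ] ℂ,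
      MeasureTheory.Integrable (fun τ : ℝ =>
        χ (kernel p q h r k.val l.val ν (c + τ * Complex.I) g) * F (c + τ * Complex.I)) ∧
      χ (∑ b : Idx p, Qr p q h r (Pi.single k F) g b l ν • basisElt p q b) =
        verticalIntegral c (fun μ => χ (kernel p q h r k.val l.val ν μ g) * F μ)) ∧
    -- the values of `K_s^r` in the four quadrants
    (0 < r → ∀ (s : ℤ) (ν μ : ℂ) (ρ β lam : ℝ), 0 < ρ →
      -1 < (ν - μ + s / p).re → (ν - μ + s / p).re < 1 →
      Kfun p r s ν μ (1 / 2 * ρ * Real.exp β, 1 / 2 * ρ * Real.exp (-β), lam) =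
        1 / 2 * Complex.exp ((μ - ν - s / p) * (β + Real.pi * Complex.I / 2) + μ * lam) *
          hankel1 (μ - ν - s / p) (r * ρ) ∧
      Kfun p r s ν μ (1 / 2 * ρ * Real.exp β, -(1 / 2 * ρ * Real.exp (-β)), lam) =
        1 / (Real.pi * Complex.I) *
          Complex.exp ((μ - ν - s / p) * (β - Real.pi * Complex.I / 2) + μ * lam) *
          macdonaldK (μ - ν - s / p) (r * ρ) ∧
      Kfun p r s ν μ (-(1 / 2 * ρ * Real.exp β), -(1 / 2 * ρ * Real.exp (-β)), lam) =
        -(1 / 2) * Complex.exp ((μ - ν - s / p) * (β - Real.pi * Complex.I / 2) + μ * lam) *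
          hankel2 (μ - ν - s / p) (r * ρ) ∧
      Kfun p r s ν μ (-(1 / 2 * ρ * Real.exp β), 1 / 2 * ρ * Real.exp (-β), lam) =
        1 / (Real.pi * Complex.I) *
          Complex.exp ((μ - ν - s / p) * (β + Real.pi * Complex.I / 2) + μ * lam) *
          macdonaldK (μ - ν - s / p) (r * ρ)) := by
  have hq1 := hq.pow_eq_one
  refine ⟨?_, ⟨?_, ?_, ?_, ?_, ?_, ?_, ?_⟩, ?_, ?_, ?_⟩
  · exact fun F hF g b l ν => summable_QrTerm hq1 r hF g b l ν
  · exact fun F hF g b => Qr_mem hq1 r hF g b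
  · exact fun F hF b l ν => contDiff_Qr hq1 r hF b l ν
  · exact fun F hF G hG => Qr_add hq1 r hF hG
  · exact fun F hF a => Qr_smul hq1 r hF a
  · exact fun F hF l ν => counit_Qr hq r hF l ν
  · exact fun F hF g g' l ν => coprod_Qr hp hq hh hhp r hF g g' l ν
  · exact fun F hF G hG g => unitary_Qr hp hq hh hhp r hF hG g
  · exact fun hr g hg hg' s ν μ h1 h2 => hasImproperIntegral_KIntegrand p hr hg hg' s ν μ h1 h2
  · exact fun hr g hg hg' F hF k l ν c hc χ =>
      Qr_eq_kernel hp hq hh hhp hr hg hg' hF k l ν c hc χ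
  · exact fun hr s ν μ ρ β lam hρ h1 h2 => Kfun_values p hr s ν μ ρ β lam hρ h1 h2
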